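/- Let $\mathbb T^2=\mathbb R^2/\mathbb Z^2$ with its Lebesgue probability measure $dx$, let $\varepsilon\in(0,1)$, and let $K:\mathbb T^2\to\mathbb R^2$ be an interaction kernel of modified SQG type: $K$ is smooth on $\mathbb T^2\setminus\{0\}$, $K(-x)=-K(x)$, $K(0)=0$, $|K(x)|\le C|x|^{-(2-\varepsilon)}$ for small $|x|$, and $K=\nabla^\perp G$ on $\mathbb T^2\setminus\{0\}$, where $G$ is smooth on $\mathbb T^2\setminus\{0\}$ and $|x|^{1-\varepsilon}G(x)\to a$ as $x\to0$ for some $a\neq0$. For $\phi\in C^\infty(\mathbb T^2)$ put $H_\phi(x,y)=K(x-y)\cdot(\nabla\phi(x)-\nabla\phi(y))$. For $N\ge1$ let $\xi=(\xi_1,\dots,\xi_N)$ and $X_0=(X_0^1,\dots,X_0^N)$ be random with joint law $\lambda_N^0=(\otimes_N N(0,1))\otimes \mathrm{Leb}_{2N}$, i.e. all these variables are independent, $\xi_n\sim N(0,1)$, and $X^n_0$ is uniform on $\mathbb T^2$. Let $\Delta_N$ be the set of $x\in(\mathbb T^2)^N$ with $x_i=x_j$ for some $i\ne j$. Then almost surely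 the system $$\frac{dX^i_t}{dt}=\frac1{\sqrt N}\sum_{j=1}^N\xi_jK(X^i_t-X^j_t),\qquad i=1,\dots,N,$$ has a unique solution $X:[0,\infty)\to\Delta_N^c$ starting from $X_0$, and the measure-valued field $\theta^N_t=N^{-1/2}\sum_{n=1}^N\xi_n\delta_{X^n_t}$ has the following properties. (i) $(\theta^N_t)_{t\ge0}$ is stationary (its finite-dimensional distributions are invariant under time shifts $t\mapsto t+h$, $h\ge0$) and space homogeneous (they are invariant under translations of $\mathbb T^2$). (ii) Almost surely, $\partial_t\langle\theta^N_t,\phi\rangle=\tfrac12\langle\theta^N_t\otimes\theta^N_t,H_\phi\rangle$ for all $t>0$ and all $\phi\in C^\infty(\mathbb T^2)$. (iii) $H_\phi\in L^2(\mathbb T^2\times\mathbb T^2)$ and $\mathbb E\big[\langle\theta^N_t\otimes\theta^N_t,H_\phi\rangle^2\big]\le c\,\|H_\phi\|^2_{L^2(\mathbb T^2\times\mathbb T^2)}$ for all $t>0$, $N\ge1$ and $\phi\in C^\infty(\mathbb T^2)$, with an absolute constant $c$. (iv) For all $p\ge1$ and $\delta>0$ there is a constant $c_{p,\delta}$, depending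 only on $p$ and $\delta$, with $\mathbb E\big[\|\theta^N_t\|^p_{H^{-1-\delta}}\big]\le c_{p,\delta}$ for all $t\ge0$ and $N\ge1$. Here $\|\omega\|_{H^s}^2=\sum_{n\in\mathbb Z^2}(1+|n|^2)^s|\langle\omega,e_n\rangle|^2$ with $e_n(x)=e^{2\pi i n\cdot x}$. (v) For every $t>0$ and $\delta>0$, as $N\to\infty$, $\theta^N_t$ converges in law in $H^{-1-\delta}(\mathbb T^2)$ to white noise, i.e. to the centred Gaussian random distribution $\omega$ with $\mathbb E[\langle\omega,\phi\rangle\langle\omega,\psi\rangle]=\int_{\mathbb T^2}\phi\psi\,dx$ for all $\phi,\psi\in C^\infty(\mathbb T^2)$. -/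

import Mathlib

open MeasureTheory ProbabilityTheory Filter Set
open scoped Topology

noncomputable section

section Smooth

open scoped ContDiff

/-! ## The torus, smooth functions and the kernel -/

/-- The two-dimensional unit torus `ℝ² / ℤ²`; its `volume` is the Lebesgue probability measure. -/
abbrev Torus : Type := UnitAddTorus (Fin 2)

/-- The Euclidean plane. -/
abbrev Plane : Type := EuclideanSpace ℝ (Fin 2)

/-- The quotient map `ℝ² → ℝ² / ℤ²`. -/
def torusProj (x : Plane) : Torus := fun i => (x i : UnitAddCircle)

lemma torusProj_surjective : Function.Surjective torusProj := by
  intro p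
  choose f hf using fun i => QuotientAddGroup.mk_surjective (p i)
  exact ⟨WithLp.toLp 2 f, funext hf⟩

/-- Real-valued `C^∞` functions on the torus: those whose periodic lift to the plane is smooth. -/
def SmoothTorusFn : Submodule ℝ (Torus → ℝ) where
  carrier := {φ | ContDiff ℝ ∞ (fun x : Plane => φ (torusProj x))}
  add_mem' {a b} ha hb := by
    rw [mem_ofPred_eq] at ha hb ⊢
    exact ha.add hb
  zero_mem' := by
    rw [mem_ofPred_eq]
    exact contDiff_const
  smul_mem' c a ha := by
    rw [mem_ofPred_eq] at ha ⊢
    exact ha.const_smul c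

/-- The `i`-th partial derivative of a function on the torus. -/
def torusPartial (i : Fin 2) (φ : Torus → ℝ) (p : Torus) : ℝ :=
  deriv (fun s : ℝ => φ (p + Pi.single i (s : UnitAddCircle))) 0

/-- The gradient `∇φ = (∂₁φ, ∂₂φ)`. -/
def torusGrad (φ : Torus → ℝ) (p : Torus) : Plane := !₂[torusPartial 0 φ p, torusPartial 1 φ p]

/-- The rotated gradient `∇^⊥φ = (-∂₂φ, ∂₁φ)`. -/
def torusPerpGrad (φ : Torus → ℝ) (p : Torus) : Plane :=
  !₂[-torusPartial 1 φ p, torusPartial 0 φ p]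

/-- The interaction kernels of the modified SQG equation with parameter `ε`: `K` is odd, smooth off
the origin, `K(0) = 0`, `|K(x)| ≤ c / |x|^(2-ε)` for small `|x|`, and `K = ∇^⊥ G` off the origin,
where `G` is smooth off the origin with singular part `a / |x|^(1-ε)`, `a ≠ 0`. -/
structure IsVortexKernel (ε : ℝ) (K : Torus → Plane) : Prop where
  smooth : ContDiffOn ℝ ∞ (fun x : Plane => K (torusProj x)) {x | torusProj x ≠ 0}
  odd : ∀ p, K (-p) = -K p
  zero : K 0 = 0
  bound : ∃ c : ℝ, ∀ᶠ x : Plane in 𝓝[≠] 0, ‖K (torusProj x)‖ ≤ c / ‖x‖ ^ (2 - ε)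
  green : ∃ G : Torus → ℝ,
    ContDiffOn ℝ ∞ (fun x : Plane => G (torusProj x)) {x | torusProj x ≠ 0} ∧
    (∀ p, p ≠ 0 → K p = torusPerpGrad G p) ∧
    ∃ a : ℝ, a ≠ 0 ∧
      Tendsto (fun x : Plane => ‖x‖ ^ (1 - ε) * G (torusProj x)) (𝓝[≠] 0) (𝓝 a)

end Smooth

/-- `H_φ(x, y) = K(x - y) · (∇φ(x) - ∇φ(y))`. -/
def vortexH (K : Torus → Plane) (φ : Torus → ℝ) (p : Torus × Torus) : ℝ :=
  inner ℝ (K (p.1 - p.2)) (torusGrad φ p.1 - torusGrad φ p.2)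

/-! ## Point vortex dynamics -/

/-- The set `Δ_N` of configurations in which two vortices coincide. -/
def collisionSet (N : ℕ) : Set (Fin N → Torus) := {x | ∃ i j, i ≠ j ∧ x i = x j}

/-- `X : [0, ∞) → Δ_Nᶜ` solves `dX^i/dt = N^{-1/2} ∑_j ξ_j K(X^i - X^j)`, `X_0 = x₀`. The derivative
of a curve on the torus is that of a lift `Y` to the plane. Only times `t ≥ 0` matter. -/
structure IsVortexSolution {N : ℕ} (K : Torus → Plane) (ξ : Fin N → ℝ) (x₀ : Fin N → Torus)
    (X : ℝ → Fin N → Torus) : Prop where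
  initial : X 0 = x₀
  noCollision : ∀ t, 0 ≤ t → X t ∉ collisionSet N
  ode : ∃ Y : ℝ → Fin N → Plane, ∀ t, 0 ≤ t → ∀ i,
    torusProj (Y t i) = X t i ∧
    HasDerivWithinAt (fun s => Y s i)
      ((√(N : ℝ))⁻¹ • ∑ j, ξ j • K (X t i - X t j)) (Ici 0) t

open Classical in
/-- The vortex dynamics `t ↦ (X^1_t, …, X^N_t)` with intensities `ξ` and initial positions `x₀`: the
global collision-free solution if there is one, and constant otherwise. -/
def vortexFlow {N : ℕ} (K : Torus → Plane) (ξ : Fin N → ℝ) (x₀ : Fin N → Torus) :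
    ℝ → Fin N → Torus :=
  if h : ∃ X, IsVortexSolution K ξ x₀ X then h.choose else fun _ => x₀

/-- The measure `N^{-1/2} ∑_n ξ_n δ_{x_n}`. -/
def pointVortexMeasure {N : ℕ} (ξ : Fin N → ℝ) (x : Fin N → Torus) : SignedMeasure Torus :=
  (√(N : ℝ))⁻¹ • ∑ n, ξ n • VectorMeasure.dirac (x n) (1 : ℝ)

/-- The measure-valued field `θ^N_t(ξ, x₀) = N^{-1/2} ∑_n ξ_n δ_{X^n_t(ξ, x₀)}`. -/
def vortexField {N : ℕ} (K : Torus → Plane) (ξ : Fin N → ℝ) (x₀ : Fin N → Torus) (t : ℝ) :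
    SignedMeasure Torus :=
  pointVortexMeasure ξ (vortexFlow K ξ x₀ t)

/-- The law `λ⁰_N = (⊗_N N(0,1)) ⊗ Leb_{2N}` of intensities and initial positions. -/
def vortexLaw (N : ℕ) : Measure ((Fin N → ℝ) × (Fin N → Torus)) :=
  (Measure.pi fun _ => gaussianReal 0 1).prod volume

/-- `⟨μ ⊗ μ, F⟩`, the integral of `F` against the product signed measure `μ ⊗ μ`. -/
def tensorPair (μ : SignedMeasure Torus) (F : Torus × Torus → ℝ) : ℝ :=
  ∫ᵛ p, F p ∂•(VectorMeasure.prod μ μ (ContinuousLinearMap.mul ℝ ℝ))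

/-! ## Distributions -/

/-- The linear functionals `T` on `C^∞(𝕋²)` with `|T φ| ≤ C ‖φ‖_{C^k}` for some `k` and `C`. -/
def distributionSubmodule : Submodule ℝ (SmoothTorusFn →ₗ[ℝ] ℝ) where
  carrier := {T | ∃ (k : ℕ) (C : ℝ), ∀ (φ : SmoothTorusFn) (M : ℝ),
    (∀ j ≤ k, ∀ x : Plane, ‖iteratedFDeriv ℝ j (fun y : Plane => φ.1 (torusProj y)) x‖ ≤ M) →
      |T φ| ≤ C * M}
  add_mem' := by
    rintro S T ⟨k, C, hS⟩ ⟨l, D, hT⟩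
    refine ⟨max k l, C + D, fun φ M h => ?_⟩
    have h1 := hS φ M fun j hj => h j (hj.trans (le_max_left _ _))
    have h2 := hT φ M fun j hj => h j (hj.trans (le_max_right _ _))
    rw [LinearMap.add_apply, add_mul]
    exact (abs_add_le _ _).trans (add_le_add h1 h2)
  zero_mem' := ⟨0, 0, fun φ M _ => by simp⟩
  smul_mem' := by
    rintro c T ⟨k, C, hT⟩
    refine ⟨k, |c| * C, fun φ M h => ?_⟩
    rw [LinearMap.smul_apply, smul_eq_mul, abs_mul, mul_assoc]
    exact mul_le_mul_of_nonneg_left (hT φ M h) (abs_nonneg c)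

/-- The space `C^∞(𝕋²)'` of real distributions on the torus. -/
def TorusDistribution : Type := distributionSubmodule

namespace TorusDistribution

instance : AddCommGroup TorusDistribution := inferInstanceAs (AddCommGroup distributionSubmodule)

instance : Module ℝ TorusDistribution := inferInstanceAs (Module ℝ distributionSubmodule)

/-- The duality `⟨T, φ⟩`. -/
def pair (T : TorusDistribution) (φ : SmoothTorusFn) : ℝ := T.1 φ

@[simp] lemma pair_add (S T : TorusDistribution) (φ : SmoothTorusFn) :
    (S + T).pair φ = S.pair φ + T.pair φ := rfl

@[simp] lemma pair_smul (c : ℝ) (T : TorusDistribution) (φ : SmoothTorusFn) :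
    (c • T).pair φ = c * T.pair φ := rfl

@[simp] lemma pair_zero (φ : SmoothTorusFn) : (0 : TorusDistribution).pair φ = 0 := rfl

/-- The σ-algebra on distributions generated by the evaluations `T ↦ ⟨T, φ⟩`. -/
instance : MeasurableSpace TorusDistribution :=
  ⨆ φ : SmoothTorusFn, MeasurableSpace.comap (fun T => T.pair φ) inferInstance

end TorusDistribution

lemma mFourier_torusProj (n : Fin 2 → ℤ) (x : Plane) :
    UnitAddTorus.mFourier n (torusProj x) =
      ∏ i, Complex.exp (2 * Real.pi * Complex.I * n i * x i) := by
  simp only [UnitAddTorus.mFourier, torusProj, ContinuousMap.coe_mk, fourier_coe_apply]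
  simp

lemma contDiff_mFourier_torusProj (n : Fin 2 → ℤ) :
    ContDiff ℝ ((⊤ : ℕ∞) : WithTop ℕ∞) (fun x : Plane => UnitAddTorus.mFourier n (torusProj x)) := by
  simp only [mFourier_torusProj]
  refine contDiff_prod fun i _ => ContDiff.cexp (contDiff_const.mul ?_)
  exact Complex.ofRealCLM.contDiff.comp (EuclideanSpace.proj (𝕜 := ℝ) i).contDiff

/-- The real part of `e_n(x) = e^{2πi n·x}`. -/
def torusCos (n : Fin 2 → ℤ) : SmoothTorusFn :=
  ⟨fun x => (UnitAddTorus.mFourier n x).re,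
    Complex.reCLM.contDiff.comp (contDiff_mFourier_torusProj n)⟩

/-- The imaginary part of `e_n(x) = e^{2πi n·x}`. -/
def torusSin (n : Fin 2 → ℤ) : SmoothTorusFn :=
  ⟨fun x => (UnitAddTorus.mFourier n x).im,
    Complex.imCLM.contDiff.comp (contDiff_mFourier_torusProj n)⟩

/-- The Fourier coefficient `⟨T, e_n⟩`, as a linear function of `T`. -/
def distFourier (n : Fin 2 → ℤ) : TorusDistribution →ₗ[ℝ] ℂ where
  toFun T := ⟨T.pair (torusCos n), T.pair (torusSin n)⟩
  map_add' _ _ := rfl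
  map_smul' c T := by apply Complex.ext <;> simp

/-! ## Sobolev spaces -/

/-- The weight `(1 + |n|²)^s`. -/
def sobolevWeight (s : ℝ) (n : Fin 2 → ℤ) : ℝ := (1 + ∑ i, (n i : ℝ) ^ 2) ^ s

lemma sobolevWeight_nonneg (s : ℝ) (n : Fin 2 → ℤ) : 0 ≤ sobolevWeight s n :=
  Real.rpow_nonneg (by positivity) s

/-- The distributions `T` with `∑_n (1 + |n|²)^s |⟨T, e_n⟩|² < ∞`. -/
def sobolevSubmodule (s : ℝ) : Submodule ℝ TorusDistribution where
  carrier := {T | Summable fun n => sobolevWeight s n * ‖distFourier n T‖ ^ 2}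
  add_mem' := by
    intro S T hS hT
    refine Summable.of_nonneg_of_le
      (fun n => mul_nonneg (sobolevWeight_nonneg s n) (sq_nonneg _)) (fun n => ?_)
      ((Summable.add hS hT).mul_left 2)
    have h : ‖distFourier n (S + T)‖ ^ 2 ≤
        2 * (‖distFourier n S‖ ^ 2 + ‖distFourier n T‖ ^ 2) := by
      rw [map_add]
      nlinarith [norm_add_le (distFourier n S) (distFourier n T),
        norm_nonneg (distFourier n S + distFourier n T),
        sq_nonneg (‖distFourier n S‖ - ‖distFourier n T‖)]
    calc sobolevWeight s n * ‖distFourier n (S + T)‖ ^ 2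
        ≤ sobolevWeight s n * (2 * (‖distFourier n S‖ ^ 2 + ‖distFourier n T‖ ^ 2)) :=
          mul_le_mul_of_nonneg_left h (sobolevWeight_nonneg s n)
      _ = _ := by ring
  zero_mem' := by simp [summable_zero]
  smul_mem' := by
    intro c T hT
    refine (Summable.mul_left (c ^ 2) hT).congr fun n => ?_
    rw [map_smul, norm_smul, mul_pow, Real.norm_eq_abs, sq_abs]
    ring

/-- The Sobolev space `H^s(𝕋²)`. -/
def SobolevSpace (s : ℝ) : Type := sobolevSubmodule s

namespace SobolevSpace

variable {s : ℝ}

/-- The distribution underlying an element of `H^s`. -/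
def toDistribution (T : SobolevSpace s) : TorusDistribution := T.1

instance : AddCommGroup (SobolevSpace s) := inferInstanceAs (AddCommGroup (sobolevSubmodule s))

lemma norm_sq_weighted (T : TorusDistribution) (n : Fin 2 → ℤ) :
    ‖√(sobolevWeight s n) • distFourier n T‖ ^ 2 = sobolevWeight s n * ‖distFourier n T‖ ^ 2 := by
  rw [norm_smul, mul_pow, Real.norm_eq_abs, sq_abs, Real.sq_sqrt (sobolevWeight_nonneg s n)]

/-- The map `T ↦ ((1 + |n|²)^{s/2} ⟨T, e_n⟩)_n` from `H^s` to `ℓ²(ℤ²)`. -/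
def toSeq : SobolevSpace s →+ lp (fun _ : Fin 2 → ℤ => ℂ) 2 where
  toFun T := ⟨fun n => √(sobolevWeight s n) • distFourier n T.toDistribution, by
    refine memℓp_gen (T.2.congr fun n => ?_)
    rw [ENNReal.toReal_ofNat, Real.rpow_ofNat]
    exact (norm_sq_weighted _ n).symm⟩
  map_zero' := by
    ext n : 2
    change √(sobolevWeight s n) • distFourier n 0 = 0
    simp
  map_add' S T := by
    ext n : 2
    change √(sobolevWeight s n) • distFourier n (S.toDistribution + T.toDistribution) = _
    rw [map_add, smul_add]
    rfl

/-- `H^s` with the norm `‖T‖² = ∑_n (1 + |n|²)^s |⟨T, e_n⟩|²`; see `SobolevSpace.norm_sq_eq`. -/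
instance : SeminormedAddCommGroup (SobolevSpace s) :=
  SeminormedAddCommGroup.induced _ _ (toSeq (s := s))

lemma norm_sq_eq (T : SobolevSpace s) :
    ‖T‖ ^ 2 = ∑' n, sobolevWeight s n * ‖distFourier n T.toDistribution‖ ^ 2 := by
  have h : ‖T‖ = ‖toSeq T‖ := rfl
  have h2 := lp.norm_rpow_eq_tsum (p := 2) (by norm_num) (toSeq T)
  simp only [ENNReal.toReal_ofNat, Real.rpow_ofNat] at h2
  rw [h, h2]
  exact tsum_congr fun n => norm_sq_weighted _ n

instance : MeasurableSpace (SobolevSpace s) := borel _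

instance : BorelSpace (SobolevSpace s) := ⟨rfl⟩

end SobolevSpace

/-! ## Signed measures as distributions -/

instance isFiniteMeasure_variation_signedMeasure (μ : SignedMeasure Torus) :
    IsFiniteMeasure μ.variation := by
  rw [← SignedMeasure.totalVariation_eq_variation]
  infer_instance

lemma isOpenQuotientMap_torusProj : IsOpenQuotientMap torusProj := by
  have h : IsOpenQuotientMap (Pi.map fun _ : Fin 2 => ((↑) : ℝ → UnitAddCircle)) :=
    IsOpenQuotientMap.piMap fun _ => QuotientAddGroup.isOpenQuotientMap_mk
  exact h.comp (EuclideanSpace.equiv (Fin 2) ℝ).toHomeomorph.isOpenQuotientMap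

lemma continuous_smoothTorusFn (φ : SmoothTorusFn) : Continuous φ.1 := by
  have h : ContDiff ℝ ((⊤ : ℕ∞) : WithTop ℕ∞) (fun x : Plane => φ.1 (torusProj x)) := φ.2
  exact isOpenQuotientMap_torusProj.isQuotientMap.continuous_iff.mpr h.continuous

lemma integrable_smoothTorusFn (φ : SmoothTorusFn) (μ : SignedMeasure Torus) :
    μ.Integrable φ.1 :=
  (continuous_smoothTorusFn φ).integrable_of_hasCompactSupport (HasCompactSupport.of_compactSpace _)

lemma abs_integral_le_of_abs_le (μ : SignedMeasure Torus) (f : Torus → ℝ) (M : ℝ)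
    (h : ∀ x, |f x| ≤ M) : |∫ᵛ x, f x ∂•μ| ≤ μ.variation.real univ * M := by
  have h1 := VectorMeasure.norm_integral_le_of_norm_le_const (μ := μ)
    (B := ContinuousLinearMap.lsmul ℝ ℝ) (f := f) (C := M)
    (Filter.Eventually.of_forall h)
  have h0 : 0 ≤ M := (abs_nonneg _).trans (h 0)
  have h2 : ‖(ContinuousLinearMap.lsmul ℝ ℝ : ℝ →L[ℝ] ℝ →L[ℝ] ℝ)‖ ≤ 1 :=
    ContinuousLinearMap.opNorm_lsmul_le
  calc |∫ᵛ x, f x ∂•μ| ≤ M * ‖(ContinuousLinearMap.lsmul ℝ ℝ : ℝ →L[ℝ] ℝ →L[ℝ] ℝ)‖ *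
        μ.variation.real univ := h1
    _ ≤ M * 1 * μ.variation.real univ := by gcongr
    _ = _ := by ring

/-- The distribution `φ ↦ ∫ φ dμ` given by a signed measure `μ`. -/
def measureDistribution (μ : SignedMeasure Torus) : TorusDistribution :=
  ⟨{  toFun := fun φ => ∫ᵛ x, φ.1 x ∂•μ
      map_add' := fun φ ψ => VectorMeasure.integral_fun_add
        (integrable_smoothTorusFn φ μ) (integrable_smoothTorusFn ψ μ)
      map_smul' := fun c φ => VectorMeasure.integral_fun_smul μ _ c φ.1 },
    0, μ.variation.real univ, fun φ M h => by
      refine abs_integral_le_of_abs_le μ φ.1 M fun x => ?_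
      obtain ⟨y, rfl⟩ := torusProj_surjective x
      simpa using h 0 le_rfl y⟩

lemma summable_sobolevWeight {s : ℝ} (hs : s < -1) : Summable (sobolevWeight s) := by
  have h := EisensteinSeries.summable_one_div_norm_rpow (k := -2 * s) (by linarith)
  refine Summable.of_norm_bounded_eventually h ?_
  have h0 : ∀ᶠ n : Fin 2 → ℤ in cofinite, n ≠ 0 := by
    simp
  filter_upwards [h0] with n hn
  have hpos : 0 < ‖n‖ := norm_pos_iff.mpr hn
  have hle : ‖n‖ ^ 2 ≤ 1 + ∑ i, (n i : ℝ) ^ 2 := by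
    have h1 : ‖n‖ ≤ √(1 + ∑ i, (n i : ℝ) ^ 2) := by
      refine (pi_norm_le_iff_of_nonneg (Real.sqrt_nonneg _)).mpr fun i => ?_
      rw [Int.norm_eq_abs]
      refine Real.abs_le_sqrt ?_
      have := Finset.single_le_sum (f := fun i => (n i : ℝ) ^ 2) (fun i _ => sq_nonneg _)
        (Finset.mem_univ i)
      linarith
    calc ‖n‖ ^ 2 ≤ √(1 + ∑ i, (n i : ℝ) ^ 2) ^ 2 := by gcongr
      _ = _ := Real.sq_sqrt (by positivity)
  rw [Real.norm_of_nonneg (sobolevWeight_nonneg s n), sobolevWeight]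
  calc (1 + ∑ i, (n i : ℝ) ^ 2) ^ s ≤ (‖n‖ ^ 2) ^ s :=
        Real.rpow_le_rpow_of_nonpos (by positivity) hle (by linarith)
    _ = ‖n‖ ^ (-(-2 * s)) := by
        rw [← Real.rpow_natCast, ← Real.rpow_mul hpos.le]
        congr 1
        push_cast
        ring

/-- A signed measure on the torus lies in `H^{-1-δ}` for every `δ > 0`. -/
lemma measureDistribution_mem (μ : SignedMeasure Torus) {δ : ℝ} (hδ : 0 < δ) :
    measureDistribution μ ∈ sobolevSubmodule (-1 - δ) := by
  set V := μ.variation.real univ with hV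
  have hV0 : 0 ≤ V := measureReal_nonneg
  have hone : ∀ n x, ‖UnitAddTorus.mFourier (d := Fin 2) n x‖ ≤ 1 := fun n x =>
    ((UnitAddTorus.mFourier n).norm_coe_le_norm x).trans_eq UnitAddTorus.mFourier_norm
  have hc : ∀ n, ‖distFourier n (measureDistribution μ)‖ ≤ 2 * V := fun n => by
    have h1 : |∫ᵛ x, (UnitAddTorus.mFourier n x).re ∂•μ| ≤ V * 1 :=
      abs_integral_le_of_abs_le μ _ 1 fun x => (Complex.abs_re_le_norm _).trans (hone n x)
    have h2 : |∫ᵛ x, (UnitAddTorus.mFourier n x).im ∂•μ| ≤ V * 1 :=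
      abs_integral_le_of_abs_le μ _ 1 fun x => (Complex.abs_im_le_norm _).trans (hone n x)
    refine (Complex.norm_le_abs_re_add_abs_im _).trans ?_
    change |∫ᵛ x, (UnitAddTorus.mFourier n x).re ∂•μ| +
      |∫ᵛ x, (UnitAddTorus.mFourier n x).im ∂•μ| ≤ _
    linarith
  refine Summable.of_nonneg_of_le
    (fun n => mul_nonneg (sobolevWeight_nonneg _ n) (sq_nonneg _)) (fun n => ?_)
    ((summable_sobolevWeight (s := -1 - δ) (by linarith)).mul_right ((2 * V) ^ 2))
  have := hc n
  have h0 := sobolevWeight_nonneg (-1 - δ) n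
  gcongr

/-- A signed measure as an element of `H^{-1-δ}`. -/
def measureSobolev (μ : SignedMeasure Torus) {δ : ℝ} (hδ : 0 < δ) : SobolevSpace (-1 - δ) :=
  ⟨measureDistribution μ, measureDistribution_mem μ hδ⟩

/-! ## White noise -/

/-- `W` is a white noise on the torus: a centred Gaussian random distribution with
`E[⟨W, φ⟩⟨W, ψ⟩] = ∫ φ ψ` for all smooth `φ`, `ψ`. -/
structure IsWhiteNoise {Ω : Type*} [MeasurableSpace Ω] (W : Ω → TorusDistribution)
    (P : Measure Ω) : Prop where
  gaussian : ∀ φ : SmoothTorusFn,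
    HasLaw (fun ω => (W ω).pair φ) (gaussianReal 0 (Real.toNNReal (∫ x, φ.1 x ^ 2))) P
  covariance : ∀ φ ψ : SmoothTorusFn,
    ∫ ω, (W ω).pair φ * (W ω).pair ψ ∂P = ∫ x, φ.1 x * ψ.1 x

end

noncomputable section

/-! ## Instances for the torus and its powers -/

/-! The velocity of each vortex is a divergence-free function of its own position, so formally the
flow preserves Lebesgue measure for every fixed choice of intensities. The obstacle is the
singularity of `K`. Write `K = b ∇^⊥ g` with `b = ±1` and `g → +∞` at the origin
(`IsVortexKernel.exists_greenPair`), and flatten `g` above height `n`. The truncated kernels are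
bounded, `C¹` and divergence free, so their flows are global and Liouville's theorem holds for them
(`measurePreserving_torusFlow`).

Collisions are excluded by using `g(x_i - x_j)` as a Lyapunov function. Its derivative along the
truncated flow is `∇g(x_i - x_j)` paired with the difference of two velocities. The interaction of
`i` and `j` with each other drops out, since it is parallel to `∇^⊥g(x_i - x_j)`. What remains is
bounded by products such as `|K(x_i - x_j)| |K(x_i - x_k)|` with three distinct indices. Under
Lebesgue measure the two arguments are independent and uniform, so integrability of `|K|`, i.e. `2 -
ε < 2`, is enough; square integrability is never needed. Invariance bounds the expected growth up to
time `T` uniformly in `n`, and Fatou's lemma gives, for almost every configuration, a bound valid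
for infinitely many `n`. For such an `n` above the initial height plus the growth, the truncation is
never felt (`ae_exists_mem_goodSet`). The truncated flows therefore glue to a global solution.
Conversely, every collision-free solution agrees on `[0, T]` with the truncated flow for all large
`n`, which gives uniqueness and lets invariance of the law pass to the limit (`map_vortexMap`).
Stationarity and homogeneity then follow from the semigroup property and from translation invariance
of the dynamics.

The evolution equation is the chain rule followed by symmetrisation, using that `K` is odd. The
estimates and the limit theorem concern a single time, so by invariance they are statements about
independent intensities and positions. `H_φ` is square integrable because the Lipschitz gradient of
`φ` gains one power of the distance; in `E⟨θ⊗θ, H_φ⟩²` only the two pairings of indices survive the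
sign symmetry of the Gaussians (`integral_sq_tensorPair_le`). Given the positions, `⟨θ, φ⟩` is
Gaussian with variance at most `sup φ²`, so all Fourier coefficients have uniformly bounded moments,
and the summable weights of `H^{-1-δ}` turn this into a norm bound.

For the convergence, the characteristic functional equals `(∫ exp(-φ²/(2N)))^N` and tends to
`exp(-∫φ²/2)` (`integral_cexp_pair_vortexLaw`, `tendsto_integral_exp_pow`). Uniform second moments
control the Fourier tail in `H^{-1-δ}`, so convergence in law reduces to finitely many coefficients
(`tendsto_of_tendsto_charFunctional`). The limit law is built from independent Gaussian coefficients
in a real trigonometric basis (`whiteNoiseLaw`). -/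

instance : IsProbabilityMeasure (volume : Measure UnitAddCircle) := ⟨by simp⟩

instance : IsProbabilityMeasure (volume : Measure Torus) :=
  inferInstanceAs (IsProbabilityMeasure (Measure.pi fun _ : Fin 2 => (volume : Measure UnitAddCircle)))

instance : Measure.IsAddHaarMeasure (volume : Measure Torus) :=
  inferInstanceAs
    (Measure.IsAddHaarMeasure (Measure.pi fun _ : Fin 2 => (volume : Measure UnitAddCircle)))

instance : BorelSpace Torus := inferInstanceAs (BorelSpace (Fin 2 → UnitAddCircle))

instance : SecondCountableTopology UnitAddCircle :=
  inferInstanceAs (SecondCountableTopology (AddCircle (1 : ℝ)))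

instance : SecondCountableTopology Torus :=
  inferInstanceAs (SecondCountableTopology (Fin 2 → UnitAddCircle))

instance (N : ℕ) : IsProbabilityMeasure (volume : Measure (Fin N → Torus)) :=
  inferInstanceAs (IsProbabilityMeasure (Measure.pi fun _ : Fin N => (volume : Measure Torus)))

instance (N : ℕ) : Measure.IsAddHaarMeasure (volume : Measure (Fin N → Torus)) :=
  Measure.pi.isAddHaarMeasure fun _ : Fin N => (volume : Measure Torus)

instance (N : ℕ) : BorelSpace (Fin N → Torus) := Pi.borelSpace

/-! ## The covering map of the torus -/

lemma torusProj_add (x y : Plane) : torusProj (x + y) = torusProj x + torusProj y := by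
  ext i; simp [torusProj]

lemma torusProj_neg (x : Plane) : torusProj (-x) = -torusProj x := by
  ext i; simp [torusProj]

lemma torusProj_sub (x y : Plane) : torusProj (x - y) = torusProj x - torusProj y := by
  ext i; simp [torusProj]

lemma torusProj_zero : torusProj 0 = 0 := by
  ext i; simp [torusProj]

lemma continuous_torusProj : Continuous torusProj := isOpenQuotientMap_torusProj.continuous

lemma torusProj_smul_single (s : ℝ) (i : Fin 2) :
    torusProj (s • EuclideanSpace.single i (1 : ℝ)) = Pi.single i (s : UnitAddCircle) := by
  ext j
  by_cases h : j = i
  · subst h; simp [torusProj]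
  · simp [torusProj, h]

lemma lipschitzWith_torusProj : LipschitzWith 1 torusProj := by
  refine LipschitzWith.of_dist_le_mul fun x y => ?_
  rw [NNReal.coe_one, one_mul, dist_pi_le_iff dist_nonneg]
  intro i
  have h : dist (torusProj x i) (torusProj y i) ≤ ‖(x - y) i‖ := by
    rw [dist_eq_norm]
    have : torusProj x i - torusProj y i = (((x - y) i : ℝ) : UnitAddCircle) := by
      simp [torusProj]
    rw [this]
    exact QuotientAddGroup.norm_mk_le_norm
  exact h.trans ((PiLp.norm_apply_le (x - y) i).trans_eq (dist_eq_norm x y).symm)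

/-- The representative of a point of the torus in `(-1/2, 1/2]²`. -/
def torusLift (p : Torus) : Plane :=
  WithLp.toLp 2 fun i => (AddCircle.equivIoc (1 : ℝ) (-1 / 2) (p i)).1

@[simp] lemma torusProj_torusLift (p : Torus) : torusProj (torusLift p) = p := by
  ext i
  exact (AddCircle.equivIoc (1 : ℝ) (-1 / 2)).symm_apply_apply (p i)

/-- The fundamental cube `(-1/2, 1/2]²`. -/
def torusCube : Set Plane := {x | ∀ i, x i ∈ Ioc (-1 / 2 : ℝ) (-1 / 2 + 1)}

lemma torusLift_mem (p : Torus) : torusLift p ∈ torusCube := fun i =>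
  (AddCircle.equivIoc (1 : ℝ) (-1 / 2) (p i)).2

lemma torusLift_torusProj {x : Plane} (hx : x ∈ torusCube) : torusLift (torusProj x) = x := by
  ext i
  have : (AddCircle.equivIoc (1 : ℝ) (-1 / 2)) ((x i : UnitAddCircle)) = ⟨x i, hx i⟩ :=
    (AddCircle.equivIoc (1 : ℝ) (-1 / 2)).apply_symm_apply ⟨x i, hx i⟩
  simp only [torusLift, torusProj]
  rw [this]

lemma torusLift_zero : torusLift 0 = 0 := by
  rw [← torusProj_zero]
  exact torusLift_torusProj fun i => by constructor <;> norm_num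

lemma abs_apply_le_of_mem_torusCube {x : Plane} (hx : x ∈ torusCube) (i : Fin 2) :
    |x i| ≤ 1 / 2 := by
  have := hx i
  rw [mem_Ioc] at this
  exact abs_le.mpr ⟨by linarith, by linarith⟩

lemma norm_le_one_of_mem_torusCube {x : Plane} (hx : x ∈ torusCube) : ‖x‖ ≤ 1 := by
  rw [EuclideanSpace.norm_eq, Fin.sum_univ_two]
  refine Real.sqrt_le_one.mpr ?_
  have h := fun i => abs_apply_le_of_mem_torusCube hx i
  have h0 := sq_abs (x 0)
  have h1 := sq_abs (x 1)
  rw [Real.norm_eq_abs, Real.norm_eq_abs]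
  nlinarith [h 0, h 1, abs_nonneg (x 0), abs_nonneg (x 1)]

lemma mem_torusCube_of_norm_lt {x : Plane} (hx : ‖x‖ < 1 / 2) : x ∈ torusCube := fun i => by
  have h := (PiLp.norm_apply_le x i).trans_lt hx
  rw [Real.norm_eq_abs, abs_lt] at h
  exact ⟨by linarith [h.1], by linarith [h.2]⟩

/-- The square of the identification of the circle with a half-open interval. It reduces integrals
of radial singularities and null-set questions on the torus to the plane. -/
lemma measurePreserving_torusLift :
    MeasurePreserving torusLift volume (volume.restrict torusCube) := by
  have h1 : MeasurePreserving
      (fun p : UnitAddCircle => (AddCircle.equivIoc (1 : ℝ) (-1 / 2) p).1) volume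
      (volume.restrict (Ioc (-1 / 2 : ℝ) (-1 / 2 + 1))) :=
    (measurePreserving_subtype_coe measurableSet_Ioc).comp
      (AddCircle.measurePreserving_equivIoc (T := (1 : ℝ)) (a := -1 / 2))
  have h2 := measurePreserving_pi (fun _ : Fin 2 => (volume : Measure UnitAddCircle))
    (fun _ => volume.restrict (Ioc (-1 / 2 : ℝ) (-1 / 2 + 1))) fun _ => h1
  rw [← Measure.restrict_pi_pi] at h2
  have h3 : MeasurePreserving (WithLp.toLp 2 : (Fin 2 → ℝ) → Plane)
      (volume.restrict (univ.pi fun _ => Ioc (-1 / 2 : ℝ) (-1 / 2 + 1)))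
      (volume.restrict torusCube) := by
    have h4 := (PiLp.volume_preserving_toLp (Fin 2)).restrict_preimage_emb
      (MeasurableEquiv.toLp 2 (Fin 2 → ℝ)).measurableEmbedding torusCube
    have h5 : (univ.pi fun _ => Ioc (-1 / 2 : ℝ) (-1 / 2 + 1)) =
        (WithLp.toLp 2 : (Fin 2 → ℝ) → Plane) ⁻¹' torusCube := by
      ext x
      simp only [mem_univ_pi, mem_preimage, torusCube]
      exact Iff.rfl
    rw [h5]
    exact h4
  exact h3.comp h2

/-- A continuous periodic function on the plane is bounded. -/
lemma exists_norm_le_of_periodic {F : Type*} [NormedAddCommGroup F] {f : Plane → F}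
    (hf : Continuous f) (hper : ∀ x y, torusProj x = torusProj y → f x = f y) :
    ∃ C, ∀ x, ‖f x‖ ≤ C := by
  obtain ⟨C, hC⟩ := (isCompact_closedBall (0 : Plane) 1).exists_bound_of_continuousOn hf.continuousOn
  refine ⟨C, fun x => ?_⟩
  rw [hper x (torusLift (torusProj x)) (by simp)]
  exact hC _ (by simpa using norm_le_one_of_mem_torusCube (torusLift_mem _))

/-! ## Configurations -/

/-- The projection of configurations in the plane to configurations on the torus. -/
def configProj {N : ℕ} (y : Fin N → Plane) : Fin N → Torus := fun i => torusProj (y i)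

/-- The canonical lift of a configuration. -/
def configLift {N : ℕ} (x : Fin N → Torus) : Fin N → Plane := fun i => torusLift (x i)

@[simp] lemma configProj_configLift {N : ℕ} (x : Fin N → Torus) :
    configProj (configLift x) = x := funext fun i => torusProj_torusLift (x i)

lemma configProj_add {N : ℕ} (y z : Fin N → Plane) :
    configProj (y + z) = configProj y + configProj z := funext fun _ => torusProj_add _ _

lemma isOpenQuotientMap_configProj {N : ℕ} : IsOpenQuotientMap (configProj (N := N)) :=
  IsOpenQuotientMap.piMap fun _ => isOpenQuotientMap_torusProj

lemma continuous_configProj {N : ℕ} : Continuous (configProj (N := N)) :=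
  isOpenQuotientMap_configProj.continuous

lemma lipschitzWith_configProj {N : ℕ} : LipschitzWith 1 (configProj (N := N)) := by
  refine LipschitzWith.of_dist_le_mul fun x y => ?_
  rw [NNReal.coe_one, one_mul, dist_pi_le_iff dist_nonneg]
  intro i
  have := lipschitzWith_torusProj.dist_le_mul (x i) (y i)
  rw [NNReal.coe_one, one_mul] at this
  exact this.trans (dist_le_pi_dist x y i)

/-- The lift pushes Lebesgue measure to Lebesgue measure restricted to a product of cubes, which is
absolutely continuous. This is what carries Rademacher's theorem from the plane to the torus. -/
lemma quasiMeasurePreserving_configLift {N : ℕ} :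
    Measure.QuasiMeasurePreserving (configLift (N := N)) volume volume := by
  have h := measurePreserving_pi (fun _ : Fin N => (volume : Measure Torus))
    (fun _ => volume.restrict torusCube) fun _ => measurePreserving_torusLift
  refine ⟨h.measurable, ?_⟩
  have h2 : Measure.map (configLift (N := N)) volume =
    Measure.pi fun _ => volume.restrict torusCube := h.map_eq
  rw [h2, ← Measure.restrict_pi_pi]
  exact Measure.restrict_le_self.absolutelyContinuous

end


noncomputable section

/-! ## Flows of regular kernels -/

open scoped NNReal in
/-- Global existence for a bounded Lipschitz vector field. -/
lemma exists_global_integralCurve {E : Type*} [NormedAddCommGroup E] [NormedSpace ℝ E]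
    [CompleteSpace E] {v : E → E} {L M : ℝ≥0} (hv : LipschitzWith L v) (hb : ∀ x, ‖v x‖ ≤ M)
    (x : E) : ∃ γ : ℝ → E, γ 0 = x ∧ ∀ t, HasDerivAt γ (v (γ t)) t := by
  have hloc : ∀ n : ℕ, ∃ α : ℝ → E, α 0 = x ∧
      ∀ t ∈ Icc (-(n + 1 : ℝ)) (n + 1), HasDerivWithinAt α (v (α t)) (Icc (-(n + 1 : ℝ)) (n + 1)) t := by
    intro n
    have h0 : (0 : ℝ) ∈ Icc (-(n + 1 : ℝ)) (n + 1) := by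
      constructor <;> linarith [Nat.cast_nonneg (α := ℝ) n]
    -- A curve of speed at most `M` stays within distance `M (n + 1)` during the window, so this
    -- radius leaves no constraint on the length of the time interval.
    have hp : IsPicardLindelof (fun _ => v) (⟨0, h0⟩ : Icc (-(n + 1 : ℝ)) (n + 1)) x
        (M * (n + 1)) 0 M L :=
      IsPicardLindelof.of_time_independent (fun y _ => hb y) hv.lipschitzOnWith (by simp)
    exact hp.exists_eq_forall_mem_Icc_hasDerivWithinAt₀
  choose α hα0 hα using hloc
  have hd : ∀ n : ℕ, ∀ t ∈ Ioo (-(n + 1 : ℝ)) (n + 1), HasDerivAt (α n) (v (α n t)) t :=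
    fun n t ht => (hα n t (Ioo_subset_Icc_self ht)).hasDerivAt (Icc_mem_nhds ht.1 ht.2)
  have heq : ∀ m n : ℕ, m ≤ n → EqOn (α m) (α n) (Ioo (-(m + 1 : ℝ)) (m + 1)) := by
    intro m n hmn
    have hmn' : (m : ℝ) ≤ n := by exact_mod_cast hmn
    refine ODE_solution_unique_of_mem_Ioo (v := fun _ => v) (s := fun _ => univ) (K := L) (t₀ := 0)
      (fun t _ => hv.lipschitzOnWith) ?_ (fun t ht => ⟨hd m t ht, trivial⟩)
      (fun t ht => ⟨hd n t ⟨by linarith [ht.1], by linarith [ht.2]⟩, trivial⟩) ?_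
    · constructor <;> linarith [Nat.cast_nonneg (α := ℝ) m]
    · rw [hα0, hα0]
  -- The window of index `⌈|t|⌉₊` contains `t` in its interior, so near `t` the glued curve is one
  -- of the local solutions.
  refine ⟨fun t => α ⌈|t|⌉₊ t, by simp [hα0], fun t => ?_⟩
  set n := ⌈|t|⌉₊ with hn
  have ht : |t| < n + 1 := (Nat.le_ceil _).trans_lt (by simp [hn])
  have ht' : t ∈ Ioo (-(n + 1 : ℝ)) (n + 1) := abs_lt.mp ht
  refine (hd n t ht').congr_of_eventuallyEq ?_
  have h1 : ∀ᶠ s : ℝ in 𝓝 t, |s| < n + 1 :=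
    (continuous_abs.tendsto t).eventually (gt_mem_nhds ht)
  filter_upwards [h1] with s hs
  have hs2 : |s| < (⌈|s|⌉₊ : ℝ) + 1 := (Nat.le_ceil _).trans_lt (by simp)
  rcases le_total n ⌈|s|⌉₊ with h | h
  · exact (heq _ _ h (abs_lt.mp hs)).symm
  · exact heq _ _ h (abs_lt.mp hs2)

/-- A continuously differentiable, divergence-free kernel vanishing at the origin. -/
structure RegularKernel (κ : Torus → Plane) : Prop where
  contDiff : ContDiff ℝ 1 (fun x : Plane => κ (torusProj x))
  div_eq_zero : ∀ x, ∑ i, fderiv ℝ (fun x : Plane => κ (torusProj x)) x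
    (EuclideanSpace.single i 1) i = 0
  zero : κ 0 = 0

lemma fderiv_eq_of_periodic {F : Type*} [NormedAddCommGroup F] [NormedSpace ℝ F] {f : Plane → F}
    (hper : ∀ x y, torusProj x = torusProj y → f x = f y) {x y : Plane}
    (h : torusProj x = torusProj y) : fderiv ℝ f x = fderiv ℝ f y := by
  have h1 : (fun z => f (z + (y - x))) = f := by
    funext z
    refine hper _ _ ?_
    rw [torusProj_add, torusProj_sub, h, sub_self, add_zero]
  have h2 := fderiv_comp_add_right (𝕜 := ℝ) (f := f) (x := x) (y - x)
  rw [h1] at h2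
  rw [h2]
  congr 1
  abel

/-- A `C¹` periodic function on the plane is globally Lipschitz. -/
lemma exists_lipschitzWith_of_periodic {F : Type*} [NormedAddCommGroup F] [NormedSpace ℝ F]
    {f : Plane → F} (hf : ContDiff ℝ 1 f) (hper : ∀ x y, torusProj x = torusProj y → f x = f y) :
    ∃ L, LipschitzWith L f := by
  obtain ⟨C, hC⟩ := exists_norm_le_of_periodic (hf.continuous_fderiv one_ne_zero)
    fun x y h => fderiv_eq_of_periodic hper h
  refine ⟨C.toNNReal, lipschitzWith_of_nnnorm_fderiv_le (𝕜 := ℝ) (hf.differentiable one_ne_zero)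
    fun x => ?_⟩
  rw [← NNReal.coe_le_coe, coe_nnnorm]
  exact (hC x).trans (Real.le_coe_toNNReal C)

namespace RegularKernel

variable {κ : Torus → Plane}

lemma continuous (hκ : RegularKernel κ) : Continuous κ :=
  isOpenQuotientMap_torusProj.isQuotientMap.continuous_iff.mpr hκ.contDiff.continuous

lemma exists_bound (hκ : RegularKernel κ) : ∃ M : NNReal, ∀ p, ‖κ p‖ ≤ M := by
  obtain ⟨C, hC⟩ := exists_norm_le_of_periodic hκ.contDiff.continuous
    fun x y h => congrArg κ h
  refine ⟨C.toNNReal, fun p => ?_⟩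
  have := hC (torusLift p)
  rw [torusProj_torusLift] at this
  exact this.trans (Real.le_coe_toNNReal C)

lemma exists_lipschitzWith (hκ : RegularKernel κ) :
    ∃ L, LipschitzWith L fun x : Plane => κ (torusProj x) :=
  exists_lipschitzWith_of_periodic hκ.contDiff fun _ _ h => congrArg κ h

end RegularKernel

/-- The velocity field `N^{-1/2} ∑_j ξ_j K(x_i - x_j)` of the vortex system. -/
def vortexVelocity {N : ℕ} (K : Torus → Plane) (ξ : Fin N → ℝ) (x : Fin N → Torus) :
    Fin N → Plane := fun i => (√(N : ℝ))⁻¹ • ∑ j, ξ j • K (x i - x j)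

section Velocity

variable {N : ℕ} {κ : Torus → Plane}

lemma exists_vortexVelocity_bound (hκ : RegularKernel κ) (ξ : Fin N → ℝ) :
    ∃ M : NNReal, ∀ x, ‖vortexVelocity κ ξ x‖ ≤ M := by
  obtain ⟨M, hM⟩ := hκ.exists_bound
  refine ⟨(√(N : ℝ)).toNNReal⁻¹ * ∑ j, ‖ξ j‖₊ * M, fun x => ?_⟩
  rw [pi_norm_le_iff_of_nonneg (NNReal.coe_nonneg _)]
  intro i
  rw [vortexVelocity, norm_smul, norm_inv, Real.norm_of_nonneg (Real.sqrt_nonneg _)]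
  push_cast
  rw [Real.coe_toNNReal _ (Real.sqrt_nonneg _)]
  gcongr
  refine norm_sum_le_of_le _ fun j _ => ?_
  rw [norm_smul]
  gcongr
  exact hM _

lemma exists_lipschitzWith_vortexVelocity (hκ : RegularKernel κ) (ξ : Fin N → ℝ) :
    ∃ L : NNReal, LipschitzWith L fun y : Fin N → Plane => vortexVelocity κ ξ (configProj y) := by
  obtain ⟨L, hL⟩ := hκ.exists_lipschitzWith
  refine ⟨(√(N : ℝ)).toNNReal⁻¹ * ∑ j, ‖ξ j‖₊ * (L * 2), LipschitzWith.of_dist_le_mul fun y z => ?_⟩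
  rw [dist_pi_le_iff (by positivity)]
  intro i
  rw [dist_eq_norm, vortexVelocity, vortexVelocity, ← smul_sub, norm_smul, norm_inv,
    Real.norm_of_nonneg (Real.sqrt_nonneg _), ← Finset.sum_sub_distrib]
  push_cast
  rw [Real.coe_toNNReal _ (Real.sqrt_nonneg _), mul_assoc, Finset.sum_mul]
  gcongr
  refine norm_sum_le_of_le _ fun j _ => ?_
  rw [← smul_sub, norm_smul, mul_assoc]
  gcongr
  have h1 := hL.dist_le_mul (y i - y j) (z i - z j)
  rw [dist_eq_norm, torusProj_sub, torusProj_sub] at h1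
  refine h1.trans ?_
  rw [mul_assoc]
  gcongr
  refine (dist_sub_sub_le _ _ _ _).trans ?_
  linarith [dist_le_pi_dist y z i, dist_le_pi_dist y z j]

/-- The field is linear in the intensities. This is the defect fed to Grönwall's inequality when
flows with different intensities are compared. -/
lemma norm_vortexVelocity_sub_le {M : ℝ} (hM : ∀ p, ‖κ p‖ ≤ M) (ξ ξ' : Fin N → ℝ)
    (x : Fin N → Torus) :
    ‖vortexVelocity κ ξ x - vortexVelocity κ ξ' x‖ ≤ (√(N : ℝ))⁻¹ * (N * M) * dist ξ ξ' := by
  have hM0 : 0 ≤ M := (norm_nonneg _).trans (hM 0)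
  rw [pi_norm_le_iff_of_nonneg (by positivity)]
  intro i
  rw [Pi.sub_apply, vortexVelocity, vortexVelocity, ← smul_sub, norm_smul, norm_inv,
    Real.norm_of_nonneg (Real.sqrt_nonneg _), ← Finset.sum_sub_distrib, mul_assoc]
  gcongr
  calc ‖∑ j, (ξ j • κ (x i - x j) - ξ' j • κ (x i - x j))‖
      ≤ ∑ _j : Fin N, dist ξ ξ' * M := by
        refine norm_sum_le_of_le _ fun j _ => ?_
        rw [← sub_smul, norm_smul]
        gcongr
        · exact (dist_eq_norm (ξ j) (ξ' j)).symm.trans_le (dist_le_pi_dist ξ ξ' j)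
        · exact hM _
    _ = N * M * dist ξ ξ' := by simp; ring

end Velocity

open Classical in
/-- The flow of the vortex system in the plane. -/
def planeFlow {N : ℕ} (κ : Torus → Plane) (ξ : Fin N → ℝ) (t : ℝ) (y : Fin N → Plane) :
    Fin N → Plane :=
  if h : ∃ γ : ℝ → Fin N → Plane, γ 0 = y ∧
    ∀ t, HasDerivAt γ (vortexVelocity κ ξ (configProj (γ t))) t then h.choose t else y

/-- The flow of the vortex system on the torus. -/
def torusFlow {N : ℕ} (κ : Torus → Plane) (ξ : Fin N → ℝ) (t : ℝ) (x : Fin N → Torus) :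
    Fin N → Torus := configProj (planeFlow κ ξ t (configLift x))

section Flow

variable {N : ℕ} {κ : Torus → Plane}

lemma planeFlow_spec (hκ : RegularKernel κ) (ξ : Fin N → ℝ) (y : Fin N → Plane) :
    planeFlow κ ξ 0 y = y ∧ ∀ t, HasDerivAt (fun t => planeFlow κ ξ t y)
      (vortexVelocity κ ξ (configProj (planeFlow κ ξ t y))) t := by
  obtain ⟨M, hM⟩ := exists_vortexVelocity_bound hκ ξ
  obtain ⟨L, hL⟩ := exists_lipschitzWith_vortexVelocity hκ ξ
  have h := exists_global_integralCurve hL (fun y => hM (configProj y)) y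
  have h2 : (fun t => planeFlow κ ξ t y) = h.choose := by
    funext t
    simp only [planeFlow, dif_pos h]
  have h3 : ∀ t, planeFlow κ ξ t y = h.choose t := fun t => congrFun h2 t
  rw [h2]
  simp only [h3]
  exact h.choose_spec

lemma planeFlow_zero (hκ : RegularKernel κ) (ξ : Fin N → ℝ) (y : Fin N → Plane) :
    planeFlow κ ξ 0 y = y := (planeFlow_spec hκ ξ y).1

lemma hasDerivAt_planeFlow (hκ : RegularKernel κ) (ξ : Fin N → ℝ) (y : Fin N → Plane) (t : ℝ) :
    HasDerivAt (fun t => planeFlow κ ξ t y)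
      (vortexVelocity κ ξ (configProj (planeFlow κ ξ t y))) t := (planeFlow_spec hκ ξ y).2 t

lemma continuous_planeFlow_time (hκ : RegularKernel κ) (ξ : Fin N → ℝ) (y : Fin N → Plane) :
    Continuous fun t => planeFlow κ ξ t y :=
  continuous_iff_continuousAt.mpr fun t => (hasDerivAt_planeFlow hκ ξ y t).continuousAt

/-- Uniqueness on the whole time line: the group law, lattice equivariance and time reversal all
follow by exhibiting a second solution. -/
lemma eq_planeFlow (hκ : RegularKernel κ) {ξ : Fin N → ℝ} {γ : ℝ → Fin N → Plane}
    (hγ : ∀ t, HasDerivAt γ (vortexVelocity κ ξ (configProj (γ t))) t) (t : ℝ) :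
    γ t = planeFlow κ ξ t (γ 0) := by
  obtain ⟨L, hL⟩ := exists_lipschitzWith_vortexVelocity hκ ξ
  have := ODE_solution_unique_univ (v := fun _ y => vortexVelocity κ ξ (configProj y))
    (s := fun _ => univ) (K := L) (t₀ := 0) (fun t => hL.lipschitzOnWith)
    (fun t => ⟨hγ t, trivial⟩)
    (fun t => ⟨hasDerivAt_planeFlow hκ ξ (γ 0) t, trivial⟩) (planeFlow_zero hκ ξ _).symm
  exact congrFun this t

/-- A one-sided version on a bounded interval, needed because solutions of the singular system live
on `t ≥ 0` and follow a truncated field only up to a finite time. -/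
lemma eqOn_planeFlow (hκ : RegularKernel κ) {ξ : Fin N → ℝ} {γ : ℝ → Fin N → Plane} {T : ℝ}
    (hc : ContinuousOn γ (Icc 0 T))
    (hγ : ∀ t ∈ Ico 0 T, HasDerivWithinAt γ (vortexVelocity κ ξ (configProj (γ t))) (Ici t) t) :
    EqOn γ (fun t => planeFlow κ ξ t (γ 0)) (Icc 0 T) := by
  obtain ⟨L, hL⟩ := exists_lipschitzWith_vortexVelocity hκ ξ
  exact ODE_solution_unique (v := fun _ y => vortexVelocity κ ξ (configProj y)) (K := L)
    (fun t => hL) hc hγ (continuous_planeFlow_time hκ ξ _).continuousOn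
    (fun t _ => (hasDerivAt_planeFlow hκ ξ (γ 0) t).hasDerivWithinAt)
    (planeFlow_zero hκ ξ _).symm

lemma planeFlow_add (hκ : RegularKernel κ) (ξ : Fin N → ℝ) (s t : ℝ) (y : Fin N → Plane) :
    planeFlow κ ξ (s + t) y = planeFlow κ ξ s (planeFlow κ ξ t y) := by
  have := eq_planeFlow hκ (γ := fun s => planeFlow κ ξ (s + t) y) (ξ := ξ)
    (fun s => (hasDerivAt_planeFlow hκ ξ y (s + t)).comp_add_const s t) s
  simpa using this

lemma planeFlow_add_lattice (hκ : RegularKernel κ) (ξ : Fin N → ℝ) (t : ℝ) (y z : Fin N → Plane)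
    (hz : configProj z = 0) : planeFlow κ ξ t (y + z) = planeFlow κ ξ t y + z := by
  have := eq_planeFlow hκ (γ := fun s => planeFlow κ ξ s y + z) (ξ := ξ) (fun s => by
    rw [configProj_add, hz, add_zero]
    exact (hasDerivAt_planeFlow hκ ξ y s).add_const z) t
  simp only [planeFlow_zero hκ] at this
  exact this.symm

/-- The field is odd in the intensities, so running backwards is running forwards with `-ξ`.
Estimates proved for nonnegative times thus cover negative ones. -/
lemma planeFlow_neg (hκ : RegularKernel κ) (ξ : Fin N → ℝ) (t : ℝ) (y : Fin N → Plane) :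
    planeFlow κ ξ (-t) y = planeFlow κ (-ξ) t y := by
  have := eq_planeFlow hκ (γ := fun s => planeFlow κ ξ (-s) y) (ξ := -ξ) (fun s => by
    have h : vortexVelocity κ (-ξ) (configProj (planeFlow κ ξ (-s) y)) =
        -vortexVelocity κ ξ (configProj (planeFlow κ ξ (-s) y)) := by
      funext i
      simp [vortexVelocity]
    rw [h]
    have h2 := (hasDerivAt_planeFlow hκ ξ y (-s)).scomp s (hasDerivAt_neg s)
    rw [neg_one_smul] at h2
    exact h2) t
  simp only [neg_zero, planeFlow_zero hκ] at this
  exact this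

/-- Two lifts differ by a lattice vector, with which the flow commutes; hence the choice of lift in
`torusFlow` is immaterial. -/
lemma configProj_planeFlow (hκ : RegularKernel κ) (ξ : Fin N → ℝ) (t : ℝ) (y : Fin N → Plane) :
    configProj (planeFlow κ ξ t y) = torusFlow κ ξ t (configProj y) := by
  set z := configLift (configProj y) - y with hz
  have hz0 : configProj z = 0 := by
    have h1 : configLift (configProj y) = y + z := by rw [hz]; abel
    have h2 := congrArg configProj h1
    rw [configProj_add, configProj_configLift] at h2
    exact left_eq_add.mp h2
  have h : configLift (configProj y) = y + z := by rw [hz]; abel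
  rw [torusFlow, h, planeFlow_add_lattice hκ ξ t y z hz0, configProj_add, hz0, add_zero]

lemma torusFlow_zero (hκ : RegularKernel κ) (ξ : Fin N → ℝ) (x : Fin N → Torus) :
    torusFlow κ ξ 0 x = x := by
  rw [torusFlow, planeFlow_zero hκ, configProj_configLift]

lemma torusFlow_add (hκ : RegularKernel κ) (ξ : Fin N → ℝ) (s t : ℝ) (x : Fin N → Torus) :
    torusFlow κ ξ (s + t) x = torusFlow κ ξ s (torusFlow κ ξ t x) := by
  rw [torusFlow, planeFlow_add hκ, configProj_planeFlow hκ]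
  rfl

/-- Grönwall. A Lipschitz observable composed with the flow stays Lipschitz, so Liouville's theorem
can be proved without differentiating the flow in its initial datum. -/
lemma lipschitzWith_planeFlow (hκ : RegularKernel κ) (ξ : Fin N → ℝ) {t : ℝ} (ht : 0 ≤ t) :
    ∃ C : NNReal, LipschitzWith C (planeFlow κ ξ t) := by
  obtain ⟨L, hL⟩ := exists_lipschitzWith_vortexVelocity hκ ξ
  refine ⟨(Real.exp (L * t)).toNNReal, LipschitzWith.of_dist_le_mul fun y z => ?_⟩
  have h := dist_le_of_trajectories_ODE (v := fun _ y => vortexVelocity κ ξ (configProj y))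
    (K := L) (a := 0) (b := t) (δ := dist y z) (fun _ => hL)
    (continuous_planeFlow_time hκ ξ y).continuousOn
    (fun s _ => (hasDerivAt_planeFlow hκ ξ y s).hasDerivWithinAt)
    (continuous_planeFlow_time hκ ξ z).continuousOn
    (fun s _ => (hasDerivAt_planeFlow hκ ξ z s).hasDerivWithinAt)
    (by rw [planeFlow_zero hκ, planeFlow_zero hκ]) t ⟨ht, le_rfl⟩
  rw [Real.coe_toNNReal _ (Real.exp_nonneg _), mul_comm]
  simpa using h

/-- The constant does not depend on the starting point, which makes it a dominating bound for
differentiation under the integral. -/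
lemma lipschitzWith_planeFlow_time (hκ : RegularKernel κ) (ξ : Fin N → ℝ) :
    ∃ C : NNReal, ∀ y, LipschitzWith C fun t => planeFlow κ ξ t y := by
  obtain ⟨M, hM⟩ := exists_vortexVelocity_bound hκ ξ
  exact ⟨M, fun y => lipschitzWith_of_nnnorm_deriv_le
    (fun t => (hasDerivAt_planeFlow hκ ξ y t).differentiableAt)
    fun t => by rw [(hasDerivAt_planeFlow hκ ξ y t).deriv]; exact hM _⟩

/-- Joint continuity of the flow in the intensities and the initial positions. -/
lemma continuous_planeFlow (hκ : RegularKernel κ) {t : ℝ} (ht : 0 ≤ t) :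
    Continuous fun p : (Fin N → ℝ) × (Fin N → Plane) => planeFlow κ p.1 t p.2 := by
  rw [continuous_iff_continuousAt]
  rintro ⟨ξ, y⟩
  obtain ⟨L, hL⟩ := exists_lipschitzWith_vortexVelocity hκ ξ
  obtain ⟨M, hM⟩ := hκ.exists_bound
  -- The trajectory with intensities `p.1` is an approximate trajectory for `ξ`, with defect
  -- proportional to `dist p.1 ξ`.
  have key : ∀ p : (Fin N → ℝ) × (Fin N → Plane),
      dist (planeFlow κ p.1 t p.2) (planeFlow κ ξ t y) ≤
        gronwallBound (dist p.2 y) L ((√(N : ℝ))⁻¹ * (N * M) * dist p.1 ξ) t := by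
    intro p
    have h := dist_le_of_approx_trajectories_ODE
      (v := fun _ y => vortexVelocity κ ξ (configProj y))
      (f := fun s => planeFlow κ p.1 s p.2) (g := fun s => planeFlow κ ξ s y)
      (K := L) (a := 0) (b := t) (δ := dist p.2 y)
      (εf := (√(N : ℝ))⁻¹ * (N * M) * dist p.1 ξ) (εg := 0) (fun _ => hL)
      (continuous_planeFlow_time hκ p.1 p.2).continuousOn
      (fun s _ => (hasDerivAt_planeFlow hκ p.1 p.2 s).hasDerivWithinAt)
      (fun s _ => by rw [dist_eq_norm]; exact norm_vortexVelocity_sub_le hM _ _ _)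
      (continuous_planeFlow_time hκ ξ y).continuousOn
      (fun s _ => (hasDerivAt_planeFlow hκ ξ y s).hasDerivWithinAt)
      (fun s _ => by rw [dist_self])
      (by rw [planeFlow_zero hκ, planeFlow_zero hκ]) t ⟨ht, le_rfl⟩
    simpa using h
  rw [ContinuousAt, tendsto_iff_dist_tendsto_zero]
  refine squeeze_zero (fun _ => dist_nonneg) key ?_
  have hc : Continuous fun p : (Fin N → ℝ) × (Fin N → Plane) =>
      gronwallBound (dist p.2 y) L ((√(N : ℝ))⁻¹ * (N * M) * dist p.1 ξ) t := by
    unfold gronwallBound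
    split_ifs <;> fun_prop
  have := hc.tendsto (ξ, y)
  simpa [gronwallBound_ε0] using this

lemma continuous_torusFlow (hκ : RegularKernel κ) {t : ℝ} (ht : 0 ≤ t) :
    Continuous fun p : (Fin N → ℝ) × (Fin N → Torus) => torusFlow κ p.1 t p.2 := by
  have hq : IsOpenQuotientMap
      (Prod.map id configProj : (Fin N → ℝ) × (Fin N → Plane) → (Fin N → ℝ) × (Fin N → Torus)) :=
    IsOpenQuotientMap.id.prodMap isOpenQuotientMap_configProj
  refine hq.isQuotientMap.continuous_iff.mpr ?_
  have : (fun p : (Fin N → ℝ) × (Fin N → Torus) => torusFlow κ p.1 t p.2) ∘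
      (Prod.map id configProj : (Fin N → ℝ) × (Fin N → Plane) → (Fin N → ℝ) × (Fin N → Torus)) =
      fun p => configProj (planeFlow κ p.1 t p.2) := by
    funext p
    simp [configProj_planeFlow hκ]
  rw [this]
  exact continuous_configProj.comp (continuous_planeFlow hκ ht)

lemma continuous_torusFlow_time (hκ : RegularKernel κ) (ξ : Fin N → ℝ) (x : Fin N → Torus) :
    Continuous fun t => torusFlow κ ξ t x :=
  continuous_configProj.comp (continuous_planeFlow_time hκ ξ _)

end Flow

end


noncomputable section

/-! ## Liouville's theorem for regular kernels -/

section Liouville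

variable {N : ℕ}

lemma measurable_configLift : Measurable (configLift (N := N)) :=
  quasiMeasurePreserving_configLift.measurable

/-- Rademacher's theorem, pulled back along the absolutely continuous lift. -/
lemma ae_differentiableAt_configLift {u : (Fin N → Plane) → ℝ} {C : NNReal}
    (hu : LipschitzWith C u) :
    ∀ᵐ x : Fin N → Torus, DifferentiableAt ℝ u (configLift x) :=
  quasiMeasurePreserving_configLift.ae hu.ae_differentiableAt

/-- Differentiation under the integral sign of a Lipschitz function along a family of maps. -/
lemma hasDerivAt_integral_comp {u : (Fin N → Torus) → ℝ} {C M : NNReal}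
    (hu : LipschitzWith C (fun y => u (configProj y))) {Ψ : ℝ → (Fin N → Plane) → Fin N → Plane}
    {V : (Fin N → Plane) → Fin N → Plane} (h0 : ∀ y, Ψ 0 y = y)
    (hΨ : ∀ y, HasDerivAt (fun s => Ψ s y) (V y) 0) (hL : ∀ y, LipschitzWith M fun s => Ψ s y)
    (hm : ∀ s, Measurable (Ψ s)) (hV : Measurable V) {w : (Fin N → Torus) → ℝ}
    (hw : Continuous w) :
    Integrable (fun x => fderiv ℝ (fun y => u (configProj y)) (configLift x) (V (configLift x)) * w x)
      ∧ HasDerivAt (fun s => ∫ x, u (configProj (Ψ s (configLift x))) * w x)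
      (∫ x, fderiv ℝ (fun y => u (configProj y)) (configLift x) (V (configLift x)) * w x) 0 := by
  set ũ := fun y : Fin N → Plane => u (configProj y) with hũ
  have hwm : Measurable w := hw.measurable
  obtain ⟨W, hW⟩ : ∃ W, ∀ x, ‖w x‖ ≤ W := by
    obtain ⟨W, hW⟩ := isCompact_univ.exists_bound_of_continuousOn (hw.continuousOn (s := univ))
    exact ⟨W, fun x => hW x trivial⟩
  have hum : Measurable ũ := hu.continuous.measurable
  have hucont : Continuous u :=
    isOpenQuotientMap_configProj.isQuotientMap.continuous_iff.mpr hu.continuous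
  refine hasDerivAt_integral_of_dominated_loc_of_lip (𝕜 := ℝ) (s := univ)
    (bound := fun _ => C * M * W) Filter.univ_mem
    (Eventually.of_forall fun s => ?_) ?_ ?_ ?_ (integrable_const _) ?_
  · exact ((hum.comp ((hm s).comp measurable_configLift)).mul hwm).aestronglyMeasurable
  · have : (fun x => u (configProj (Ψ 0 (configLift x))) * w x) = fun x => u x * w x := by
      funext x; rw [h0, configProj_configLift]
    rw [this]
    exact (hucont.mul hw).integrable_of_hasCompactSupport (HasCompactSupport.of_compactSpace _)
  · have h1 : Measurable fun y => fderiv ℝ ũ y (V y) :=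
      isBoundedBilinearMap_apply.continuous.measurable.comp ((measurable_fderiv ℝ ũ).prodMk hV)
    exact ((h1.comp measurable_configLift).mul hwm).aestronglyMeasurable
  · refine Eventually.of_forall fun x => LipschitzWith.lipschitzOnWith ?_
    refine LipschitzWith.of_dist_le_mul fun s t => ?_
    rw [Real.dist_eq, ← sub_mul, abs_mul, ← Real.dist_eq]
    have h1 := (hu.comp (hL (configLift x))).dist_le_mul s t
    have hW0 : 0 ≤ W := (norm_nonneg _).trans (hW x)
    have h2 : ((Real.nnabs (↑C * ↑M * W) : NNReal) : ℝ) = C * M * W := by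
      rw [Real.coe_nnabs, abs_of_nonneg (by positivity)]
    rw [h2]
    have h3 := hW x
    rw [Real.norm_eq_abs] at h3
    calc _ ≤ (↑(C * M) * dist s t) * W := by
          exact mul_le_mul h1 h3 (abs_nonneg _) (by positivity)
      _ = _ := by push_cast; ring
  -- The observable is merely Lipschitz; the chain rule at almost every point suffices under the
  -- integral.
  · filter_upwards [ae_differentiableAt_configLift hu] with x hx
    have h1 : HasFDerivAt ũ (fderiv ℝ ũ (configLift x)) (Ψ 0 (configLift x)) := by
      rw [h0]; exact hx.hasFDerivAt
    exact (h1.comp_hasDerivAt (0 : ℝ) (hΨ (configLift x))).mul_const (w x)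

/-- Integration by parts on the torus against a Lipschitz function. -/
lemma integral_fderiv_mul_eq_neg {u w w' : (Fin N → Torus) → ℝ} {C D : NNReal}
    (hu : LipschitzWith C (fun y => u (configProj y)))
    (hw : LipschitzWith D (fun y => w (configProj y))) (e : Fin N → Plane)
    (hw' : ∀ y : Fin N → Plane,
      HasDerivAt (fun s : ℝ => w (configProj (y + s • e))) (w' (configProj y)) 0) :
    Integrable (fun x => fderiv ℝ (fun y => u (configProj y)) (configLift x) e * w x) ∧
    Integrable (fun x => u x * w' x) ∧
    ∫ x, fderiv ℝ (fun y => u (configProj y)) (configLift x) e * w x = -∫ x, u x * w' x := by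
  have hucont : Continuous u :=
    isOpenQuotientMap_configProj.isQuotientMap.continuous_iff.mpr hu.continuous
  have hwcont : Continuous w :=
    isOpenQuotientMap_configProj.isQuotientMap.continuous_iff.mpr hw.continuous
  have hd : ∀ (v y : Fin N → Plane), HasDerivAt (fun s : ℝ => y + s • v) v 0 := fun v y => by
    simpa using ((hasDerivAt_id (0 : ℝ)).smul_const v).const_add y
  have hl : ∀ (v y : Fin N → Plane), LipschitzWith ‖v‖₊ (fun s : ℝ => y + s • v) := fun v y => by
    refine LipschitzWith.of_dist_le_mul fun s t => ?_
    rw [dist_add_left, dist_eq_norm, ← sub_smul, norm_smul, mul_comm, dist_eq_norm]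
    rfl
  have h1 := hasDerivAt_integral_comp hu (Ψ := fun s y => y + s • e) (V := fun _ => e)
    (fun y => by simp) (hd e) (hl e) (fun s => by fun_prop) measurable_const hwcont
  have h2 := hasDerivAt_integral_comp hw (Ψ := fun s y => y + s • (-e)) (V := fun _ => -e)
    (fun y => by simp) (hd (-e)) (by simpa using hl (-e)) (fun s => by fun_prop)
    measurable_const hucont
  -- Where `w` is differentiable, its Fréchet derivative along `e` must be the given directional
  -- derivative `w'`.
  have h3 : ∀ᵐ x : Fin N → Torus,
      fderiv ℝ (fun y => w (configProj y)) (configLift x) (-e) * u x = -(u x * w' x) := by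
    filter_upwards [ae_differentiableAt_configLift hw] with x hx
    have h4 : HasFDerivAt (fun y => w (configProj y))
        (fderiv ℝ (fun y => w (configProj y)) (configLift x)) (configLift x + (0 : ℝ) • e) := by
      simpa using hx.hasFDerivAt
    have h6 : HasDerivAt (fun s : ℝ => w (configProj (configLift x + s • e)))
        (fderiv ℝ (fun y => w (configProj y)) (configLift x) e) 0 :=
      HasFDerivAt.comp_hasDerivAt (l := fun y => w (configProj y)) (0 : ℝ) h4 (hd e (configLift x))
    have h5 := h6.unique (hw' (configLift x))
    rw [configProj_configLift] at h5
    rw [map_neg, h5]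
    ring
  -- Translation invariance of Lebesgue measure moves the shift from `u` to `w`, reversing its sign;
  -- differentiating both forms at `s = 0` gives the integration by parts.
  have h4 : (fun s : ℝ => ∫ x, u (configProj (configLift x + s • e)) * w x) =
      fun s : ℝ => ∫ x, w (configProj (configLift x + s • -e)) * u x := by
    funext s
    simp only [configProj_add, configProj_configLift, smul_neg]
    have h0 : configProj (-(s • e)) = -configProj (s • e) := funext fun i => torusProj_neg _
    rw [← integral_add_right_eq_self (fun x => w (x + configProj (-(s • e))) * u x)
      (configProj (s • e))]
    refine integral_congr_ae (Eventually.of_forall fun x => ?_)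
    simp only [h0, add_neg_cancel_right]
    ring
  refine ⟨h1.1, ?_, ?_⟩
  · refine (h2.1.congr h3).neg.congr (Eventually.of_forall fun x => ?_)
    simp
  · rw [← integral_neg, ← integral_congr_ae h3]
    have h5 := h1.2
    rw [h4] at h5
    exact h5.unique h2.2

variable {κ : Torus → Plane}

/-- The partial derivative `∂_α κ_α`, as a function on the torus. -/
def diagPartial (κ : Torus → Plane) (α : Fin 2) (p : Torus) : ℝ :=
  fderiv ℝ (fun x : Plane => κ (torusProj x)) (torusLift p) (EuclideanSpace.single α 1) α

lemma diagPartial_torusProj (κ : Torus → Plane) (α : Fin 2) (x : Plane) :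
    diagPartial κ α (torusProj x) =
      fderiv ℝ (fun x : Plane => κ (torusProj x)) x (EuclideanSpace.single α 1) α := by
  rw [diagPartial, fderiv_eq_of_periodic (fun x y h => congrArg κ h)
    (torusProj_torusLift (torusProj x))]

/-- The unit vector moving particle `i` in the direction `α`. -/
def coordVec (i : Fin N) (α : Fin 2) : Fin N → Plane := Pi.single i (EuclideanSpace.single α (1 : ℝ))

/-- Displacing particle `i` shifts `x_i - x_j` for `j ≠ i` and leaves `x_i - x_i` fixed, so only the
terms with `j ≠ i` contribute. -/
lemma hasDerivAt_vortexVelocity_coord (hκ : RegularKernel κ) (ξ : Fin N → ℝ) (i : Fin N)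
    (α : Fin 2) (y : Fin N → Plane) :
    HasDerivAt (fun s : ℝ => vortexVelocity κ ξ
        (configProj (y + s • coordVec i α)) i α)
      ((√(N : ℝ))⁻¹ * ∑ j, ξ j * if j = i then 0 else
        diagPartial κ α (configProj y i - configProj y j)) 0 := by
  have h : ∀ j, HasDerivAt (fun s : ℝ => ξ j * κ
      (configProj (y + s • coordVec i α) i -
        configProj (y + s • coordVec i α) j) α)
      (ξ j * if j = i then 0 else diagPartial κ α (configProj y i - configProj y j)) 0 := by
    intro j
    refine HasDerivAt.const_mul (ξ j) ?_
    by_cases hj : j = i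
    · subst hj
      simp only [sub_self, if_true]
      exact hasDerivAt_const _ _
    · rw [if_neg hj]
      have h1 : ∀ s : ℝ, configProj (y + s • coordVec i α) i -
          configProj (y + s • coordVec i α) j =
          torusProj ((y i - y j) + s • EuclideanSpace.single α (1 : ℝ)) := by
        intro s
        simp only [configProj, Pi.add_apply, Pi.smul_apply, coordVec, Pi.single_eq_same,
          Pi.single_eq_of_ne hj, smul_zero, add_zero]
        rw [← torusProj_sub]
        congr 1
        abel
      simp only [h1]
      have h2 : configProj y i - configProj y j = torusProj (y i - y j) :=
        (torusProj_sub _ _).symm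
      rw [h2, diagPartial_torusProj]
      have h3 : HasFDerivAt (fun x : Plane => κ (torusProj x))
          (fderiv ℝ (fun x : Plane => κ (torusProj x)) (y i - y j))
          ((y i - y j) + (0 : ℝ) • EuclideanSpace.single α (1 : ℝ)) := by
        rw [zero_smul, add_zero]
        exact (hκ.contDiff.differentiable one_ne_zero _).hasFDerivAt
      have h4 : HasDerivAt (fun s : ℝ => (y i - y j) + s • EuclideanSpace.single α (1 : ℝ))
          (EuclideanSpace.single α (1 : ℝ)) 0 := by
        simpa using ((hasDerivAt_id (0 : ℝ)).smul_const
          (EuclideanSpace.single α (1 : ℝ))).const_add (y i - y j)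
      have h5 := h3.comp_hasDerivAt (0 : ℝ) h4
      exact ((EuclideanSpace.proj (𝕜 := ℝ) α).hasFDerivAt.comp_hasDerivAt (0 : ℝ) h5)
  have hs := (HasDerivAt.fun_sum fun j (_ : j ∈ Finset.univ) => h j).const_mul (√(N : ℝ))⁻¹
  refine hs.congr_of_eventuallyEq (Eventually.of_forall fun s => ?_)
  simp [vortexVelocity]

/-- Infinitesimal form of Liouville's theorem. After integration by parts in each coordinate, the
derivatives falling on the velocity sum to the divergence of `κ` at each `x_i - x_j`, which is zero.
-/
lemma integral_fderiv_vortexVelocity (hκ : RegularKernel κ) (ξ : Fin N → ℝ)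
    {u : (Fin N → Torus) → ℝ} {C : NNReal} (hu : LipschitzWith C (fun y => u (configProj y))) :
    ∫ x, fderiv ℝ (fun y => u (configProj y)) (configLift x) (vortexVelocity κ ξ x) = 0 := by
  obtain ⟨L, hL⟩ := exists_lipschitzWith_vortexVelocity hκ ξ
  have hw : ∀ (i : Fin N) (α : Fin 2),
      LipschitzWith L (fun y => vortexVelocity κ ξ (configProj y) i α) := by
    intro i α
    refine LipschitzWith.of_dist_le_mul fun y z => le_trans ?_ (hL.dist_le_mul y z)
    refine le_trans ?_ (dist_le_pi_dist _ _ i)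
    rw [dist_eq_norm, dist_eq_norm]
    exact PiLp.norm_apply_le
      (vortexVelocity κ ξ (configProj y) i - vortexVelocity κ ξ (configProj z) i) α
  have hI := fun i α => integral_fderiv_mul_eq_neg hu (hw i α)
    (w := fun x => vortexVelocity κ ξ x i α)
    (w' := fun x => (√(N : ℝ))⁻¹ * ∑ j, ξ j * if j = i then 0 else diagPartial κ α (x i - x j))
    (coordVec i α)
    (hasDerivAt_vortexVelocity_coord hκ ξ i α)
  have hdec : ∀ v : Fin N → Plane,
      v = ∑ i, ∑ α, v i α • coordVec i α := by
    intro v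
    ext i α
    rw [Finset.sum_apply, Finset.sum_eq_single i]
    · fin_cases α <;> simp [coordVec]
    · intro j _ hj
      simp [coordVec, hj.symm]
    · simp
  have h1 : ∀ x, fderiv ℝ (fun y => u (configProj y)) (configLift x) (vortexVelocity κ ξ x) =
      ∑ i, ∑ α, fderiv ℝ (fun y => u (configProj y)) (configLift x)
        (coordVec i α) * vortexVelocity κ ξ x i α := by
    intro x
    conv_lhs => rw [hdec (vortexVelocity κ ξ x)]
    rw [map_sum]
    refine Finset.sum_congr rfl fun i _ => ?_
    rw [map_sum]
    refine Finset.sum_congr rfl fun α _ => ?_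
    rw [map_smul, smul_eq_mul, mul_comm]
  simp_rw [h1]
  rw [integral_finsetSum _ fun i _ => integrable_finsetSum _ fun α _ => (hI i α).1]
  refine Finset.sum_eq_zero fun i _ => ?_
  rw [integral_finsetSum _ fun α _ => (hI i α).1]
  simp_rw [fun α => (hI i α).2.2]
  rw [Finset.sum_neg_distrib, ← integral_finsetSum _ fun α _ => (hI i α).2.1, neg_eq_zero]
  refine integral_eq_zero_of_ae (Eventually.of_forall fun x => ?_)
  simp only [Pi.zero_apply]
  rw [← Finset.mul_sum, ← Finset.mul_sum, Finset.sum_comm]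
  have : ∑ j, ∑ α, ξ j * (if j = i then 0 else diagPartial κ α (x i - x j)) = 0 := by
    refine Finset.sum_eq_zero fun j _ => ?_
    rw [← Finset.mul_sum]
    by_cases hj : j = i
    · simp [hj]
    · simp only [if_neg hj]
      have := hκ.div_eq_zero (torusLift (x i - x j))
      rw [← mul_zero (ξ j), ← this]
      rfl
  rw [this, mul_zero, mul_zero]

/-- For Lipschitz `f` the integral of `f ∘ Φ_r` has derivative zero in `r`, because `f ∘ Φ_r` is
again Lipschitz and `integral_fderiv_vortexVelocity` applies to it. Lipschitz functions determine a
probability measure. -/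
lemma measurePreserving_torusFlow (hκ : RegularKernel κ) (ξ : Fin N → ℝ) {t : ℝ} (ht : 0 ≤ t) :
    MeasurePreserving (torusFlow κ ξ t) volume volume := by
  have hc : ∀ t, 0 ≤ t → Continuous (torusFlow (N := N) κ ξ t) := fun t ht =>
    (continuous_torusFlow hκ ht).comp (Continuous.prodMk_right ξ)
  have hcp : ∀ s, Continuous (planeFlow (N := N) κ ξ s) := by
    intro s
    rcases le_total 0 s with hs | hs
    · obtain ⟨C, hC⟩ := lipschitzWith_planeFlow hκ ξ hs
      exact hC.continuous
    · obtain ⟨C, hC⟩ := lipschitzWith_planeFlow hκ (-ξ) (neg_nonneg.mpr hs)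
      have : planeFlow (N := N) κ ξ s = planeFlow κ (-ξ) (-s) := by
        funext y
        rw [← planeFlow_neg hκ, neg_neg]
      rw [this]
      exact hC.continuous
  obtain ⟨M, hM⟩ := lipschitzWith_planeFlow_time (N := N) hκ ξ
  obtain ⟨L, hL⟩ := exists_lipschitzWith_vortexVelocity hκ ξ
  have key : ∀ f : (Fin N → Torus) → ℝ, (∃ L, LipschitzWith L f) →
      ∫ x, f (torusFlow κ ξ t x) = ∫ x, f x := by
    rintro f ⟨Lf, hf⟩
    have hder : ∀ r, 0 ≤ r → HasDerivAt (fun s => ∫ x, f (torusFlow κ ξ s x)) 0 r := by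
      intro r hr
      obtain ⟨C, hC⟩ := lipschitzWith_planeFlow (N := N) hκ ξ hr
      have hu : LipschitzWith (Lf * (1 * C)) (fun y => f (torusFlow κ ξ r (configProj y))) := by
        have := hf.comp (lipschitzWith_configProj.comp hC)
        convert this using 2 with y
        simp [configProj_planeFlow hκ]
      have h1 := (hasDerivAt_integral_comp
        (u := fun x => f (torusFlow κ ξ r x)) hu (Ψ := fun s y => planeFlow κ ξ s y)
        (V := fun y => vortexVelocity κ ξ (configProj y)) (w := fun _ => 1)
        (planeFlow_zero hκ ξ)
        (fun y => by
          have := hasDerivAt_planeFlow hκ ξ y 0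
          rwa [planeFlow_zero hκ] at this)
        hM (fun s => (hcp s).measurable) hL.continuous.measurable continuous_const).2
      simp only [mul_one, configProj_configLift] at h1
      rw [integral_fderiv_vortexVelocity hκ ξ (u := fun x => f (torusFlow κ ξ r x)) hu] at h1
      -- Writing `Φ_s = Φ_r ∘ Φ_{s-r}` puts the variable time in the inner flow, to be
      -- differentiated at time zero. The increment `s - r` takes both signs, which is why
      -- continuity at negative times was recorded in `hcp`.
      have h2 : (fun s => ∫ x, f (torusFlow κ ξ s x)) = fun s => ∫ x, f (torusFlow κ ξ r
          (configProj (planeFlow κ ξ (s - r) (configLift x)))) := by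
        funext s
        refine integral_congr_ae (Eventually.of_forall fun x => ?_)
        have : s = r + (s - r) := by ring
        simp only []
        conv_lhs => rw [this, torusFlow_add hκ]
        rfl
      rw [h2]
      have h3 : HasDerivAt (fun s => ∫ x, f (torusFlow κ ξ r
          (configProj (planeFlow κ ξ s (configLift x))))) 0 (r - r) := by
        rw [sub_self]; exact h1
      exact h3.comp_sub_const r r
    have h4 := constant_of_has_deriv_right_zero (a := 0) (b := t)
      (fun r hr => (hder r hr.1).continuousAt.continuousWithinAt)
      (fun r hr => (hder r hr.1).hasDerivWithinAt) t ⟨ht, le_rfl⟩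
    rw [h4]
    simp [torusFlow_zero hκ]
  refine ⟨(hc t ht).measurable, ?_⟩
  have hm := (hc t ht).measurable
  have : IsProbabilityMeasure (Measure.map (torusFlow (N := N) κ ξ t) volume) :=
    Measure.isProbabilityMeasure_map hm.aemeasurable
  let μ : ProbabilityMeasure (Fin N → Torus) := ⟨Measure.map (torusFlow κ ξ t) volume, ‹_›⟩
  let ν : ProbabilityMeasure (Fin N → Torus) := ⟨volume, inferInstance⟩
  -- The criterion for weak convergence by Lipschitz functions is applied to a constant sequence;
  -- equality follows from uniqueness of limits.
  have h5 : Tendsto (fun _ : ℕ => μ) atTop (𝓝 ν) := by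
    rw [tendsto_iff_forall_lipschitz_integral_tendsto]
    intro f _ hf
    have : ∫ x, f x ∂(μ : Measure (Fin N → Torus)) = ∫ x, f x ∂(ν : Measure (Fin N → Torus)) := by
      obtain ⟨L, hL⟩ := hf
      change ∫ x, f x ∂(Measure.map (torusFlow κ ξ t) volume) = ∫ x, f x
      rw [integral_map hm.aemeasurable hL.continuous.measurable.aestronglyMeasurable]
      exact key f ⟨L, hL⟩
    rw [this]
    exact tendsto_const_nhds
  have h6 : μ = ν := tendsto_nhds_unique tendsto_const_nhds h5
  exact congrArg Subtype.val h6

end Liouville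

end


noncomputable section

/-! ## Differential calculus on the torus -/

lemma torusPartial_torusProj {φ : Torus → ℝ} {x : Plane}
    (h : DifferentiableAt ℝ (fun x : Plane => φ (torusProj x)) x) (i : Fin 2) :
    torusPartial i φ (torusProj x) =
      fderiv ℝ (fun x : Plane => φ (torusProj x)) x (EuclideanSpace.single i 1) := by
  have h1 : (fun s : ℝ => φ (torusProj x + Pi.single i (s : UnitAddCircle))) =
      (fun x : Plane => φ (torusProj x)) ∘ fun s : ℝ => x + s • EuclideanSpace.single i (1 : ℝ) := by
    funext s
    simp only [Function.comp_apply, torusProj_add, torusProj_smul_single]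
  have h2 : HasDerivAt (fun s : ℝ => x + s • EuclideanSpace.single i (1 : ℝ))
      (EuclideanSpace.single i (1 : ℝ)) 0 := by
    simpa using ((hasDerivAt_id (0 : ℝ)).smul_const (EuclideanSpace.single i (1 : ℝ))).const_add x
  have h3 : HasFDerivAt (fun x : Plane => φ (torusProj x))
      (fderiv ℝ (fun x : Plane => φ (torusProj x)) x)
      (x + (0 : ℝ) • EuclideanSpace.single i (1 : ℝ)) := by
    simpa using h.hasFDerivAt
  rw [torusPartial, h1]
  exact (h3.comp_hasDerivAt (0 : ℝ) h2).deriv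

lemma plane_eq_sum (v : Plane) :
    v = ∑ i, v i • (EuclideanSpace.single i (1 : ℝ) : Plane) := by
  ext j
  fin_cases j <;> simp

lemma fderiv_apply_eq_inner_torusGrad {φ : Torus → ℝ} {x : Plane}
    (h : DifferentiableAt ℝ (fun x : Plane => φ (torusProj x)) x) (v : Plane) :
    fderiv ℝ (fun x : Plane => φ (torusProj x)) x v = inner ℝ (torusGrad φ (torusProj x)) v := by
  conv_lhs => rw [plane_eq_sum v]
  rw [map_sum, PiLp.inner_apply, Fin.sum_univ_two, Fin.sum_univ_two, map_smul, map_smul,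
    ← torusPartial_torusProj h, ← torusPartial_torusProj h]
  simp [torusGrad]

lemma hasFDerivAt_torusGrad {φ : Torus → ℝ} {x : Plane}
    (h : DifferentiableAt ℝ (fun x : Plane => φ (torusProj x)) x) :
    HasFDerivAt (fun x : Plane => φ (torusProj x))
      (innerSL ℝ (torusGrad φ (torusProj x))) x := by
  have h1 : innerSL ℝ (torusGrad φ (torusProj x)) =
      fderiv ℝ (fun x : Plane => φ (torusProj x)) x := by
    refine ContinuousLinearMap.ext fun v => ?_
    rw [fderiv_apply_eq_inner_torusGrad h, innerSL_apply_apply]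
  rw [h1]
  exact h.hasFDerivAt

/-- Clockwise rotation by a right angle, the inverse of `∇φ ↦ ∇^⊥φ`. -/
def planeRot (v : Plane) : Plane := !₂[v 1, -v 0]

lemma planeRot_torusPerpGrad (φ : Torus → ℝ) (p : Torus) :
    planeRot (torusPerpGrad φ p) = torusGrad φ p := by
  ext i
  fin_cases i <;> simp [planeRot, torusPerpGrad, torusGrad]

lemma planeRot_smul (c : ℝ) (v : Plane) : planeRot (c • v) = c • planeRot v := by
  ext i
  fin_cases i <;> simp [planeRot]

lemma planeRot_zero : planeRot 0 = 0 := by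
  ext i
  fin_cases i <;> simp [planeRot]

/-- The orthogonality of `∇g` and `∇^⊥g`: two vortices do not change the value of `g` at their
difference by acting on each other. -/
lemma inner_planeRot_self (v : Plane) : inner ℝ (planeRot v) v = 0 := by
  simp [planeRot, PiLp.inner_apply, Fin.sum_univ_two]
  ring

lemma norm_planeRot (v : Plane) : ‖planeRot v‖ = ‖v‖ := by
  rw [EuclideanSpace.norm_eq, EuclideanSpace.norm_eq, Fin.sum_univ_two, Fin.sum_univ_two]
  simp [planeRot, add_comm]

/-! ## Truncated kernels -/

/-- The smooth cutoff equal to `1` below `n + 1` and to `0` above `n + 2`. -/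
def cutoff (n : ℕ) (r : ℝ) : ℝ := Real.smoothTransition (n + 2 - r)

/-- The primitive of the cutoff: the identity below `n + 1`, constant above `n + 2`. -/
def softTrunc (n : ℕ) (r : ℝ) : ℝ := ∫ s in (0 : ℝ)..r, cutoff n s

lemma contDiff_cutoff (n : ℕ) {m : ℕ∞} : ContDiff ℝ m (cutoff n) :=
  Real.smoothTransition.contDiff.comp (contDiff_const.sub contDiff_id)

lemma continuous_cutoff (n : ℕ) : Continuous (cutoff n) := (contDiff_cutoff n (m := 0)).continuous

lemma cutoff_nonneg (n : ℕ) (r : ℝ) : 0 ≤ cutoff n r := Real.smoothTransition.nonneg _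

lemma cutoff_le_one (n : ℕ) (r : ℝ) : cutoff n r ≤ 1 := Real.smoothTransition.le_one _

lemma cutoff_eq_one {n : ℕ} {r : ℝ} (h : r ≤ n + 1) : cutoff n r = 1 :=
  Real.smoothTransition.one_of_one_le (by linarith)

lemma cutoff_eq_zero {n : ℕ} {r : ℝ} (h : (n : ℝ) + 2 ≤ r) : cutoff n r = 0 :=
  Real.smoothTransition.zero_of_nonpos (by linarith)

lemma hasDerivAt_softTrunc (n : ℕ) (r : ℝ) : HasDerivAt (softTrunc n) (cutoff n r) r :=
  ((continuous_cutoff n).integral_hasStrictDerivAt 0 r).hasDerivAt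

lemma monotone_softTrunc (n : ℕ) : Monotone (softTrunc n) :=
  monotone_of_deriv_nonneg (fun r => (hasDerivAt_softTrunc n r).differentiableAt) fun r => by
    rw [(hasDerivAt_softTrunc n r).deriv]
    exact cutoff_nonneg n r

lemma softTrunc_eq_self {n : ℕ} {r : ℝ} (h : r ≤ n + 1) : softTrunc n r = r := by
  have h1 : ∀ s ∈ uIcc 0 r, cutoff n s = 1 := fun s hs => by
    refine cutoff_eq_one ?_
    rcases le_total 0 r with h0 | h0
    · rw [uIcc_of_le h0] at hs
      exact hs.2.trans h
    · rw [uIcc_of_ge h0] at hs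
      exact hs.2.trans (by positivity)
  rw [softTrunc, intervalIntegral.integral_congr h1]
  simp

lemma softTrunc_le_self (n : ℕ) (r : ℝ) : softTrunc n r ≤ r := by
  rcases le_total r 0 with h | h
  · exact (softTrunc_eq_self (h.trans (by positivity))).le
  · have := intervalIntegral.integral_mono_on h ((continuous_cutoff n).intervalIntegrable 0 r)
      (intervalIntegrable_const (μ := volume) (a := 0) (b := r) (c := (1 : ℝ))) fun s _ => cutoff_le_one n s
    simpa [softTrunc] using this

/-- The truncation starts only at `n + 1`, one unit above `n`. So a bound by `n` on the truncated
value is already a bound on the true value. -/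
lemma le_of_softTrunc_le {n : ℕ} {r : ℝ} (h : softTrunc n r ≤ n) : r ≤ n := by
  by_contra hr
  rcases le_total r (n + 1) with h1 | h1
  · rw [softTrunc_eq_self h1] at h
    exact hr h
  · have := monotone_softTrunc n h1
    rw [softTrunc_eq_self le_rfl] at this
    linarith

/-- The plateau makes the truncated stream function constant near the origin, hence smooth there
whatever the singularity of `g`. -/
lemma softTrunc_eq_const {n : ℕ} {r : ℝ} (h : (n : ℝ) + 2 ≤ r) :
    softTrunc n r = softTrunc n (n + 2) := by
  have h1 : softTrunc n r - softTrunc n (n + 2) = ∫ s in ((n : ℝ) + 2)..r, cutoff n s :=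
    intervalIntegral.integral_interval_sub_left ((continuous_cutoff n).intervalIntegrable _ _)
      ((continuous_cutoff n).intervalIntegrable _ _)
  have h2 : ∀ s ∈ uIcc ((n : ℝ) + 2) r, cutoff n s = 0 := fun s hs => by
    rw [uIcc_of_le h] at hs
    exact cutoff_eq_zero hs.1
  rw [intervalIntegral.integral_congr h2] at h1
  simp only [intervalIntegral.integral_zero] at h1
  linarith

lemma contDiff_softTrunc (n : ℕ) : ContDiff ℝ 2 (softTrunc n) := by
  have h : ContDiff ℝ (1 + 1) (softTrunc n) := by
    rw [contDiff_succ_iff_deriv]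
    refine ⟨fun r => (hasDerivAt_softTrunc n r).differentiableAt, by simp, ?_⟩
    have : deriv (softTrunc n) = cutoff n := funext fun r => (hasDerivAt_softTrunc n r).deriv
    rw [this]
    exact contDiff_cutoff n (m := 1)
  exact h

/-- `K = b ∇^⊥ g` off the origin, with `b = ±1` and `g` tending to `+∞` at the origin. -/
structure IsGreenPair (K : Torus → Plane) (b : ℝ) (g : Torus → ℝ) : Prop where
  smooth : ∀ x : Plane, torusProj x ≠ 0 → ContDiffAt ℝ 2 (fun x : Plane => g (torusProj x)) x
  eq_perpGrad : ∀ p, p ≠ 0 → K p = b • torusPerpGrad g p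
  sq_eq_one : b * b = 1
  odd : ∀ p, K (-p) = -K p
  zero : K 0 = 0
  tendsto : Tendsto g (𝓝[≠] 0) atTop

/-- The truncated stream function. -/
def truncGreen (g : Torus → ℝ) (n : ℕ) (p : Torus) : ℝ :=
  -- `g 0` carries no information; the plateau value is the only one continuous at the origin.
  open Classical in if p = 0 then softTrunc n (n + 2) else softTrunc n (g p)

/-- The truncated kernel. -/
def truncKernel (K : Torus → Plane) (g : Torus → ℝ) (n : ℕ) (p : Torus) : Plane :=
  cutoff n (g p) • K p

lemma norm_truncKernel_le (K : Torus → Plane) (g : Torus → ℝ) (n : ℕ) (p : Torus) :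
    ‖truncKernel K g n p‖ ≤ ‖K p‖ := by
  rw [truncKernel, norm_smul, Real.norm_of_nonneg (cutoff_nonneg _ _)]
  exact mul_le_of_le_one_left (norm_nonneg _) (cutoff_le_one _ _)

lemma truncGreen_of_ne (g : Torus → ℝ) (n : ℕ) {p : Torus} (hp : p ≠ 0) :
    truncGreen g n p = softTrunc n (g p) := if_neg hp

lemma truncGreen_le (g : Torus → ℝ) (n : ℕ) {p : Torus} (hp : p ≠ 0) :
    truncGreen g n p ≤ g p := by
  rw [truncGreen_of_ne g n hp]
  exact softTrunc_le_self _ _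

/-- The plateau lies strictly above `n`. Bounds on the truncated stream function therefore exclude
collisions by themselves. -/
lemma ne_zero_of_truncGreen_le {g : Torus → ℝ} {n : ℕ} {p : Torus} (h : truncGreen g n p ≤ n) :
    p ≠ 0 := by
  rintro rfl
  rw [truncGreen, if_pos rfl] at h
  linarith [le_of_softTrunc_le h]

lemma le_of_truncGreen_le {g : Torus → ℝ} {n : ℕ} {p : Torus} (h : truncGreen g n p ≤ n) :
    g p ≤ n := by
  rw [truncGreen_of_ne g n (ne_zero_of_truncGreen_le h)] at h
  exact le_of_softTrunc_le h

lemma truncKernel_eq_self {K : Torus → Plane} {g : Torus → ℝ} {n : ℕ} {p : Torus}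
    (h : g p ≤ n + 1) : truncKernel K g n p = K p := by
  rw [truncKernel, cutoff_eq_one h, one_smul]

namespace IsGreenPair

variable {K : Torus → Plane} {b : ℝ} {g : Torus → ℝ}

lemma eventually_le (h : IsGreenPair K b g) (R : ℝ) : ∀ᶠ p in 𝓝 (0 : Torus), p ≠ 0 → R ≤ g p := by
  have := h.tendsto.eventually (eventually_ge_atTop R)
  rw [eventually_nhdsWithin_iff] at this
  exact this

lemma eventuallyEq_truncGreen (h : IsGreenPair K b g) (n : ℕ) {x : Plane} (hx : torusProj x = 0) :
    (fun x : Plane => truncGreen g n (torusProj x)) =ᶠ[𝓝 x] fun _ => softTrunc n (n + 2) := by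
  have h1 := h.eventually_le (n + 2)
  rw [← hx] at h1
  have h2 := continuous_torusProj.continuousAt.eventually h1
  filter_upwards [h2] with y hy
  by_cases hy0 : torusProj y = 0
  · simp [truncGreen, hy0]
  · rw [truncGreen_of_ne g n hy0]
    exact softTrunc_eq_const (hy (by rw [hx]; exact hy0))

lemma eventually_ne {x : Plane} (hx : torusProj x ≠ 0) : ∀ᶠ y in 𝓝 x, torusProj y ≠ 0 :=
  continuous_torusProj.continuousAt.eventually (isOpen_ne.mem_nhds hx)

lemma contDiff_truncGreen (h : IsGreenPair K b g) (n : ℕ) :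
    ContDiff ℝ 2 (fun x : Plane => truncGreen g n (torusProj x)) := by
  rw [contDiff_iff_contDiffAt]
  intro x
  by_cases hx : torusProj x = 0
  · exact contDiffAt_const.congr_of_eventuallyEq (h.eventuallyEq_truncGreen n hx)
  · refine ((contDiff_softTrunc n).contDiffAt.comp x (h.smooth x hx)).congr_of_eventuallyEq ?_
    filter_upwards [eventually_ne hx] with y hy
    exact truncGreen_of_ne g n hy

lemma planeRot_kernel (h : IsGreenPair K b g) {p : Torus} (hp : p ≠ 0) :
    b • planeRot (K p) = torusGrad g p := by
  rw [h.eq_perpGrad p hp, planeRot_smul, smul_smul, h.sq_eq_one, one_smul, planeRot_torusPerpGrad]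

/-- The derivative of `softTrunc` is `cutoff`, so multiplying `K` by the cutoff amounts to
truncating its stream function; this keeps the truncated kernel a rotated gradient. At the origin
both sides vanish. -/
lemma hasFDerivAt_truncGreen (h : IsGreenPair K b g) (n : ℕ) (x : Plane) :
    HasFDerivAt (fun x : Plane => truncGreen g n (torusProj x))
      (innerSL ℝ (b • planeRot (truncKernel K g n (torusProj x)))) x := by
  by_cases hx : torusProj x = 0
  · have h1 : truncKernel K g n (torusProj x) = 0 := by
      rw [hx, truncKernel, h.zero, smul_zero]
    rw [h1, planeRot_zero, smul_zero, map_zero]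
    exact (hasFDerivAt_const _ _).congr_of_eventuallyEq (h.eventuallyEq_truncGreen n hx)
  · have h1 := hasFDerivAt_torusGrad ((h.smooth x hx).differentiableAt two_ne_zero)
    have h2 := (hasDerivAt_softTrunc n (g (torusProj x))).comp_hasFDerivAt x h1
    have h3 : b • planeRot (truncKernel K g n (torusProj x)) =
        cutoff n (g (torusProj x)) • torusGrad g (torusProj x) := by
      rw [truncKernel, planeRot_smul, smul_comm, h.planeRot_kernel hx]
    rw [h3, map_smul]
    refine h2.congr_of_eventuallyEq ?_
    filter_upwards [eventually_ne hx] with y hy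
    exact truncGreen_of_ne g n hy

lemma truncKernel_apply (h : IsGreenPair K b g) (n : ℕ) (x : Plane) :
    truncKernel K g n (torusProj x) =
      -(b * fderiv ℝ (fun x : Plane => truncGreen g n (torusProj x)) x
          (EuclideanSpace.single 1 1)) • EuclideanSpace.single 0 1 +
      (b * fderiv ℝ (fun x : Plane => truncGreen g n (torusProj x)) x
          (EuclideanSpace.single 0 1)) • EuclideanSpace.single 1 1 := by
  rw [(h.hasFDerivAt_truncGreen n x).fderiv]
  have hb := h.sq_eq_one
  ext i
  fin_cases i
  · simp only [innerSL_apply_apply, inner_smul_left, planeRot, PiLp.inner_apply]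
    simp [← mul_assoc, hb]
  · simp only [innerSL_apply_apply, inner_smul_left, planeRot, PiLp.inner_apply]
    simp [← mul_assoc, hb]

lemma regularKernel_truncKernel (h : IsGreenPair K b g) (n : ℕ) :
    RegularKernel (truncKernel K g n) := by
  set F := fun x : Plane => truncGreen g n (torusProj x) with hF
  have hF2 : ContDiff ℝ 2 F := h.contDiff_truncGreen n
  have hd : ContDiff ℝ 1 (fderiv ℝ F) := hF2.fderiv_right (by norm_num)
  have hde : ∀ v : Plane, ContDiff ℝ 1 fun x => fderiv ℝ F x v := fun v =>
    hd.clm_apply contDiff_const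
  have heq : (fun x : Plane => truncKernel K g n (torusProj x)) = fun x =>
      -(b * fderiv ℝ F x (EuclideanSpace.single 1 1)) • EuclideanSpace.single 0 (1 : ℝ) +
      (b * fderiv ℝ F x (EuclideanSpace.single 0 1)) • EuclideanSpace.single 1 (1 : ℝ) :=
    funext fun x => h.truncKernel_apply n x
  refine ⟨?_, fun x => ?_, ?_⟩
  · rw [heq]
    exact (((contDiff_const.mul (hde _)).neg).smul contDiff_const).add
      ((contDiff_const.mul (hde _)).smul contDiff_const)
  · have hdx : HasFDerivAt (fderiv ℝ F) (fderiv ℝ (fderiv ℝ F) x) x :=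
      (hd.differentiable one_ne_zero x).hasFDerivAt
    have hv : ∀ v : Plane, HasFDerivAt (fun x => fderiv ℝ F x v)
        ((ContinuousLinearMap.apply ℝ ℝ v).comp (fderiv ℝ (fderiv ℝ F) x)) x := fun v =>
      (ContinuousLinearMap.apply ℝ ℝ v).hasFDerivAt.comp x hdx
    -- The divergence is `b (∂₁∂₀F - ∂₀∂₁F)`, zero by symmetry of second derivatives.
    have hsymm : IsSymmSndFDerivAt ℝ F x := hF2.contDiffAt.isSymmSndFDerivAt (by simp)
    have h1 := ((((hv (EuclideanSpace.single 1 1)).const_mul b).neg).smul_const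
      (EuclideanSpace.single 0 (1 : ℝ) : Plane)).add
      (((hv (EuclideanSpace.single 0 1)).const_mul b).smul_const
      (EuclideanSpace.single 1 (1 : ℝ) : Plane))
    rw [heq]
    erw [h1.fderiv]
    rw [Fin.sum_univ_two]
    simp
    rw [hsymm.eq (EuclideanSpace.single 0 1) (EuclideanSpace.single 1 1)]
    ring
  · rw [truncKernel, h.zero, smul_zero]

end IsGreenPair

/-- The sign `b` is that of `a`, and `g = b G`. Since `1 - ε > 0`, the factor `‖x‖^{-(1-ε)}` forces
`g` to `+∞`. -/
lemma IsVortexKernel.exists_greenPair {ε : ℝ} (hε : ε ∈ Ioo (0 : ℝ) 1) {K : Torus → Plane}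
    (hK : IsVortexKernel ε K) : ∃ b g, IsGreenPair K b g := by
  obtain ⟨G, hG, hKG, a, ha, hlim⟩ := hK.green
  have hopen : IsOpen {x : Plane | torusProj x ≠ 0} := isOpen_ne.preimage continuous_torusProj
  have key : ∀ b : ℝ, b * b = 1 → 0 < b * a → IsGreenPair K b (fun p => b * G p) := by
    intro b hb hba
    have hsm : ∀ x : Plane, torusProj x ≠ 0 →
        ContDiffAt ℝ 2 (fun x : Plane => b * G (torusProj x)) x := fun x hx =>
      contDiffAt_const.mul (contDiffAt_infty.mp ((hG x hx).contDiffAt (hopen.mem_nhds hx)) 2)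
    refine ⟨hsm, fun p hp => ?_, hb, hK.odd, hK.zero, ?_⟩
    · rw [hKG p hp]
      ext i
      have hpd : ∀ i, torusPartial i (fun p => b * G p) p = b * torusPartial i G p := fun i => by
        rw [torusPartial, torusPartial, deriv_const_mul_field]
      fin_cases i <;> simp [torusPerpGrad, hpd, ← mul_assoc, hb]
    · have h1 : Tendsto (fun x : Plane => b * G (torusProj x)) (𝓝[≠] 0) atTop := by
        have h2 : Tendsto (fun x : Plane => ‖x‖ ^ (-(1 - ε))) (𝓝[≠] 0) atTop := by
          have h3 : Tendsto (fun x : Plane => ‖x‖) (𝓝[≠] 0) (𝓝[>] 0) := by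
            refine tendsto_nhdsWithin_iff.mpr ⟨?_, ?_⟩
            · exact (continuous_norm.tendsto' (0 : Plane) 0 norm_zero).mono_left nhdsWithin_le_nhds
            · filter_upwards [self_mem_nhdsWithin] with x hx
              exact norm_pos_iff.mpr hx
          exact (tendsto_rpow_neg_nhdsGT_zero (by linarith [hε.2])).comp h3
        have h4 := (hlim.const_mul b).pos_mul_atTop hba h2
        refine h4.congr' ?_
        filter_upwards [self_mem_nhdsWithin] with x hx
        have hx0 : 0 < ‖x‖ := norm_pos_iff.mpr hx
        rw [Real.rpow_neg hx0.le]
        have : ‖x‖ ^ (1 - ε) ≠ 0 := (Real.rpow_pos_of_pos hx0 _).ne'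
        field_simp
      rw [tendsto_atTop] at h1 ⊢
      intro R
      have h5 := h1 R
      rw [eventually_nhdsWithin_iff] at h5 ⊢
      -- The projection is open, so neighbourhoods of the origin of the torus are images of
      -- neighbourhoods in the plane.
      have h6 : (𝓝 (0 : Torus)) = Filter.map torusProj (𝓝 0) := by
        rw [isOpenQuotientMap_torusProj.isOpenMap.map_nhds_eq continuous_torusProj.continuousAt,
          torusProj_zero]
      rw [h6, eventually_map]
      filter_upwards [h5] with x hx hx0
      refine hx ?_
      rintro rfl
      exact hx0 torusProj_zero
  rcases lt_or_gt_of_ne ha with h | h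
  · exact ⟨-1, _, key (-1) (by norm_num) (by linarith)⟩
  · exact ⟨1, _, key 1 (by norm_num) (by linarith)⟩

end


noncomputable section

/-! ## Integrability of the kernel -/

lemma continuousAt_of_comp_torusProj {F : Type*} [TopologicalSpace F] {f : Torus → F} {p : Torus}
    (h : ContinuousAt (fun x : Plane => f (torusProj x)) (torusLift p)) : ContinuousAt f p := by
  have := (isOpenQuotientMap_torusProj.continuousAt_comp_iff (g := f) (x := torusLift p)).mp h
  rwa [torusProj_torusLift] at this

lemma IsGreenPair.continuousAt {K : Torus → Plane} {b : ℝ} {g : Torus → ℝ}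
    (h : IsGreenPair K b g) {p : Torus} (hp : p ≠ 0) : ContinuousAt g p :=
  continuousAt_of_comp_torusProj (h.smooth _ (by rwa [torusProj_torusLift])).continuousAt

namespace IsVortexKernel

variable {ε : ℝ} {K : Torus → Plane}

lemma continuousAt (hK : IsVortexKernel ε K) {p : Torus} (hp : p ≠ 0) : ContinuousAt K p := by
  have hopen : IsOpen {x : Plane | torusProj x ≠ 0} := isOpen_ne.preimage continuous_torusProj
  refine continuousAt_of_comp_torusProj (hK.smooth.continuousOn.continuousAt (hopen.mem_nhds ?_))
  rwa [mem_ofPred_eq, torusProj_torusLift]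

lemma measurable (hK : IsVortexKernel ε K) : Measurable K :=
  measurable_of_continuousOn_compl_singleton 0 fun _ hp =>
    (hK.continuousAt hp).continuousWithinAt

/-- Near the origin this is the assumed bound. Elsewhere `K` is bounded by compactness, and the
power is at least one because representatives have norm at most one. -/
lemma norm_le_rpow (hε : ε ∈ Ioo (0 : ℝ) 1) (hK : IsVortexKernel ε K) :
    ∃ C, 0 ≤ C ∧ ∀ p, ‖K p‖ ≤ C * ‖torusLift p‖ ^ (-(2 - ε)) := by
  obtain ⟨c, hc⟩ := hK.bound
  rw [eventually_nhdsWithin_iff, Metric.eventually_nhds_iff] at hc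
  obtain ⟨r, hr, hc⟩ := hc
  -- Radius at most `1/2` keeps the ball inside the fundamental cube, where `torusLift` recovers the
  -- point itself.
  set U : Set Torus := torusProj '' Metric.ball 0 (min r (1 / 2)) with hU
  have hUo : IsOpen U := isOpenQuotientMap_torusProj.isOpenMap _ Metric.isOpen_ball
  have h0U : (0 : Torus) ∈ U := ⟨0, by simp [hr], torusProj_zero⟩
  obtain ⟨B, hB⟩ := hUo.isClosed_compl.isCompact.exists_bound_of_continuousOn (f := K)
    fun p hp => (hK.continuousAt (by rintro rfl; exact hp h0U)).continuousWithinAt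
  have hone : ∀ p : Torus, p ≠ 0 → 1 ≤ ‖torusLift p‖ ^ (-(2 - ε)) := fun p hp => by
    refine Real.one_le_rpow_of_pos_of_le_one_of_nonpos ?_
      (norm_le_one_of_mem_torusCube (torusLift_mem p)) (by linarith [hε.2])
    refine norm_pos_iff.mpr fun h => hp ?_
    rw [← torusProj_torusLift p, h, torusProj_zero]
  refine ⟨max c (max B 0), by positivity, fun p => ?_⟩
  by_cases hp0 : p = 0
  · rw [hp0, hK.zero, norm_zero]
    positivity
  by_cases hp : p ∈ U
  · obtain ⟨x, hx, rfl⟩ := hp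
    rw [mem_ball_zero_iff, lt_min_iff] at hx
    rw [torusLift_torusProj (mem_torusCube_of_norm_lt hx.2), Real.rpow_neg (norm_nonneg _),
      ← div_eq_mul_inv]
    refine (hc (by simpa using hx.1) ?_).trans ?_
    · rintro rfl
      exact hp0 torusProj_zero
    · gcongr
      exact le_max_left _ _
  · refine (hB p hp).trans ?_
    calc B ≤ max c (max B 0) * 1 := by
          rw [mul_one]; exact (le_max_left _ _).trans (le_max_right _ _)
      _ ≤ _ := by gcongr; exact hone p hp0

end IsVortexKernel

/-- The threshold `2` is the dimension. It is used with exponent `2 - ε` for the kernel and `2 (1 -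
ε)` for `H_φ²`. -/
lemma integrable_norm_torusLift_rpow {α : ℝ} (hα : α < 2) :
    Integrable fun p : Torus => ‖torusLift p‖ ^ (-α) := by
  have h1 : IntegrableOn (fun x : Plane => ‖x‖ ^ (-α)) (Metric.ball 0 2) := by
    refine integrableOn_ball_of_norm_le_rpow (C := 1) (α := α) (by simp) (by simpa using hα)
      (Eventually.of_forall fun x => ?_) ?_
    · rw [one_mul, Real.norm_of_nonneg (Real.rpow_nonneg (norm_nonneg _) _)]
    · exact (measurable_norm.pow_const _).aestronglyMeasurable
  have h2 : IntegrableOn (fun x : Plane => ‖x‖ ^ (-α)) torusCube := h1.mono_set fun x hx => by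
    rw [mem_ball_zero_iff]
    exact (norm_le_one_of_mem_torusCube hx).trans_lt (by norm_num)
  exact measurePreserving_torusLift.integrable_comp_of_integrable h2

lemma IsVortexKernel.integrable_norm {ε : ℝ} {K : Torus → Plane} (hε : ε ∈ Ioo (0 : ℝ) 1)
    (hK : IsVortexKernel ε K) : Integrable fun p => ‖K p‖ := by
  obtain ⟨C, hC0, hC⟩ := hK.norm_le_rpow hε
  refine ((integrable_norm_torusLift_rpow (α := 2 - ε) (by linarith [hε.1])).const_mul C).mono'
    hK.measurable.norm.aestronglyMeasurable (Eventually.of_forall fun p => ?_)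
  rw [norm_norm]
  exact hC p

/-! ## Gradients of smooth functions and the function `H_φ` -/

lemma contDiff_torusGrad (φ : SmoothTorusFn) :
    ContDiff ℝ 1 fun x : Plane => torusGrad φ.1 (torusProj x) := by
  have h : ContDiff ℝ ((⊤ : ℕ∞) : WithTop ℕ∞) (fun x : Plane => φ.1 (torusProj x)) := φ.2
  have hd : ∀ v : Plane, ContDiff ℝ 1 fun x => fderiv ℝ (fun x : Plane => φ.1 (torusProj x)) x v :=
    fun v => ((contDiff_infty.mp h 2).fderiv_right (m := 1) (by norm_num)).clm_apply contDiff_const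
  rw [contDiff_euclidean]
  intro i
  have : (fun x : Plane => torusGrad φ.1 (torusProj x) i) = fun x =>
      fderiv ℝ (fun x : Plane => φ.1 (torusProj x)) x (EuclideanSpace.single i 1) := by
    funext x
    rw [← torusPartial_torusProj (h.differentiable (by simp) x)]
    fin_cases i <;> simp [torusGrad]
  rw [this]
  exact hd _

lemma continuous_torusGrad (φ : SmoothTorusFn) : Continuous (torusGrad φ.1) :=
  isOpenQuotientMap_torusProj.isQuotientMap.continuous_iff.mpr (contDiff_torusGrad φ).continuous

lemma norm_torusGrad_sub_le (φ : SmoothTorusFn) :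
    ∃ L : NNReal, ∀ p q, ‖torusGrad φ.1 p - torusGrad φ.1 q‖ ≤ L * ‖torusLift (p - q)‖ := by
  obtain ⟨L, hL⟩ := exists_lipschitzWith_of_periodic (contDiff_torusGrad φ)
    fun x y h => congrArg (torusGrad φ.1) h
  refine ⟨L, fun p q => ?_⟩
  -- `torusLift p - torusLift (p - q)` is a lift of `q` whose distance from the lift of `p` is
  -- exactly `‖torusLift (p - q)‖`.
  have h := hL.dist_le_mul (torusLift p) (torusLift p - torusLift (p - q))
  rw [torusProj_sub, torusProj_torusLift, torusProj_torusLift, sub_sub_cancel, dist_eq_norm,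
    dist_eq_norm, sub_sub_cancel] at h
  exact h

/-- A continuous surjective homomorphism of compact groups carries normalised Haar measure to
normalised Haar measure. -/
lemma measurePreserving_torus_sub :
    MeasurePreserving (fun p : Torus × Torus => p.1 - p.2) volume volume := by
  let f : Torus × Torus →+ Torus := AddMonoidHom.fst _ _ - AddMonoidHom.snd _ _
  have hf : Continuous f := continuous_fst.sub continuous_snd
  have : Measure.IsAddHaarMeasure (volume : Measure (Torus × Torus)) :=
    Measure.prod.instIsAddHaarMeasure (volume : Measure Torus) (volume : Measure Torus)
  exact AddMonoidHom.measurePreserving (f := f) hf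
    (fun p => ⟨(p, 0), by simp [f]⟩) (by simp)

lemma vortexH_swap {K : Torus → Plane} (hK : ∀ p, K (-p) = -K p) (φ : Torus → ℝ) (x y : Torus) :
    vortexH K φ (y, x) = vortexH K φ (x, y) := by
  simp only [vortexH]
  rw [← neg_sub x y, hK, ← neg_sub (torusGrad φ x), inner_neg_neg]

lemma vortexH_self {K : Torus → Plane} (φ : Torus → ℝ) (x : Torus) : vortexH K φ (x, x) = 0 := by
  simp [vortexH]

lemma measurable_vortexH {K : Torus → Plane} (hK : Measurable K) (φ : SmoothTorusFn) :
    Measurable (vortexH K φ.1) := by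
  have h := (continuous_torusGrad φ).measurable
  exact (hK.comp (measurable_fst.sub measurable_snd)).inner
    ((h.comp measurable_fst).sub (h.comp measurable_snd))

/-- The gradient difference is Lipschitz and improves the singularity from `2 - ε` to `1 - ε`. Its
square has exponent `2 (1 - ε) < 2`, integrable since `ε > 0`. -/
lemma memLp_vortexH {ε : ℝ} {K : Torus → Plane} (hε : ε ∈ Ioo (0 : ℝ) 1)
    (hK : IsVortexKernel ε K) (φ : SmoothTorusFn) : MemLp (vortexH K φ.1) 2 := by
  have hm := measurable_vortexH hK.measurable φ
  rw [memLp_two_iff_integrable_sq hm.aestronglyMeasurable]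
  obtain ⟨C, hC0, hC⟩ := hK.norm_le_rpow hε
  obtain ⟨L, hL⟩ := norm_torusGrad_sub_le φ
  have hint := measurePreserving_torus_sub.integrable_comp_of_integrable
    ((integrable_norm_torusLift_rpow (α := 2 * (1 - ε)) (by linarith [hε.1])).const_mul
      ((C * L) ^ 2))
  refine hint.mono' (hm.pow_const 2).aestronglyMeasurable (Eventually.of_forall fun p => ?_)
  simp only [Function.comp_apply]
  rw [Real.norm_of_nonneg (sq_nonneg _), ← sq_abs]
  -- At coinciding points the power of zero takes a default value, so the bound is obtained from `K
  -- 0 = 0`.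
  by_cases h0 : ‖torusLift (p.1 - p.2)‖ = 0
  · have : vortexH K φ.1 p = 0 := by
      rw [norm_eq_zero] at h0
      have h1 : p.1 - p.2 = 0 := by rw [← torusProj_torusLift (p.1 - p.2), h0, torusProj_zero]
      rw [vortexH, h1, hK.zero, inner_zero_left]
    rw [this, abs_zero, zero_pow two_ne_zero]
    positivity
  · have hpos : 0 < ‖torusLift (p.1 - p.2)‖ := lt_of_le_of_ne (norm_nonneg _) (Ne.symm h0)
    have h1 : |vortexH K φ.1 p| ≤ (C * L) * ‖torusLift (p.1 - p.2)‖ ^ (-(1 - ε)) := by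
      refine (abs_real_inner_le_norm _ _).trans ?_
      calc _ ≤ (C * ‖torusLift (p.1 - p.2)‖ ^ (-(2 - ε))) * (L * ‖torusLift (p.1 - p.2)‖) := by
            gcongr
            · exact hC _
            · exact hL _ _
        _ = (C * L) * (‖torusLift (p.1 - p.2)‖ ^ (-(2 - ε)) * ‖torusLift (p.1 - p.2)‖ ^ (1 : ℝ)) := by
            rw [Real.rpow_one]; ring
        _ = _ := by
            rw [← Real.rpow_add hpos]
            congr 2
            ring
    calc |vortexH K φ.1 p| ^ 2 ≤ ((C * L) * ‖torusLift (p.1 - p.2)‖ ^ (-(1 - ε))) ^ 2 := by gcongr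
      _ = (C * L) ^ 2 * ‖torusLift (p.1 - p.2)‖ ^ (-(2 * (1 - ε))) := by
          rw [mul_pow, ← Real.rpow_natCast (_ ^ _), ← Real.rpow_mul hpos.le]
          congr 2
          push_cast
          ring

end


noncomputable section

/-! ## Almost sure absence of collisions -/

section Lyapunov

variable {N : ℕ} {K : Torus → Plane} {b : ℝ} {g : Torus → ℝ}

/-- A bound for the time derivative of the stream function at `x_i - x_j` along the flow. -/
def pairRate (κ : Torus → Plane) (ξ : Fin N → ℝ) (i j : Fin N) (x : Fin N → Torus) : ℝ :=
  (√(N : ℝ))⁻¹ * ∑ k, if k = i ∨ k = j then 0 else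
    |ξ k| * (‖κ (x i - x j)‖ * ‖κ (x i - x k)‖ + ‖κ (x i - x j)‖ * ‖κ (x j - x k)‖)

/-- The sum of the rates over all pairs. -/
def totalRate (κ : Torus → Plane) (ξ : Fin N → ℝ) (x : Fin N → Torus) : ℝ :=
  ∑ i, ∑ j, if i = j then 0 else pairRate κ ξ i j x

lemma pairRate_nonneg (κ : Torus → Plane) (ξ : Fin N → ℝ) (i j : Fin N) (x : Fin N → Torus) :
    0 ≤ pairRate κ ξ i j x := by
  refine mul_nonneg (by positivity) (Finset.sum_nonneg fun k _ => ?_)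
  split_ifs <;> positivity

lemma pairRate_le_totalRate (κ : Torus → Plane) (ξ : Fin N → ℝ) {i j : Fin N} (hij : i ≠ j)
    (x : Fin N → Torus) : pairRate κ ξ i j x ≤ totalRate κ ξ x := by
  have h0 : ∀ i j, 0 ≤ if i = j then 0 else pairRate κ ξ i j x := fun i j => by
    split_ifs
    · exact le_rfl
    · exact pairRate_nonneg _ _ _ _ _
  calc pairRate κ ξ i j x = if i = j then 0 else pairRate κ ξ i j x := (if_neg hij).symm
    _ ≤ ∑ j, if i = j then 0 else pairRate κ ξ i j x :=
        Finset.single_le_sum (f := fun j => if i = j then 0 else pairRate κ ξ i j x)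
          (fun j _ => h0 i j) (Finset.mem_univ j)
    _ ≤ totalRate κ ξ x :=
        Finset.single_le_sum (f := fun i => ∑ j, if i = j then 0 else pairRate κ ξ i j x)
          (fun i _ => Finset.sum_nonneg fun j _ => h0 i j) (Finset.mem_univ i)

lemma totalRate_mono {κ κ' : Torus → Plane} (h : ∀ p, ‖κ p‖ ≤ ‖κ' p‖) (ξ : Fin N → ℝ)
    (x : Fin N → Torus) : totalRate κ ξ x ≤ totalRate κ' ξ x := by
  refine Finset.sum_le_sum fun i _ => Finset.sum_le_sum fun j _ => ?_
  split_ifs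
  · exact le_rfl
  refine mul_le_mul_of_nonneg_left (Finset.sum_le_sum fun k _ => ?_) (by positivity)
  split_ifs
  · exact le_rfl
  gcongr <;> exact h _

lemma continuous_pairRate {κ : Torus → Plane} (hκ : Continuous κ) (ξ : Fin N → ℝ) (i j : Fin N) :
    Continuous (pairRate κ ξ i j) := by
  refine continuous_const.mul (continuous_finsetSum _ fun k _ => ?_)
  split_ifs
  · exact continuous_const
  · fun_prop

lemma continuous_totalRate {κ : Torus → Plane} (hκ : Continuous κ) (ξ : Fin N → ℝ) :
    Continuous (totalRate κ ξ) := by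
  refine continuous_finsetSum _ fun i _ => continuous_finsetSum _ fun j _ => ?_
  split_ifs
  · exact continuous_const
  · exact continuous_pairRate hκ ξ i j

/-- For three distinct indices the two differences are independent and uniform. Hence a product of
two values of `|K|` is integrable as soon as `|K|` is. -/
lemma measurePreserving_sub_sub {i j k : Fin N} (hij : i ≠ j) (hki : k ≠ i) (hkj : k ≠ j) :
    MeasurePreserving (fun x : Fin N → Torus => (x i - x j, x i - x k)) volume volume := by
  let e (i : Fin N) : (Fin N → Torus) →+ Torus := Pi.evalAddMonoidHom (fun _ : Fin N => Torus) i
  let f : (Fin N → Torus) →+ Torus × Torus := (e i - e j).prod (e i - e k)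
  have hf : Continuous f :=
    ((continuous_apply i).sub (continuous_apply j)).prodMk
      ((continuous_apply i).sub (continuous_apply k))
  have : Measure.IsAddHaarMeasure (volume : Measure (Torus × Torus)) :=
    Measure.prod.instIsAddHaarMeasure (volume : Measure Torus) (volume : Measure Torus)
  refine AddMonoidHom.measurePreserving (f := f) hf (fun p => ?_) (by simp)
  refine ⟨Pi.single j (-p.1) + Pi.single k (-p.2), ?_⟩
  simp [f, e, hij, hkj, hki.symm, hkj.symm]

lemma measurePreserving_sub_apply {i j : Fin N} (hij : i ≠ j) :
    MeasurePreserving (fun x : Fin N → Torus => x i - x j) volume volume := by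
  let e (i : Fin N) : (Fin N → Torus) →+ Torus := Pi.evalAddMonoidHom (fun _ : Fin N => Torus) i
  let f : (Fin N → Torus) →+ Torus := e i - e j
  have hf : Continuous f := (continuous_apply i).sub (continuous_apply j)
  refine AddMonoidHom.measurePreserving (f := f) hf (fun p => ?_) (by simp)
  exact ⟨Pi.single i p, by simp [f, e, hij.symm]⟩

/-- Each summand is a product of two values of `|K|` at independent uniform points. For the second
summand the roles of `i` and `j` are exchanged, with oddness restoring `x_i - x_j`. -/
lemma integrable_totalRate (hodd : ∀ p, K (-p) = -K p) (hK : Integrable fun p => ‖K p‖)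
    (ξ : Fin N → ℝ) : Integrable (totalRate K ξ) := by
  have hprod : Integrable fun p : Torus × Torus => ‖K p.1‖ * ‖K p.2‖ := hK.mul_prod hK
  refine integrable_finsetSum _ fun i _ => integrable_finsetSum _ fun j _ => ?_
  split_ifs with hij
  · exact integrable_zero _ _ _
  refine Integrable.const_mul (integrable_finsetSum _ fun k _ => ?_) _
  split_ifs with hk
  · exact integrable_zero _ _ _
  rw [not_or] at hk
  refine Integrable.const_mul (Integrable.add ?_ ?_) _
  · exact (measurePreserving_sub_sub hij hk.1 hk.2).integrable_comp_of_integrable hprod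
  · have h := (measurePreserving_sub_sub (Ne.symm hij) hk.2 hk.1).integrable_comp_of_integrable hprod
    refine h.congr (Eventually.of_forall fun x => ?_)
    simp only [Function.comp_apply]
    rw [← neg_sub (x i) (x j), hodd, norm_neg]

lemma ae_notMem_collisionSet : ∀ᵐ x : Fin N → Torus, x ∉ collisionSet N := by
  have h0 : volume ({0} : Set Torus) = 0 := by
    refine measure_mono_null (t := torusLift ⁻¹' {0}) ?_ ?_
    · simp [torusLift_zero]
    · rw [measurePreserving_torusLift.measure_preimage (measurableSet_singleton 0).nullMeasurableSet,
        measure_singleton]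
  have h : ∀ i j : Fin N, i ≠ j → ∀ᵐ x : Fin N → Torus, x i ≠ x j := fun i j hij => by
    have h1 := (measurePreserving_sub_apply hij).quasiMeasurePreserving.ae
      (p := fun p => p ≠ 0) (compl_mem_ae_iff.mpr h0)
    filter_upwards [h1] with x hx h2
    exact hx (sub_eq_zero.mpr h2)
  have h' : ∀ᵐ x : Fin N → Torus, ∀ i j : Fin N, i ≠ j → x i ≠ x j := by
    rw [ae_all_iff]; intro i
    rw [ae_all_iff]; intro j
    by_cases hij : i = j
    · simp [hij]
    · filter_upwards [h i j hij] with x hx _ using hx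
  filter_upwards [h'] with x hx
  rintro ⟨i, j, hij, he⟩
  exact hx i j hij he

/-- The effect of `i` on `j` is antiparallel to that of `j` on `i`, hence also orthogonal to the
gradient. -/
lemma inner_planeRot_truncKernel_neg (hodd : ∀ p, K (-p) = -K p) (n : ℕ) (p : Torus) :
    inner ℝ (planeRot (truncKernel K g n p)) (truncKernel K g n (-p)) = 0 := by
  rw [truncKernel, truncKernel, hodd, smul_neg, inner_neg_right, planeRot_smul, inner_smul_left,
    inner_smul_right, inner_planeRot_self]
  simp

/-- The terms `k = i` and `k = j`, which would be of the order of `‖κ(x_i - x_j)‖²`, vanish by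
orthogonality; the others are estimated by Cauchy-Schwarz. -/
lemma abs_inner_vortexVelocity_sub_le (hg : IsGreenPair K b g) (n : ℕ) (ξ : Fin N → ℝ)
    {i j : Fin N} (hij : i ≠ j) (x : Fin N → Torus) :
    |inner ℝ (b • planeRot (truncKernel K g n (x i - x j)))
      (vortexVelocity (truncKernel K g n) ξ x i - vortexVelocity (truncKernel K g n) ξ x j)| ≤
    pairRate (truncKernel K g n) ξ i j x := by
  set κ := truncKernel K g n with hκ
  have h0 : κ 0 = 0 := (hg.regularKernel_truncKernel n).zero
  have hb : |b| = 1 := by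
    have := hg.sq_eq_one
    rcases mul_self_eq_one_iff.mp this with h | h <;> simp [h]
  rw [vortexVelocity, vortexVelocity, ← smul_sub, ← Finset.sum_sub_distrib, inner_smul_left,
    inner_smul_right, inner_sum, abs_mul, abs_mul]
  simp only [conj_trivial, hb, one_mul]
  rw [abs_of_nonneg (by positivity : (0 : ℝ) ≤ (√(N : ℝ))⁻¹), pairRate]
  refine mul_le_mul_of_nonneg_left ?_ (by positivity)
  refine (Finset.abs_sum_le_sum_abs _ _).trans (Finset.sum_le_sum fun k _ => ?_)
  rw [← smul_sub, inner_smul_right, abs_mul]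
  split_ifs with hk
  · rcases hk with rfl | rfl
    · rw [sub_self, h0, zero_sub, inner_neg_right, ← neg_sub (x k) (x j),
        inner_planeRot_truncKernel_neg hg.odd, neg_zero, abs_zero, mul_zero]
    · rw [sub_self, h0, sub_zero, inner_planeRot_self, abs_zero, mul_zero]
  · gcongr
    refine (abs_real_inner_le_norm _ _).trans ?_
    rw [norm_planeRot, ← mul_add]
    gcongr
    exact norm_sub_le _ _

lemma continuous_truncGreen (hg : IsGreenPair K b g) (n : ℕ) : Continuous (truncGreen g n) :=
  isOpenQuotientMap_torusProj.isQuotientMap.continuous_iff.mpr (hg.contDiff_truncGreen n).continuous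

/-- The fundamental theorem of calculus along the flow. The integral is extended to `T` and the rate
summed over all pairs, so that one random quantity serves all times and pairs. -/
lemma truncGreen_torusFlow_le (hg : IsGreenPair K b g) (n : ℕ) (ξ : Fin N → ℝ) {i j : Fin N}
    (hij : i ≠ j) (x : Fin N → Torus) {t T : ℝ} (ht : t ∈ Icc 0 T) :
    truncGreen g n (torusFlow (truncKernel K g n) ξ t x i -
        torusFlow (truncKernel K g n) ξ t x j) ≤
      truncGreen g n (x i - x j) +
        ∫ s in (0 : ℝ)..T, totalRate (truncKernel K g n) ξ (torusFlow (truncKernel K g n) ξ s x) := by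
  set κ := truncKernel K g n with hκdef
  have hκ : RegularKernel κ := hg.regularKernel_truncKernel n
  set Y := fun s => planeFlow κ ξ s (configLift x) with hY
  set X := fun s => torusFlow κ ξ s x with hX
  have hXc : Continuous X := continuous_torusFlow_time hκ ξ x
  set f := fun s => truncGreen g n (X s i - X s j) with hf
  have hder : ∀ s, HasDerivAt f (inner ℝ (b • planeRot (κ (X s i - X s j)))
      (vortexVelocity κ ξ (X s) i - vortexVelocity κ ξ (X s) j)) s := by
    intro s
    have h1 : HasDerivAt (fun s => Y s i - Y s j)
        (vortexVelocity κ ξ (X s) i - vortexVelocity κ ξ (X s) j) s := by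
      have h := hasDerivAt_pi.mp (hasDerivAt_planeFlow hκ ξ (configLift x) s)
      exact (h i).sub (h j)
    have h2 := (hg.hasFDerivAt_truncGreen n (Y s i - Y s j)).comp_hasDerivAt s h1
    have h3 : ∀ s, torusProj (Y s i - Y s j) = X s i - X s j := fun s => torusProj_sub _ _
    rw [h3, innerSL_apply_apply] at h2
    refine h2.congr_of_eventuallyEq (Eventually.of_forall fun r => ?_)
    simp only [hf, Function.comp_apply, h3]
  have hrot : Continuous planeRot := by
    refine (PiLp.continuous_toLp 2 _).comp (continuous_pi fun i => ?_)
    fin_cases i <;> simp <;> fun_prop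
  have hvel : ∀ i, Continuous fun s => vortexVelocity κ ξ (X s) i := fun i => by
    have := hκ.continuous
    unfold vortexVelocity
    fun_prop
  have hder_cont : Continuous fun s => inner ℝ (b • planeRot (κ (X s i - X s j)))
      (vortexVelocity κ ξ (X s) i - vortexVelocity κ ξ (X s) j) := by
    have := hκ.continuous
    exact Continuous.inner (by fun_prop) ((hvel i).sub (hvel j))
  have hint : f t - f 0 = ∫ s in (0 : ℝ)..t, inner ℝ (b • planeRot (κ (X s i - X s j)))
      (vortexVelocity κ ξ (X s) i - vortexVelocity κ ξ (X s) j) :=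
    (intervalIntegral.integral_eq_sub_of_hasDerivAt (fun s _ => hder s)
      (hder_cont.intervalIntegrable _ _)).symm
  have hrate : Continuous fun s => totalRate κ ξ (X s) :=
    (continuous_totalRate hκ.continuous ξ).comp hXc
  have hle : f t - f 0 ≤ ∫ s in (0 : ℝ)..t, totalRate κ ξ (X s) := by
    rw [hint]
    refine intervalIntegral.integral_mono_on ht.1 (hder_cont.intervalIntegrable _ _)
      (hrate.intervalIntegrable _ _) fun s _ => ?_
    exact (le_abs_self _).trans ((abs_inner_vortexVelocity_sub_le hg n ξ hij (X s)).trans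
      (pairRate_le_totalRate κ ξ hij (X s)))
  have hle2 : ∫ s in (0 : ℝ)..t, totalRate κ ξ (X s) ≤ ∫ s in (0 : ℝ)..T, totalRate κ ξ (X s) := by
    refine intervalIntegral.integral_mono_interval le_rfl ht.1 ht.2
      (Eventually.of_forall fun s => ?_) (hrate.intervalIntegrable _ _)
    exact (pairRate_nonneg κ ξ i j (X s)).trans (pairRate_le_totalRate κ ξ hij (X s))
  have h0 : f 0 = truncGreen g n (x i - x j) := by
    simp only [hf, hX, torusFlow_zero hκ]
  change f t ≤ _
  linarith

/-- The data for which the truncated dynamics is collision-free, hence exact, up to time `T`. -/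
def goodSet (K : Torus → Plane) (g : Torus → ℝ) (T : ℝ) (n : ℕ) :
    Set ((Fin N → ℝ) × (Fin N → Torus)) :=
  {p | ∀ t ∈ Icc 0 T, ∀ i j, i ≠ j → truncGreen g n
    (torusFlow (truncKernel K g n) p.1 t p.2 i - torusFlow (truncKernel K g n) p.1 t p.2 j) ≤ n}

/-- Provides the measurability needed to apply Fubini's theorem in the intensities and positions. -/
lemma isClosed_goodSet (hg : IsGreenPair K b g) (T : ℝ) (n : ℕ) :
    IsClosed (goodSet (N := N) K g T n) := by
  have : goodSet (N := N) K g T n = ⋂ t ∈ Icc 0 T, ⋂ i, ⋂ j, ⋂ (_ : i ≠ j), {p | truncGreen g n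
    (torusFlow (truncKernel K g n) p.1 t p.2 i -
      torusFlow (truncKernel K g n) p.1 t p.2 j) ≤ n} := by
    ext p; simp [goodSet]
  rw [this]
  refine isClosed_biInter fun t ht => isClosed_iInter fun i => isClosed_iInter fun j =>
    isClosed_iInter fun _ => isClosed_le ?_ continuous_const
  have h := continuous_torusFlow (N := N) (hg.regularKernel_truncKernel n) ht.1
  exact (continuous_truncGreen hg n).comp
    (((continuous_apply i).comp h).sub ((continuous_apply j).comp h))

/-- The bound for the growth of the Lyapunov function up to time `T`. -/
def lyapunovGrowth (κ : Torus → Plane) (ξ : Fin N → ℝ) (T : ℝ) (x : Fin N → Torus) : ENNReal :=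
  -- The absolute value changes nothing on `[0, T]`; it gives joint measurability over all real
  -- times from continuity known at nonnegative times.
  ∫⁻ s in Icc 0 T, ENNReal.ofReal (totalRate κ ξ (torusFlow κ ξ |s| x))

variable {κ : Torus → Plane}

lemma measurable_totalRate_torusFlow (hκ : RegularKernel κ) (ξ : Fin N → ℝ) :
    Measurable fun p : (Fin N → Torus) × ℝ =>
      ENNReal.ofReal (totalRate κ ξ (torusFlow κ ξ |p.2| p.1)) := by
  have h1 : Measurable (Function.uncurry fun (s : ℝ) (x : Fin N → Torus) =>
      torusFlow κ ξ |s| x) :=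
    measurable_uncurry_of_continuous_of_measurable
      (fun x => (continuous_torusFlow_time hκ ξ x).comp continuous_abs)
      (fun s => ((continuous_torusFlow hκ (abs_nonneg s)).comp
        (Continuous.prodMk_right ξ)).measurable)
  have h2 : Measurable fun p : (Fin N → Torus) × ℝ => torusFlow κ ξ |p.2| p.1 :=
    h1.comp measurable_swap
  exact ((continuous_totalRate hκ.continuous ξ).measurable.comp h2).ennreal_ofReal

lemma measurable_lyapunovGrowth (hκ : RegularKernel κ) (ξ : Fin N → ℝ) (T : ℝ) :
    Measurable (lyapunovGrowth κ ξ T) :=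
  (measurable_totalRate_torusFlow hκ ξ).lintegral_prod_right'

lemma lintegral_totalRate_torusFlow (hκ : RegularKernel κ) (ξ : Fin N → ℝ) {s : ℝ} (hs : 0 ≤ s) :
    ∫⁻ x, ENNReal.ofReal (totalRate κ ξ (torusFlow κ ξ s x)) =
      ∫⁻ x, ENNReal.ofReal (totalRate κ ξ x) :=
  (measurePreserving_torusFlow hκ ξ hs).lintegral_comp
    (f := fun x => ENNReal.ofReal (totalRate κ ξ x))
    (continuous_totalRate hκ.continuous ξ).measurable.ennreal_ofReal

/-- Tonelli's theorem and the invariance of Lebesgue measure: the expected rate is the same at every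
time. -/
lemma lintegral_lyapunovGrowth (hκ : RegularKernel κ) (ξ : Fin N → ℝ) (T : ℝ) :
    ∫⁻ x, lyapunovGrowth κ ξ T x =
      ENNReal.ofReal T * ∫⁻ x, ENNReal.ofReal (totalRate κ ξ x) := by
  have hsw := lintegral_lintegral_swap (μ := (volume : Measure (Fin N → Torus)))
    (ν := (volume : Measure ℝ).restrict (Icc 0 T))
    (f := fun x s => ENNReal.ofReal (totalRate κ ξ (torusFlow κ ξ |s| x)))
    (measurable_totalRate_torusFlow hκ ξ).aemeasurable
  simp only [lyapunovGrowth]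
  rw [hsw]
  simp only [lintegral_totalRate_torusFlow hκ ξ (abs_nonneg _)]
  rw [setLIntegral_const, Real.volume_Icc, sub_zero, mul_comm]

lemma integral_totalRate_torusFlow_le (hκ : RegularKernel κ) (ξ : Fin N → ℝ) {T B : ℝ}
    (hT : 0 ≤ T) (hB : 0 ≤ B) {x : Fin N → Torus}
    (h : lyapunovGrowth κ ξ T x ≤ ENNReal.ofReal B) :
    ∫ s in (0 : ℝ)..T, totalRate κ ξ (torusFlow κ ξ s x) ≤ B := by
  have hc : Continuous fun s => totalRate κ ξ (torusFlow κ ξ s x) :=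
    (continuous_totalRate hκ.continuous ξ).comp (continuous_torusFlow_time hκ ξ x)
  rw [intervalIntegral.integral_of_le hT, ← integral_Icc_eq_integral_Ioc,
    ← ENNReal.ofReal_le_ofReal_iff hB,
    ofReal_integral_eq_lintegral_ofReal hc.continuousOn.integrableOn_Icc
      (Eventually.of_forall fun s => Finset.sum_nonneg fun i _ => Finset.sum_nonneg fun j _ => by
        split_ifs
        · exact le_rfl
        · exact pairRate_nonneg _ _ _ _ _)]
  refine le_trans (le_of_eq ?_) h
  refine setLIntegral_congr_fun measurableSet_Icc fun s hs => ?_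
  simp only [abs_of_nonneg hs.1]

/-- Truncation only decreases the rate, so the expectations are bounded uniformly in `n` by that of
the singular kernel. Fatou's lemma makes the liminf finite almost everywhere; no convergence of the
truncated flows is required. -/
lemma ae_exists_frequently_lyapunovGrowth_lt (hg : IsGreenPair K b g)
    (hK : Integrable fun p => ‖K p‖) (ξ : Fin N → ℝ) (T : ℝ) :
    ∀ᵐ x : Fin N → Torus, ∃ B : ℝ, 0 ≤ B ∧
      ∃ᶠ n in atTop, lyapunovGrowth (truncKernel K g n) ξ T x < ENNReal.ofReal B := by
  have hm : ∀ n, Measurable (lyapunovGrowth (N := N) (truncKernel K g n) ξ T) := fun n =>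
    measurable_lyapunovGrowth (hg.regularKernel_truncKernel n) ξ T
  have hbound : ∀ n, ∫⁻ x, lyapunovGrowth (N := N) (truncKernel K g n) ξ T x ≤
      ENNReal.ofReal T * ∫⁻ x, ENNReal.ofReal (totalRate K ξ x) := fun n => by
    rw [lintegral_lyapunovGrowth (hg.regularKernel_truncKernel n)]
    gcongr with x
    exact totalRate_mono (norm_truncKernel_le K g n) ξ x
  have hfin : ENNReal.ofReal T * ∫⁻ x : Fin N → Torus, ENNReal.ofReal (totalRate K ξ x) < ⊤ :=
    ENNReal.mul_lt_top ENNReal.ofReal_lt_top (integrable_totalRate hg.odd hK ξ).lintegral_lt_top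
  have hliminf : ∫⁻ x, liminf (fun n => lyapunovGrowth (N := N) (truncKernel K g n) ξ T x) atTop
      < ⊤ := by
    refine (lintegral_liminf_le hm).trans_lt (lt_of_le_of_lt ?_ hfin)
    refine (liminf_le_liminf (Eventually.of_forall hbound)).trans_eq ?_
    exact liminf_const _
  filter_upwards [ae_lt_top (Measurable.liminf hm) hliminf.ne] with x hx
  obtain ⟨B, hB1, hB2⟩ := ENNReal.lt_iff_exists_real_btwn.mp hx
  exact ⟨B, hB1, frequently_lt_of_liminf_lt (by isBoundedDefault) hB2.1⟩

lemma ae_exists_mem_goodSet (hg : IsGreenPair K b g) (hK : Integrable fun p => ‖K p‖)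
    (ξ : Fin N → ℝ) {T : ℝ} (hT : 0 ≤ T) :
    ∀ᵐ x : Fin N → Torus, ∃ n, (ξ, x) ∈ goodSet K g T n := by
  filter_upwards [ae_exists_frequently_lyapunovGrowth_lt hg hK ξ T, ae_notMem_collisionSet]
    with x hx hcol
  obtain ⟨B, hB1, hfreq⟩ := hx
  obtain ⟨R, hR⟩ : ∃ R : ℝ, ∀ i j : Fin N, g (x i - x j) ≤ R := by
    obtain ⟨R, hR⟩ := (Set.finite_range fun q : Fin N × Fin N => g (x q.1 - x q.2)).bddAbove
    exact ⟨R, fun i j => hR ⟨(i, j), rfl⟩⟩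
  -- Among the infinitely many admissible `n`, one exceeds the initial height `R` plus the growth
  -- `B`; then no pair rises above `n`.
  obtain ⟨n, hn, hnB⟩ := (hfreq.and_eventually
    (tendsto_natCast_atTop_atTop.eventually (eventually_ge_atTop (R + B)))).exists
  refine ⟨n, fun t ht i j hij => ?_⟩
  have hij' : x i - x j ≠ 0 := fun h => hcol ⟨i, j, hij, sub_eq_zero.mp h⟩
  have h0 := truncGreen_torusFlow_le hg n ξ hij x ht
  have h1 := (truncGreen_le g n hij').trans (hR i j)
  have h2 := integral_totalRate_torusFlow_le (hg.regularKernel_truncKernel n) ξ hT hB1 hn.le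
  simp only at h0 ⊢
  linarith

lemma ae_vortexLaw_exists_mem_goodSet (hg : IsGreenPair K b g) (hK : Integrable fun p => ‖K p‖) :
    ∀ᵐ p ∂(vortexLaw N), ∀ T : ℕ, ∃ n, p ∈ goodSet K g (T : ℝ) n := by
  rw [ae_all_iff]
  intro T
  have hm : MeasurableSet {p : (Fin N → ℝ) × (Fin N → Torus) | ∃ n, p ∈ goodSet K g (T : ℝ) n} := by
    have : {p : (Fin N → ℝ) × (Fin N → Torus) | ∃ n, p ∈ goodSet K g (T : ℝ) n} =
        ⋃ n, goodSet K g (T : ℝ) n := by ext; simp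
    rw [this]
    exact MeasurableSet.iUnion fun n => (isClosed_goodSet hg T n).measurableSet
  have h := (Measure.ae_prod_mem_iff_ae_ae_mem (μ := Measure.pi fun _ : Fin N => gaussianReal 0 1)
    (ν := (volume : Measure (Fin N → Torus))) hm).mpr
    (Eventually.of_forall fun ξ => ae_exists_mem_goodSet hg hK ξ (Nat.cast_nonneg T))
  exact h

end Lyapunov

end


noncomputable section

/-! ### Global solutions of the singular system, their uniqueness and invariance of the law -/

section Dynamics

variable {N : ℕ} {K : Torus → Plane} {b : ℝ} {g : Torus → ℝ}

/-- Wherever all pairs lie below `n + 1` the cutoff equals one; the diagonal terms vanish for both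
kernels. -/
lemma vortexVelocity_truncKernel (hg : IsGreenPair K b g) {n : ℕ} (ξ : Fin N → ℝ)
    {x : Fin N → Torus} (h : ∀ i j, i ≠ j → g (x i - x j) ≤ n + 1) :
    vortexVelocity (truncKernel K g n) ξ x = vortexVelocity K ξ x := by
  funext i
  simp only [vortexVelocity]
  congr 1
  refine Finset.sum_congr rfl fun j _ => ?_
  by_cases hij : i = j
  · rw [hij, sub_self, (hg.regularKernel_truncKernel n).zero, hg.zero]
  · rw [truncKernel_eq_self (h i j hij)]

lemma eq_planeFlow_truncKernel (hg : IsGreenPair K b g) {n : ℕ} {ξ : Fin N → ℝ}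
    {Y : ℝ → Fin N → Plane} {T : ℝ} (hc : ContinuousOn Y (Icc 0 T))
    (hY : ∀ t ∈ Ico 0 T, HasDerivWithinAt Y (vortexVelocity K ξ (configProj (Y t))) (Ici t) t)
    (hle : ∀ t ∈ Ico 0 T, ∀ i j, i ≠ j → g (configProj (Y t) i - configProj (Y t) j) ≤ n + 1)
    {t : ℝ} (ht : t ∈ Icc 0 T) :
    Y t = planeFlow (truncKernel K g n) ξ t (Y 0) := by
  refine eqOn_planeFlow (hg.regularKernel_truncKernel n) hc (fun t ht => ?_) ht
  rw [vortexVelocity_truncKernel hg ξ (hle t ht)]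
  exact hY t ht

lemma hasDerivAt_planeFlow_of_mem_goodSet (hg : IsGreenPair K b g) {n : ℕ} {ξ : Fin N → ℝ}
    {x : Fin N → Torus} {T : ℝ} (h : (ξ, x) ∈ goodSet K g T n) {t : ℝ} (ht : t ∈ Icc 0 T) :
    HasDerivAt (fun t => planeFlow (truncKernel K g n) ξ t (configLift x))
      (vortexVelocity K ξ (configProj (planeFlow (truncKernel K g n) ξ t (configLift x)))) t := by
  have h1 := hasDerivAt_planeFlow (hg.regularKernel_truncKernel n) ξ (configLift x) t
  have h2 := vortexVelocity_truncKernel hg (n := n) ξ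
    (x := configProj (planeFlow (truncKernel K g n) ξ t (configLift x))) fun i j hij =>
      (le_of_truncGreen_le (h t ht i j hij)).trans (by linarith)
  rwa [h2] at h1

/-- A trajectory on which level `n` is not felt also solves every higher truncated system. This
consistency allows trajectories for different horizons to be glued. -/
lemma planeFlow_eq_of_mem_goodSet_of_le (hg : IsGreenPair K b g) {n m : ℕ} (hnm : n ≤ m)
    {ξ : Fin N → ℝ} {x : Fin N → Torus} {T : ℝ} (h : (ξ, x) ∈ goodSet K g T n) {t : ℝ}
    (ht : t ∈ Icc 0 T) :
    planeFlow (truncKernel K g n) ξ t (configLift x) =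
      planeFlow (truncKernel K g m) ξ t (configLift x) := by
  have hκ := hg.regularKernel_truncKernel n
  have h1 := eq_planeFlow_truncKernel hg (n := m) (ξ := ξ) (T := T)
    (Y := fun t => planeFlow (truncKernel K g n) ξ t (configLift x))
    (continuous_planeFlow_time hκ ξ _).continuousOn
    (fun t ht => (hasDerivAt_planeFlow_of_mem_goodSet hg h ⟨ht.1, ht.2.le⟩).hasDerivWithinAt)
    (fun t ht i j hij => by
      have h2 := le_of_truncGreen_le (h t ⟨ht.1, ht.2.le⟩ i j hij)
      have h3 : (n : ℝ) ≤ m := Nat.cast_le.mpr hnm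
      exact h2.trans (by linarith)) ht
  simpa only [planeFlow_zero hκ] using h1

lemma planeFlow_eq_of_mem_goodSet (hg : IsGreenPair K b g) {n m : ℕ}
    {ξ : Fin N → ℝ} {x : Fin N → Torus} {T T' : ℝ} (h : (ξ, x) ∈ goodSet K g T n)
    (h' : (ξ, x) ∈ goodSet K g T' m) {t : ℝ} (ht : t ∈ Icc 0 T) (ht' : t ∈ Icc 0 T') :
    planeFlow (truncKernel K g n) ξ t (configLift x) =
      planeFlow (truncKernel K g m) ξ t (configLift x) :=
  (planeFlow_eq_of_mem_goodSet_of_le hg (le_max_left n m) h ht).trans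
    (planeFlow_eq_of_mem_goodSet_of_le hg (le_max_right n m) h' ht').symm

lemma exists_isVortexSolution_of_mem_goodSet (hg : IsGreenPair K b g)
    {ξ : Fin N → ℝ} {x : Fin N → Torus} (h : ∀ T : ℕ, ∃ n, (ξ, x) ∈ goodSet K g (T : ℝ) n) :
    ∃ X, IsVortexSolution K ξ x X := by
  choose n hn using h
  set Z : ℕ → ℝ → Fin N → Plane :=
    fun T t => planeFlow (truncKernel K g (n T)) ξ t (configLift x) with hZ
  -- The horizon `⌈t⌉₊ + 1` lies strictly beyond `t`, so `Y` agrees with a single trajectory on the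
  -- nonnegative times near `t`.
  set Y : ℝ → Fin N → Plane := fun t => Z (⌈t⌉₊ + 1) t with hY
  have hlt : ∀ t : ℝ, t < ((⌈t⌉₊ + 1 : ℕ) : ℝ) := fun t => by
    have := Nat.le_ceil t
    push_cast
    linarith
  have hYZ : ∀ (T : ℕ) (t : ℝ), 0 ≤ t → t ≤ T → Y t = Z T t := fun T t h0 hT =>
    planeFlow_eq_of_mem_goodSet hg (hn _) (hn _) ⟨h0, (hlt t).le⟩ ⟨h0, hT⟩
  refine ⟨fun t => configProj (Y t), ?_, fun t ht => ?_, Y, fun t ht i => ⟨rfl, ?_⟩⟩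
  · simp only [hY, hZ, planeFlow_zero (hg.regularKernel_truncKernel _), configProj_configLift]
  · rintro ⟨i, j, hij, he⟩
    exact ne_zero_of_truncGreen_le (hn (⌈t⌉₊ + 1) t ⟨ht, (hlt t).le⟩ i j hij)
      (sub_eq_zero.mpr he)
  · have h1 := hasDerivAt_planeFlow_of_mem_goodSet hg (hn (⌈t⌉₊ + 1)) (t := t) ⟨ht, (hlt t).le⟩
    have h2 := (hasDerivAt_pi.mp h1 i).hasDerivWithinAt (s := Ici 0)
    refine h2.congr_of_eventuallyEq ?_ rfl
    filter_upwards [self_mem_nhdsWithin, mem_nhdsWithin_of_mem_nhds (Iio_mem_nhds (hlt t))]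
      with s hs0 hs
    exact congrFun (hYZ _ s hs0 (le_of_lt hs)) i

lemma IsVortexSolution.exists_curve {ξ : Fin N → ℝ} {x : Fin N → Torus} {X : ℝ → Fin N → Torus}
    (h : IsVortexSolution K ξ x X) : ∃ Y : ℝ → Fin N → Plane,
      (∀ t, 0 ≤ t → configProj (Y t) = X t) ∧
      ∀ t, 0 ≤ t → HasDerivWithinAt Y (vortexVelocity K ξ (X t)) (Ici 0) t := by
  obtain ⟨Y, hY⟩ := h.ode
  exact ⟨Y, fun t ht => funext fun i => (hY t ht i).1,
    fun t ht => hasDerivWithinAt_pi.mpr fun i => (hY t ht i).2⟩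

lemma IsVortexSolution.continuousOn {ξ : Fin N → ℝ} {x : Fin N → Torus} {X : ℝ → Fin N → Torus}
    (h : IsVortexSolution K ξ x X) : ContinuousOn X (Ici 0) := by
  obtain ⟨Y, hYX, hY⟩ := h.exists_curve
  have hc : ContinuousOn Y (Ici 0) := fun t ht => (hY t ht).continuousWithinAt
  exact (continuous_configProj.comp_continuousOn hc).congr fun t ht => (hYX t ht).symm

/-- On `[0, T]` a collision-free solution has `g(X^i - X^j)` bounded by compactness, so every
sufficiently high truncation is invisible to it. Uniqueness, measurability and invariance all rest
on this. -/
lemma IsVortexSolution.eventually_eq_torusFlow (hg : IsGreenPair K b g)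
    {ξ : Fin N → ℝ} {x : Fin N → Torus} {X : ℝ → Fin N → Torus}
    (h : IsVortexSolution K ξ x X) (T : ℝ) :
    ∀ᶠ n : ℕ in atTop, ∀ t ∈ Icc 0 T, X t = torusFlow (truncKernel K g n) ξ t x := by
  obtain ⟨Y, hYX, hY⟩ := h.exists_curve
  have hYc : ContinuousOn Y (Icc 0 T) :=
    fun t ht => ((hY t ht.1).continuousWithinAt).mono Icc_subset_Ici_self
  have hb : ∀ i j, ∃ R : ℝ, i ≠ j → ∀ t ∈ Icc 0 T, g (X t i - X t j) ≤ R := by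
    intro i j
    by_cases hij : i = j
    · exact ⟨0, fun h => absurd hij h⟩
    have hc : ContinuousOn (fun t => g (X t i - X t j)) (Icc 0 T) := by
      intro t ht
      have hne : X t i - X t j ≠ 0 := fun he => h.noCollision t ht.1 ⟨i, j, hij, sub_eq_zero.mp he⟩
      have h1 : ContinuousWithinAt X (Icc 0 T) t := (h.continuousOn t ht.1).mono Icc_subset_Ici_self
      have h2 := continuousWithinAt_pi.mp h1
      exact ContinuousAt.comp_continuousWithinAt (g := g) (hg.continuousAt hne) ((h2 i).sub (h2 j))
    obtain ⟨R, hR⟩ := (isCompact_Icc.image_of_continuousOn hc).bddAbove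
    exact ⟨R, fun _ t ht => hR ⟨t, ht, rfl⟩⟩
  choose R hR using hb
  obtain ⟨M, hM⟩ := (Set.finite_range fun q : Fin N × Fin N => R q.1 q.2).bddAbove
  filter_upwards [tendsto_natCast_atTop_atTop.eventually (eventually_ge_atTop M)] with n hn t ht
  have h1 := eq_planeFlow_truncKernel hg (n := n) (ξ := ξ) hYc
    (fun t ht => by
      rw [hYX t ht.1]
      exact (hY t ht.1).mono (Ici_subset_Ici.mpr ht.1))
    (fun t ht i j hij => by
      rw [hYX t ht.1]
      have h3 := hR i j hij t ⟨ht.1, ht.2.le⟩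
      have h4 : R i j ≤ M := hM ⟨(i, j), rfl⟩
      linarith) ht
  rw [← hYX t ht.1, h1, configProj_planeFlow (hg.regularKernel_truncKernel n), hYX 0 le_rfl,
    h.initial]

lemma IsVortexSolution.eqOn (hg : IsGreenPair K b g)
    {ξ : Fin N → ℝ} {x : Fin N → Torus} {X X' : ℝ → Fin N → Torus}
    (h : IsVortexSolution K ξ x X) (h' : IsVortexSolution K ξ x X') : EqOn X X' (Ici 0) := by
  intro t ht
  obtain ⟨n, h1, h2⟩ := ((h.eventually_eq_torusFlow hg t).and
    (h'.eventually_eq_torusFlow hg t)).exists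
  rw [h1 t ⟨ht, le_rfl⟩, h2 t ⟨ht, le_rfl⟩]

lemma isVortexSolution_vortexFlow {ξ : Fin N → ℝ} {x : Fin N → Torus}
    (h : ∃ X, IsVortexSolution K ξ x X) : IsVortexSolution K ξ x (vortexFlow K ξ x) := by
  rw [vortexFlow, dif_pos h]
  exact h.choose_spec

lemma IsVortexSolution.shift {ξ : Fin N → ℝ} {x : Fin N → Torus} {X : ℝ → Fin N → Torus}
    (hX : IsVortexSolution K ξ x X) {h : ℝ} (hh : 0 ≤ h) :
    IsVortexSolution K ξ (X h) (fun t => X (t + h)) := by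
  obtain ⟨Y, hY⟩ := hX.ode
  refine ⟨by simp, fun t ht => hX.noCollision _ (add_nonneg ht hh), fun t => Y (t + h),
    fun t ht i => ⟨(hY _ (add_nonneg ht hh) i).1, ?_⟩⟩
  have h1 := (hY _ (add_nonneg ht hh) i).2
  have h2 : HasDerivWithinAt (fun s : ℝ => s + h) 1 (Ici 0) t :=
    ((hasDerivAt_id t).add_const h).hasDerivWithinAt
  have h3 := HasDerivWithinAt.scomp (t' := Ici 0) (h := fun s : ℝ => s + h) t h1 h2
    (fun s hs => add_nonneg hs hh)
  rw [one_smul] at h3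
  exact h3

lemma IsVortexSolution.add_const {ξ : Fin N → ℝ} {x : Fin N → Torus} {X : ℝ → Fin N → Torus}
    (hX : IsVortexSolution K ξ x X) (a : Torus) :
    IsVortexSolution K ξ (fun i => x i + a) (fun t i => X t i + a) := by
  obtain ⟨Y, hY⟩ := hX.ode
  obtain ⟨z, rfl⟩ := torusProj_surjective a
  refine ⟨by simp [hX.initial], fun t ht => ?_, fun t i => Y t i + z, fun t ht i => ⟨?_, ?_⟩⟩
  · rintro ⟨i, j, hij, he⟩
    exact hX.noCollision t ht ⟨i, j, hij, add_right_cancel he⟩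
  · rw [torusProj_add, (hY t ht i).1]
  · simpa only [add_sub_add_right_eq_sub] using (hY t ht i).2.add_const z

/-- `vortexFlow` selects a solution separately for each starting point; uniqueness makes these
selections consistent at nonnegative times. -/
lemma vortexFlow_add (hg : IsGreenPair K b g) {ξ : Fin N → ℝ} {x : Fin N → Torus}
    (hX : ∃ X, IsVortexSolution K ξ x X) {t h : ℝ} (ht : 0 ≤ t) (hh : 0 ≤ h) :
    vortexFlow K ξ x (t + h) = vortexFlow K ξ (vortexFlow K ξ x h) t := by
  have h1 := (isVortexSolution_vortexFlow hX).shift hh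
  exact h1.eqOn hg (isVortexSolution_vortexFlow ⟨_, h1⟩) ht

lemma vortexFlow_add_const (hg : IsGreenPair K b g) {ξ : Fin N → ℝ} {x : Fin N → Torus}
    (hX : ∃ X, IsVortexSolution K ξ x X) (a : Torus) {t : ℝ} (ht : 0 ≤ t) :
    vortexFlow K ξ (fun i => x i + a) t = fun i => vortexFlow K ξ x t i + a := by
  have h1 := (isVortexSolution_vortexFlow hX).add_const a
  exact (h1.eqOn hg (isVortexSolution_vortexFlow ⟨_, h1⟩) ht).symm

lemma tendsto_torusFlow (hg : IsGreenPair K b g) {ξ : Fin N → ℝ} {x : Fin N → Torus}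
    (hX : ∃ X, IsVortexSolution K ξ x X) {t : ℝ} (ht : 0 ≤ t) :
    Tendsto (fun n => torusFlow (truncKernel K g n) ξ t x) atTop (𝓝 (vortexFlow K ξ x t)) := by
  refine tendsto_const_nhds.congr' ?_
  filter_upwards [(isVortexSolution_vortexFlow hX).eventually_eq_torusFlow hg t] with n hn
    using hn t ⟨ht, le_rfl⟩

lemma ae_exists_isVortexSolution (hg : IsGreenPair K b g) (hK : Integrable fun p => ‖K p‖) :
    ∀ᵐ p ∂(vortexLaw N), ∃ X, IsVortexSolution K p.1 p.2 X := by
  filter_upwards [ae_vortexLaw_exists_mem_goodSet hg hK] with p hp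
    using exists_isVortexSolution_of_mem_goodSet hg hp

/-- The time-`t` map of intensities and positions. -/
def vortexMap (K : Torus → Plane) (t : ℝ) (p : (Fin N → ℝ) × (Fin N → Torus)) :
    (Fin N → ℝ) × (Fin N → Torus) := (p.1, vortexFlow K p.1 p.2 t)

instance : IsProbabilityMeasure (vortexLaw N) := by
  unfold vortexLaw
  infer_instance

/-- A skew product: intensities are conserved, and for each value of them the flow preserves
Lebesgue measure. -/
lemma measurePreserving_torusFlow_vortexLaw {κ : Torus → Plane} (hκ : RegularKernel κ) {t : ℝ}
    (ht : 0 ≤ t) :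
    MeasurePreserving (fun p : (Fin N → ℝ) × (Fin N → Torus) => (p.1, torusFlow κ p.1 t p.2))
      (vortexLaw N) (vortexLaw N) :=
  (MeasurePreserving.id _).skew_product (continuous_torusFlow hκ ht).measurable
    (Eventually.of_forall fun ξ => (measurePreserving_torusFlow hκ ξ ht).map_eq)

lemma ae_tendsto_vortexMap (hg : IsGreenPair K b g) (hK : Integrable fun p => ‖K p‖) {t : ℝ}
    (ht : 0 ≤ t) : ∀ᵐ p ∂(vortexLaw N), Tendsto
      (fun n => (p.1, torusFlow (truncKernel K g n) p.1 t p.2)) atTop (𝓝 (vortexMap K t p)) := by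
  filter_upwards [ae_exists_isVortexSolution hg hK] with p hp
    using tendsto_const_nhds.prodMk_nhds (tendsto_torusFlow hg hp ht)

/-- Since `vortexFlow` is defined by choice, measurability is obtained only almost everywhere, as a
limit of continuous maps. -/
lemma aemeasurable_vortexMap (hg : IsGreenPair K b g) (hK : Integrable fun p => ‖K p‖) {t : ℝ}
    (ht : 0 ≤ t) : AEMeasurable (vortexMap K t) (vortexLaw N) :=
  aemeasurable_of_tendsto_metrizable_ae atTop
    (fun n => (measurePreserving_torusFlow_vortexLaw
      (hg.regularKernel_truncKernel n) ht).measurable.aemeasurable)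
    (ae_tendsto_vortexMap hg hK ht)

/-- Integrals of bounded continuous functions are invariant under each truncated flow, and dominated
convergence passes this to the limit. -/
lemma map_vortexMap (hg : IsGreenPair K b g) (hK : Integrable fun p => ‖K p‖) {t : ℝ}
    (ht : 0 ≤ t) : (vortexLaw N).map (vortexMap K t) = vortexLaw N := by
  have hm := aemeasurable_vortexMap (N := N) hg hK ht
  have : IsProbabilityMeasure ((vortexLaw N).map (vortexMap K t)) :=
    Measure.isProbabilityMeasure_map hm
  refine ext_of_forall_integral_eq_of_IsFiniteMeasure fun f => ?_
  rw [integral_map hm f.continuous.aestronglyMeasurable]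
  have h1 : Tendsto (fun n => ∫ p, f (p.1, torusFlow (truncKernel K g n) p.1 t p.2) ∂(vortexLaw N))
      atTop (𝓝 (∫ p, f (vortexMap K t p) ∂(vortexLaw N))) := by
    refine tendsto_integral_of_dominated_convergence (fun _ => ‖f‖) (fun n => ?_)
      (integrable_const _) (fun n => Eventually.of_forall fun p => f.norm_coe_le_norm _) ?_
    · exact (f.continuous.measurable.comp (measurePreserving_torusFlow_vortexLaw
        (hg.regularKernel_truncKernel n) ht).measurable).aestronglyMeasurable
    · filter_upwards [ae_tendsto_vortexMap hg hK ht] with p hp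
        using (f.continuous.tendsto _).comp hp
  refine tendsto_nhds_unique h1 (tendsto_const_nhds.congr fun n => ?_)
  have h2 := measurePreserving_torusFlow_vortexLaw (N := N) (hg.regularKernel_truncKernel n) ht
  conv_lhs => rw [← h2.map_eq]
  exact integral_map h2.measurable.aemeasurable f.continuous.aestronglyMeasurable

end Dynamics

end


noncomputable section

/-! ### Integration against sums of point masses and their tensor squares -/

section PointMeasures

lemma integrable_smul_dirac {α : Type*} [MeasurableSpace α] [MeasurableSingletonClass α]
    (c : ℝ) (y : α) (F : α → ℝ) : (c • VectorMeasure.dirac y (1 : ℝ)).Integrable F := by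
  refine VectorMeasure.Integrable.smul_vectorMeasure ?_ c
  simp only [VectorMeasure.Integrable, VectorMeasure.variation_dirac]
  refine Integrable.smul_measure ?_ (by simp)
  exact (integrable_const (F y)).congr (ae_eq_dirac F).symm

lemma integral_sum_smul_dirac {α ι : Type*} [MeasurableSpace α] [MeasurableSingletonClass α]
    (s : Finset ι) (c : ι → ℝ) (y : ι → α) (F : α → ℝ) :
    ∫ᵛ x, F x ∂•(∑ i ∈ s, c i • VectorMeasure.dirac (y i) (1 : ℝ)) = ∑ i ∈ s, c i * F (y i) := by
  rw [VectorMeasure.integral_finsetSum_vectorMeasure fun i _ => integrable_smul_dirac _ _ _]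
  simp

variable {N : ℕ}

lemma pair_pointVortexMeasure (ξ : Fin N → ℝ) (x : Fin N → Torus) (φ : SmoothTorusFn) :
    (measureDistribution (pointVortexMeasure ξ x)).pair φ =
      (√(N : ℝ))⁻¹ * ∑ n, ξ n * φ.1 (x n) := by
  change ∫ᵛ y, φ.1 y ∂•(pointVortexMeasure ξ x) = _
  rw [pointVortexMeasure, VectorMeasure.integral_smul_vectorMeasure, integral_sum_smul_dirac,
    smul_eq_mul]

/-- The product measure is determined by rectangles, on which a point mass at a pair factorises. -/
lemma prod_pointVortexMeasure (ξ : Fin N → ℝ) (x : Fin N → Torus) :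
    VectorMeasure.prod (pointVortexMeasure ξ x) (pointVortexMeasure ξ x)
      (ContinuousLinearMap.mul ℝ ℝ) =
    ∑ p : Fin N × Fin N, ((N : ℝ)⁻¹ * (ξ p.1 * ξ p.2)) •
      VectorMeasure.dirac (x p.1, x p.2) (1 : ℝ) := by
  refine VectorMeasure.prod_eq_of_forall_apply_prod fun s t hs ht => ?_
  have hd : ∀ i j, VectorMeasure.dirac (x i, x j) (1 : ℝ) (s ×ˢ t) =
      VectorMeasure.dirac (x i) (1 : ℝ) s * VectorMeasure.dirac (x j) (1 : ℝ) t := by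
    intro i j
    by_cases h1 : x i ∈ s <;> by_cases h2 : x j ∈ t <;> simp [hs, ht, hs.prod ht, h1, h2]
  have hN : (N : ℝ)⁻¹ = (√(N : ℝ))⁻¹ * (√(N : ℝ))⁻¹ := by
    rw [← mul_inv, Real.mul_self_sqrt (Nat.cast_nonneg N)]
  simp only [pointVortexMeasure, smul_apply, sum_apply,
    smul_eq_mul, ContinuousLinearMap.mul_apply', hd, hN, Fintype.sum_prod_type]
  rw [mul_mul_mul_comm, Finset.sum_mul_sum, Finset.mul_sum]
  refine Finset.sum_congr rfl fun i _ => ?_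
  rw [Finset.mul_sum]
  refine Finset.sum_congr rfl fun j _ => ?_
  ring

lemma tensorPair_pointVortexMeasure (ξ : Fin N → ℝ) (x : Fin N → Torus) (F : Torus × Torus → ℝ) :
    tensorPair (pointVortexMeasure ξ x) F =
      (N : ℝ)⁻¹ * ∑ i, ∑ j, ξ i * ξ j * F (x i, x j) := by
  rw [tensorPair, prod_pointVortexMeasure, integral_sum_smul_dirac, Fintype.sum_prod_type,
    Finset.mul_sum]
  refine Finset.sum_congr rfl fun i _ => ?_
  rw [Finset.mul_sum]
  exact Finset.sum_congr rfl fun j _ => by ring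

lemma map_pointVortexMeasure (ξ : Fin N → ℝ) (x : Fin N → Torus) (a : Torus) :
    (pointVortexMeasure ξ x).map (fun y => y + a) = pointVortexMeasure ξ fun i => x i + a := by
  have hm : Measurable fun y : Torus => y + a := measurable_add_const a
  ext s hs
  rw [VectorMeasure.map_apply _ hm hs]
  simp only [pointVortexMeasure, smul_apply, sum_apply]
  congr 1
  refine Finset.sum_congr rfl fun i _ => ?_
  congr 1
  by_cases h : x i + a ∈ s
  · rw [VectorMeasure.dirac_apply_of_mem (hm hs) h, VectorMeasure.dirac_apply_of_mem hs h]
  · rw [VectorMeasure.dirac_apply_of_notMem h,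
      VectorMeasure.dirac_apply_of_notMem (s := (fun y => y + a) ⁻¹' s) h]

lemma TorusDistribution.measurable_iff {Ω : Type*} [MeasurableSpace Ω] {f : Ω → TorusDistribution} :
    Measurable f ↔ ∀ φ : SmoothTorusFn, Measurable fun ω => (f ω).pair φ := by
  constructor
  · intro h φ
    have h1 : Measurable fun T : TorusDistribution => T.pair φ :=
      measurable_iff_comap_le.mpr (le_iSup (fun φ : SmoothTorusFn =>
        MeasurableSpace.comap (fun T : TorusDistribution => T.pair φ) inferInstance) φ)
    exact h1.comp h
  · intro h
    rw [measurable_iff_comap_le]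
    change MeasurableSpace.comap f (⨆ φ : SmoothTorusFn, _) ≤ _
    rw [MeasurableSpace.comap_iSup]
    refine iSup_le fun φ => ?_
    rw [MeasurableSpace.comap_comp]
    exact measurable_iff_comap_le.mp (h φ)

/-- The distribution `N^{-1/2} ∑_n ξ_n δ_{x_n}`. -/
def pointVortexDistribution (p : (Fin N → ℝ) × (Fin N → Torus)) : TorusDistribution :=
  measureDistribution (pointVortexMeasure p.1 p.2)

lemma measurable_pointVortexDistribution : Measurable (pointVortexDistribution (N := N)) := by
  rw [TorusDistribution.measurable_iff]
  intro φ
  simp only [pointVortexDistribution, pair_pointVortexMeasure]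
  have := continuous_smoothTorusFn φ
  exact Continuous.measurable (by fun_prop)

end PointMeasures

/-! ### The evolution equation, stationarity and homogeneity of the vortex field -/

section Field

variable {N : ℕ} {K : Torus → Plane} {b : ℝ} {g : Torus → ℝ}

/-- The chain rule gives a double sum of `K(X^i - X^j) · ∇φ(X^i)`. As `K` is odd, exchanging the
indices and averaging replaces the gradient by half a gradient difference. -/
lemma hasDerivAt_pair_vortexField (hg : IsGreenPair K b g) {ξ : Fin N → ℝ} {x : Fin N → Torus}
    (hX : ∃ X, IsVortexSolution K ξ x X) {t : ℝ} (ht : 0 < t) (φ : SmoothTorusFn) :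
    HasDerivAt (fun s => (measureDistribution (vortexField K ξ x s)).pair φ)
      (1 / 2 * tensorPair (vortexField K ξ x t) (vortexH K φ.1)) t := by
  set X := vortexFlow K ξ x with hXdef
  obtain ⟨Y, hYX, hY⟩ := (isVortexSolution_vortexFlow hX).exists_curve
  have hφ : ContDiff ℝ ((⊤ : ℕ∞) : WithTop ℕ∞) (fun x : Plane => φ.1 (torusProj x)) := φ.2
  have hYi : ∀ i, HasDerivAt (fun s => Y s i) (vortexVelocity K ξ (X t) i) t := fun i =>
    hasDerivAt_pi.mp ((hY t ht.le).hasDerivAt (Ici_mem_nhds ht)) i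
  have hXi : ∀ s, 0 ≤ s → ∀ i, torusProj (Y s i) = X s i := fun s hs i => congrFun (hYX s hs) i
  have hφi : ∀ i, HasDerivAt (fun s => φ.1 (X s i))
      (inner ℝ (torusGrad φ.1 (X t i)) (vortexVelocity K ξ (X t) i)) t := by
    intro i
    have h1 := hasFDerivAt_torusGrad (φ := φ.1) (x := Y t i)
      ((hφ.differentiable (by simp)) (Y t i))
    have h2 := h1.comp_hasDerivAt t (hYi i)
    rw [innerSL_apply_apply, hXi t ht.le] at h2
    refine h2.congr_of_eventuallyEq ?_
    filter_upwards [Ici_mem_nhds ht] with s hs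
    rw [Function.comp_apply, hXi s hs]
  have hsum := (HasDerivAt.fun_sum fun i (_ : i ∈ Finset.univ) => (hφi i).const_mul (ξ i)).const_mul
    (√(N : ℝ))⁻¹
  simp only [vortexField, pair_pointVortexMeasure, tensorPair_pointVortexMeasure]
  refine hsum.congr_deriv ?_
  have hN : (N : ℝ)⁻¹ = (√(N : ℝ))⁻¹ * (√(N : ℝ))⁻¹ := by
    rw [← mul_inv, Real.mul_self_sqrt (Nat.cast_nonneg N)]
  -- The one-sided interaction; the summand of `H_φ` is `A i j + A j i`, which accounts for the
  -- factor `1/2`.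
  set A : Fin N → Fin N → ℝ := fun i j =>
    ξ i * ξ j * inner ℝ (K (X t i - X t j)) (torusGrad φ.1 (X t i)) with hA
  have hH : ∀ i j, ξ i * ξ j * vortexH K φ.1 (X t i, X t j) = A i j + A j i := by
    intro i j
    simp only [vortexH, hA]
    rw [← neg_sub (X t i) (X t j), hg.odd, inner_sub_right, inner_neg_left]
    ring
  have hswap : ∑ i, ∑ j, A j i = ∑ i, ∑ j, A i j := Finset.sum_comm
  have hR : ∑ i, ∑ j, ξ i * ξ j * vortexH K φ.1 (X t i, X t j) = 2 * ∑ i, ∑ j, A i j := by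
    simp only [hH, Finset.sum_add_distrib, hswap, two_mul]
  have hL : ∀ i, ξ i * inner ℝ (torusGrad φ.1 (X t i)) (vortexVelocity K ξ (X t) i) =
      (√(N : ℝ))⁻¹ * ∑ j, A i j := by
    intro i
    simp only [vortexVelocity, hA, inner_smul_right, inner_sum, Finset.mul_sum]
    refine Finset.sum_congr rfl fun j _ => ?_
    rw [real_inner_comm]
    ring
  rw [hR, hN]
  simp only [hL, ← Finset.mul_sum]
  ring

lemma aemeasurable_vortexField (hg : IsGreenPair K b g) (hK : Integrable fun p => ‖K p‖) {t : ℝ}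
    (ht : 0 ≤ t) : AEMeasurable
      (fun p => measureDistribution (vortexField K p.1 p.2 t)) (vortexLaw N) := by
  have h := measurable_pointVortexDistribution.comp_aemeasurable
    (aemeasurable_vortexMap (N := N) hg hK ht)
  exact h

lemma map_vortexField (hg : IsGreenPair K b g) (hK : Integrable fun p => ‖K p‖) {t : ℝ}
    (ht : 0 ≤ t) {β : Type*} [MeasurableSpace β] {F : (Fin N → ℝ) × (Fin N → Torus) → β}
    (hF : AEMeasurable F (vortexLaw N)) :
    (vortexLaw N).map (fun p => F (vortexMap K t p)) = (vortexLaw N).map F := by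
  have h := map_vortexMap (N := N) hg hK ht
  rw [← h] at hF
  conv_rhs => rw [← h, AEMeasurable.map_map_of_aemeasurable hF (aemeasurable_vortexMap hg hK ht)]
  rfl

/-- The field at finitely many times. -/
def vortexFieldVector (K : Torus → Plane) {m : ℕ} (t : Fin m → ℝ)
    (p : (Fin N → ℝ) × (Fin N → Torus)) : Fin m → TorusDistribution :=
  fun k => measureDistribution (vortexField K p.1 p.2 (t k))

lemma aemeasurable_vortexFieldVector (hg : IsGreenPair K b g) (hK : Integrable fun p => ‖K p‖)
    {m : ℕ} {t : Fin m → ℝ} (ht : ∀ k, 0 ≤ t k) :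
    AEMeasurable (vortexFieldVector K t) (vortexLaw N) :=
  aemeasurable_pi_lambda _ fun k => aemeasurable_vortexField hg hK (ht k)

/-- By the semigroup property the field at shifted times is the unshifted field evaluated at the
data moved by `vortexMap`, whose law is unchanged. -/
lemma identDistrib_vortexFieldVector_add (hg : IsGreenPair K b g)
    (hK : Integrable fun p => ‖K p‖) {m : ℕ} {t : Fin m → ℝ} (ht : ∀ k, 0 ≤ t k) {h : ℝ}
    (hh : 0 ≤ h) :
    IdentDistrib (vortexFieldVector (N := N) K fun k => t k + h) (vortexFieldVector K t)
      (vortexLaw N) (vortexLaw N) := by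
  have hm := aemeasurable_vortexFieldVector (N := N) hg hK ht
  refine ⟨aemeasurable_vortexFieldVector hg hK fun k => add_nonneg (ht k) hh, hm, ?_⟩
  rw [← map_vortexField hg hK hh hm]
  refine Measure.map_congr ?_
  filter_upwards [ae_exists_isVortexSolution hg hK] with p hp
  funext k
  simp only [vortexFieldVector, vortexField, vortexMap]
  rw [vortexFlow_add hg hp (ht k) hh]

lemma measurePreserving_translate (a : Torus) :
    MeasurePreserving (fun p : (Fin N → ℝ) × (Fin N → Torus) => (p.1, fun i => p.2 i + a))
      (vortexLaw N) (vortexLaw N) :=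
  (MeasurePreserving.id _).prod (measurePreserving_add_right volume fun _ : Fin N => a)

/-- The system depends on positions only through differences, so translating the field amounts to
translating the initial positions, which preserves their law. -/
lemma identDistrib_map_vortexFieldVector (hg : IsGreenPair K b g)
    (hK : Integrable fun p => ‖K p‖) {m : ℕ} {t : Fin m → ℝ} (ht : ∀ k, 0 ≤ t k) (a : Torus) :
    IdentDistrib (fun (p : (Fin N → ℝ) × (Fin N → Torus)) k =>
        measureDistribution ((vortexField K p.1 p.2 (t k)).map (fun x => x + a)))
      (vortexFieldVector K t) (vortexLaw N) (vortexLaw N) := by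
  have hm := aemeasurable_vortexFieldVector (N := N) hg hK ht
  have ha := measurePreserving_translate (N := N) a
  have hae : (fun p : (Fin N → ℝ) × (Fin N → Torus) => vortexFieldVector K t
      (p.1, fun i => p.2 i + a)) =ᵐ[vortexLaw N] fun p k =>
        measureDistribution ((vortexField K p.1 p.2 (t k)).map (fun x => x + a)) := by
    filter_upwards [ae_exists_isVortexSolution hg hK] with p hp
    funext k
    simp only [vortexFieldVector, vortexField, map_pointVortexMeasure]
    rw [vortexFlow_add_const hg hp a (ht k)]
  have hm' : AEMeasurable (fun p : (Fin N → ℝ) × (Fin N → Torus) => vortexFieldVector K t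
      (p.1, fun i => p.2 i + a)) (vortexLaw N) := by
    have h1 := hm
    rw [← ha.map_eq] at h1
    exact h1.comp_aemeasurable ha.measurable.aemeasurable
  refine ⟨hm'.congr hae, hm, ?_⟩
  rw [← Measure.map_congr hae]
  have h1 := hm
  rw [← ha.map_eq] at h1
  have h2 := AEMeasurable.map_map_of_aemeasurable h1 ha.measurable.aemeasurable
  rw [ha.map_eq] at h2
  exact h2.symm

/-- Transfers identities proved on the canonical space of intensities and positions to an arbitrary
probability space. -/
lemma IdentDistrib.comp_hasLaw {Ω 𝓧 β : Type*} [MeasurableSpace Ω] [MeasurableSpace 𝓧]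
    [MeasurableSpace β] {Z : Ω → 𝓧} {μ : Measure 𝓧} {P : Measure Ω} (hZ : HasLaw Z μ P)
    {f f' : 𝓧 → β} (h : IdentDistrib f f' μ μ) :
    IdentDistrib (fun ω => f (Z ω)) (fun ω => f' (Z ω)) P P := by
  have h1 := h.aemeasurable_fst
  have h2 := h.aemeasurable_snd
  rw [← hZ.map_eq] at h1 h2
  refine ⟨h1.comp_aemeasurable hZ.aemeasurable, h2.comp_aemeasurable hZ.aemeasurable, ?_⟩
  have e1 := AEMeasurable.map_map_of_aemeasurable h1 hZ.aemeasurable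
  have e2 := AEMeasurable.map_map_of_aemeasurable h2 hZ.aemeasurable
  rw [hZ.map_eq] at e1 e2
  have := h.map_eq
  rw [e1, e2] at this
  exact this

end Field

end


noncomputable section

/-! ### Second moments of quadratic functionals of the point vortex measure -/

section SecondMoment

variable {N : ℕ}

/-- The law of `N` independent standard Gaussian variables. -/
abbrev stdGaussianPi (N : ℕ) : Measure (Fin N → ℝ) := Measure.pi fun _ => gaussianReal 0 1

lemma integrable_pow_gaussianReal (k : ℕ) : Integrable (fun x : ℝ => x ^ k) (gaussianReal 0 1) := by
  rcases Nat.eq_zero_or_pos k with rfl | hk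
  · simp
  have h := (memLp_id_gaussianReal (μ := 0) (v := 1) k).integrable_norm_pow' 
  refine (h.mono' (by fun_prop) (Eventually.of_forall fun x => ?_))
  simp

lemma measurePreserving_eval_stdGaussianPi (i : Fin N) :
    MeasurePreserving (fun ξ : Fin N → ℝ => ξ i) (stdGaussianPi N) (gaussianReal 0 1) :=
  measurePreserving_eval (fun _ : Fin N => gaussianReal 0 1) i

lemma integrable_eval_pow (i : Fin N) (k : ℕ) :
    Integrable (fun ξ : Fin N → ℝ => ξ i ^ k) (stdGaussianPi N) :=
  (measurePreserving_eval_stdGaussianPi i).integrable_comp_of_integrable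
    (integrable_pow_gaussianReal k)

lemma integral_eval_pow (i : Fin N) (k : ℕ) :
    ∫ ξ : Fin N → ℝ, ξ i ^ k ∂(stdGaussianPi N) = ∫ x, x ^ k ∂(gaussianReal 0 1) := by
  rw [← (measurePreserving_eval_stdGaussianPi i).map_eq, integral_map (measurable_pi_apply i).aemeasurable
    (by fun_prop)]

lemma memLp_eval_mul_eval (i j : Fin N) :
    MemLp (fun ξ : Fin N → ℝ => ξ i * ξ j) 2 (stdGaussianPi N) := by
  rw [memLp_two_iff_integrable_sq (by fun_prop)]
  refine ((integrable_eval_pow i 4).add (integrable_eval_pow j 4)).mono' (by fun_prop)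
    (Eventually.of_forall fun ξ => ?_)
  rw [Real.norm_of_nonneg (sq_nonneg _)]
  simp only [Pi.add_apply]
  nlinarith [sq_nonneg (ξ i ^ 2 - ξ j ^ 2), sq_nonneg (ξ i ^ 2), sq_nonneg (ξ j ^ 2)]

lemma integrable_eval_mul₄ (i j k l : Fin N) :
    Integrable (fun ξ : Fin N → ℝ => ξ i * ξ j * (ξ k * ξ l)) (stdGaussianPi N) :=
  (memLp_eval_mul_eval i j).integrable_mul (memLp_eval_mul_eval k l)

lemma measurePreserving_flip (i : Fin N) :
    MeasurePreserving (fun (ξ : Fin N → ℝ) j => if j = i then -ξ j else ξ j) (stdGaussianPi N)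
      (stdGaussianPi N) := by
  have h : ∀ j : Fin N, MeasurePreserving (fun x : ℝ => if j = i then -x else x)
      (gaussianReal 0 1) (gaussianReal 0 1) := by
    intro j
    by_cases hj : j = i
    · simp only [hj, if_true]
      refine ⟨measurable_neg, ?_⟩
      have := gaussianReal_map_neg (μ := 0) (v := 1)
      simpa using this
    · simp only [hj, if_false]
      exact MeasurePreserving.id _
  exact measurePreserving_pi _ _ h

/-- Flipping the sign of `ξ i` preserves the law, while an index occurring exactly once makes the
product change sign. -/
lemma integral_eval_mul₄_eq_zero {i j k l : Fin N} (hj : j ≠ i) (hk : k ≠ i) (hl : l ≠ i) :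
    ∫ ξ : Fin N → ℝ, ξ i * ξ j * (ξ k * ξ l) ∂(stdGaussianPi N) = 0 := by
  have h := integral_map (μ := stdGaussianPi N) (measurePreserving_flip i).measurable.aemeasurable
    (f := fun ξ : Fin N → ℝ => ξ i * ξ j * (ξ k * ξ l)) (by fun_prop)
  rw [(measurePreserving_flip i).map_eq] at h
  simp only [hj, hk, hl, if_true, if_false, neg_mul, integral_neg] at h
  linarith

/-- The fourth moment of a standard Gaussian variable. -/
def gaussianFourthMoment : ℝ := ∫ x, x ^ 4 ∂(gaussianReal 0 1)

lemma gaussianFourthMoment_nonneg : 0 ≤ gaussianFourthMoment :=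
  integral_nonneg fun x => by positivity

/-- The inequality `a²b² ≤ (a⁴ + b⁴)/2` avoids separating equal from distinct indices; sharpness is
not needed. -/
lemma integral_eval_sq_mul_le (i j : Fin N) :
    ∫ ξ : Fin N → ℝ, ξ i * ξ j * (ξ i * ξ j) ∂(stdGaussianPi N) ≤ gaussianFourthMoment := by
  have h : ∫ ξ : Fin N → ℝ, ξ i * ξ j * (ξ i * ξ j) ∂(stdGaussianPi N) ≤
      ∫ ξ : Fin N → ℝ, (1 / 2 * ξ i ^ 4 + 1 / 2 * ξ j ^ 4) ∂(stdGaussianPi N) := by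
    refine integral_mono (integrable_eval_mul₄ i j i j)
      (((integrable_eval_pow i 4).const_mul _).add ((integrable_eval_pow j 4).const_mul _))
      fun ξ => ?_
    simp only
    nlinarith [sq_nonneg (ξ i ^ 2 - ξ j ^ 2)]
  refine h.trans (le_of_eq ?_)
  rw [integral_add ((integrable_eval_pow i 4).const_mul _) ((integrable_eval_pow j 4).const_mul _),
    integral_const_mul, integral_const_mul, integral_eval_pow, integral_eval_pow,
    gaussianFourthMoment]
  ring

lemma measurePreserving_eval_pair {i j : Fin N} (hij : i ≠ j) :
    MeasurePreserving (fun x : Fin N → Torus => (x i, x j)) volume volume := by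
  let e (i : Fin N) : (Fin N → Torus) →+ Torus := Pi.evalAddMonoidHom (fun _ : Fin N => Torus) i
  let f : (Fin N → Torus) →+ Torus × Torus := (e i).prod (e j)
  have hf : Continuous f := (continuous_apply i).prodMk (continuous_apply j)
  have : Measure.IsAddHaarMeasure (volume : Measure (Torus × Torus)) :=
    Measure.prod.instIsAddHaarMeasure (volume : Measure Torus) (volume : Measure Torus)
  refine AddMonoidHom.measurePreserving (f := f) hf (fun p => ?_) (by simp)
  exact ⟨Pi.single i p.1 + Pi.single j p.2, by simp [f, e, hij, hij.symm]⟩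

variable {h : Torus × Torus → ℝ}

lemma memLp_eval_pair (hh : MemLp h 2) (h0 : ∀ x, h (x, x) = 0) (i j : Fin N) :
    MemLp (fun x : Fin N → Torus => h (x i, x j)) 2 := by
  by_cases hij : i = j
  · simp [hij, h0]
  · exact hh.comp_measurePreserving (measurePreserving_eval_pair hij)

lemma integrable_quadratic_term (hh : MemLp h 2) (h0 : ∀ x, h (x, x) = 0) (i j k l : Fin N) :
    Integrable (fun p : (Fin N → ℝ) × (Fin N → Torus) =>
      p.1 i * p.1 j * (p.1 k * p.1 l) * (h (p.2 i, p.2 j) * h (p.2 k, p.2 l))) (vortexLaw N) :=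
  (integrable_eval_mul₄ i j k l).mul_prod
    ((memLp_eval_pair hh h0 i j).integrable_mul (memLp_eval_pair hh h0 k l))

/-- With a kernel vanishing on the diagonal, only the pairings `(k, l) = (i, j)` and `(k, l) = (j,
i)` have a nonzero Gaussian factor; symmetry of `h` makes the two equal. -/
lemma integral_quadratic_term_le (hh : MemLp h 2) (h0 : ∀ x, h (x, x) = 0)
    (hsymm : ∀ x y, h (y, x) = h (x, y)) (i j k l : Fin N) :
    ∫ p : (Fin N → ℝ) × (Fin N → Torus),
      p.1 i * p.1 j * (p.1 k * p.1 l) * (h (p.2 i, p.2 j) * h (p.2 k, p.2 l)) ∂(vortexLaw N) ≤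
    (gaussianFourthMoment * ∫ p, h p ^ 2) *
      ((if k = i ∧ l = j then 1 else 0) + (if k = j ∧ l = i then 1 else 0)) := by
  have hnn : 0 ≤ gaussianFourthMoment * ∫ p, h p ^ 2 :=
    mul_nonneg gaussianFourthMoment_nonneg (integral_nonneg fun p => sq_nonneg _)
  have hRn : 0 ≤ (gaussianFourthMoment * ∫ p, h p ^ 2) *
      ((if k = i ∧ l = j then 1 else 0) + (if k = j ∧ l = i then 1 else 0)) := by
    refine mul_nonneg hnn ?_
    split_ifs <;> norm_num
  have hprod := integral_prod_mul (μ := stdGaussianPi N) (ν := (volume : Measure (Fin N → Torus)))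
    (fun ξ => ξ i * ξ j * (ξ k * ξ l)) (fun x => h (x i, x j) * h (x k, x l))
  rw [vortexLaw, hprod]
  by_cases hij : i = j
  · simp only [hij, h0, zero_mul, integral_zero, mul_zero] at hRn ⊢
    exact hRn
  by_cases hkl : k = l
  · simp only [hkl, h0, mul_zero, integral_zero] at hRn ⊢
    exact hRn
  have hsq : ∫ x : Fin N → Torus, h (x i, x j) * h (x i, x j) = ∫ p, h p ^ 2 := by
    rw [← (measurePreserving_eval_pair hij).map_eq, integral_map
      (measurePreserving_eval_pair hij).measurable.aemeasurable]
    · simp only [sq]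
    · rw [(measurePreserving_eval_pair hij).map_eq]
      exact hh.aestronglyMeasurable.pow 2
  have hmain : (∫ ξ : Fin N → ℝ, ξ i * ξ j * (ξ i * ξ j) ∂(stdGaussianPi N)) *
      ∫ x : Fin N → Torus, h (x i, x j) * h (x i, x j) ≤ gaussianFourthMoment * ∫ p, h p ^ 2 := by
    rw [hsq]
    exact mul_le_mul_of_nonneg_right (integral_eval_sq_mul_le i j)
      (integral_nonneg fun p => sq_nonneg _)
  by_cases h1 : k = i ∧ l = j
  · obtain ⟨rfl, rfl⟩ := h1
    have : ¬ (k = l ∧ l = k) := fun h => hkl h.1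
    simpa [this] using hmain
  by_cases h2 : k = j ∧ l = i
  · obtain ⟨rfl, rfl⟩ := h2
    have : ¬ (k = l ∧ l = k) := fun h => hkl h.1
    have e1 : ∀ ξ : Fin N → ℝ, ξ k * ξ l = ξ l * ξ k := fun ξ => mul_comm _ _
    have e2 : ∀ x : Fin N → Torus, h (x k, x l) = h (x l, x k) := fun x => hsymm _ _
    simp only [e1, e2]
    simpa [this, e1] using hmain
  -- As `i ≠ j` and `k ≠ l`, having both `i` and `j` among `k, l` would be a pairing. So one of them
  -- occurs only once and the fourth-order moment is zero.
  have hz : ∫ ξ : Fin N → ℝ, ξ i * ξ j * (ξ k * ξ l) ∂(stdGaussianPi N) = 0 := by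
    by_cases hi : k ≠ i ∧ l ≠ i
    · exact integral_eval_mul₄_eq_zero (Ne.symm hij) hi.1 hi.2
    have hj : k ≠ j ∧ l ≠ j := by
      constructor
      · rintro rfl; apply hi; exact ⟨Ne.symm hij, fun h => h2 ⟨rfl, h⟩⟩
      · rintro rfl; apply hi; exact ⟨fun h => h1 ⟨h, rfl⟩, Ne.symm hij⟩
    rw [← integral_eval_mul₄_eq_zero hij hj.1 hj.2]
    exact integral_congr_ae (Eventually.of_forall fun ξ => by ring)
  rw [hz, zero_mul]
  exact hRn

lemma sq_tensorPair_pointVortexMeasure (h : Torus × Torus → ℝ)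
    (p : (Fin N → ℝ) × (Fin N → Torus)) :
    tensorPair (pointVortexMeasure p.1 p.2) h ^ 2 = ((N : ℝ)⁻¹) ^ 2 *
      ∑ i, ∑ j, ∑ k, ∑ l, p.1 i * p.1 j * (p.1 k * p.1 l) *
        (h (p.2 i, p.2 j) * h (p.2 k, p.2 l)) := by
  rw [tensorPair_pointVortexMeasure, mul_pow, sq (∑ i, _), Finset.sum_mul]
  congr 1
  refine Finset.sum_congr rfl fun i _ => ?_
  rw [Finset.sum_mul]
  refine Finset.sum_congr rfl fun j _ => ?_
  rw [Finset.mul_sum]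
  refine Finset.sum_congr rfl fun k _ => ?_
  rw [Finset.mul_sum]
  exact Finset.sum_congr rfl fun l _ => by ring

lemma integrable_sq_tensorPair (hh : MemLp h 2) (h0 : ∀ x, h (x, x) = 0) :
    Integrable (fun p : (Fin N → ℝ) × (Fin N → Torus) =>
      tensorPair (pointVortexMeasure p.1 p.2) h ^ 2) (vortexLaw N) := by
  simp only [sq_tensorPair_pointVortexMeasure]
  exact Integrable.const_mul (integrable_finsetSum _ fun i _ => integrable_finsetSum _ fun j _ =>
    integrable_finsetSum _ fun k _ => integrable_finsetSum _ fun l _ =>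
      integrable_quadratic_term hh h0 i j k l) _

/-- For each of the `N²` pairs `(i, j)` at most two terms survive, and the prefactor `N⁻²`
compensates exactly. -/
lemma integral_sq_tensorPair_le (hh : MemLp h 2) (h0 : ∀ x, h (x, x) = 0)
    (hsymm : ∀ x y, h (y, x) = h (x, y)) :
    ∫ p, tensorPair (pointVortexMeasure p.1 p.2) h ^ 2 ∂(vortexLaw N) ≤
      2 * gaussianFourthMoment * ∫ p, h p ^ 2 := by
  simp only [sq_tensorPair_pointVortexMeasure]
  have hI := integrable_quadratic_term (N := N) hh h0
  rw [integral_const_mul, integral_finsetSum _ fun i _ => integrable_finsetSum _ fun j _ =>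
    integrable_finsetSum _ fun k _ => integrable_finsetSum _ fun l _ => hI i j k l]
  simp_rw [integral_finsetSum _ fun j _ => integrable_finsetSum _ fun k _ =>
      integrable_finsetSum _ fun l _ => hI _ j k l,
    integral_finsetSum _ fun k _ => integrable_finsetSum _ fun l _ => hI _ _ k l,
    integral_finsetSum _ fun l _ => hI _ _ _ l]
  set A := gaussianFourthMoment * ∫ p, h p ^ 2 with hA
  have hA0 : 0 ≤ A := mul_nonneg gaussianFourthMoment_nonneg (integral_nonneg fun p => sq_nonneg _)
  have hsum : ∀ i j : Fin N, ∑ k, ∑ l, A * ((if k = i ∧ l = j then (1 : ℝ) else 0) +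
      (if k = j ∧ l = i then 1 else 0)) = 2 * A := by
    intro i j
    simp only [← Finset.mul_sum, Finset.sum_add_distrib, ite_and, Finset.sum_ite_eq',
      Finset.mem_univ, if_true, Finset.sum_ite_irrel, Finset.sum_const_zero]
    ring
  calc _ ≤ ((N : ℝ)⁻¹) ^ 2 * ∑ i : Fin N, ∑ j : Fin N, 2 * A := by
        refine mul_le_mul_of_nonneg_left ?_ (by positivity)
        refine Finset.sum_le_sum fun i _ => Finset.sum_le_sum fun j _ => ?_
        rw [← hsum i j]
        exact Finset.sum_le_sum fun k _ => Finset.sum_le_sum fun l _ =>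
          integral_quadratic_term_le hh h0 hsymm i j k l
    _ = ((N : ℝ)⁻¹ * N) ^ 2 * (2 * A) := by
        simp only [Finset.sum_const, Finset.card_univ, Fintype.card_fin, nsmul_eq_mul]
        ring
    _ ≤ 1 * (2 * A) := by
        refine mul_le_mul_of_nonneg_right ?_ (by positivity)
        -- For `N = 0` the convention `0⁻¹ = 0` makes the left side vanish.
        rcases eq_or_ne (N : ℝ) 0 with hN | hN
        · simp [hN]
        · rw [inv_mul_cancel₀ hN, one_pow]
    _ = _ := by rw [hA]; ring

end SecondMoment

end


noncomputable section

/-! ### The real basis `cos + sin` and Sobolev norms expressed in it -/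

section Cas

/-- The real trigonometric basis function `cos (2πn·x) + sin (2πn·x)`. -/
def torusCas (n : Fin 2 → ℤ) : SmoothTorusFn := torusCos n + torusSin n

lemma torusCas_apply (n : Fin 2 → ℤ) (x : Torus) :
    (torusCas n).1 x = (UnitAddTorus.mFourier n x).re + (UnitAddTorus.mFourier n x).im := rfl

lemma norm_mFourier_apply (n : Fin 2 → ℤ) (x : Torus) : ‖UnitAddTorus.mFourier n x‖ = 1 := by
  simp only [UnitAddTorus.mFourier, ContinuousMap.coe_mk, norm_prod, fourier_apply,
    Circle.norm_coe, Finset.prod_const_one]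

lemma abs_torusCas_le (n : Fin 2 → ℤ) (x : Torus) : |(torusCas n).1 x| ≤ 2 := by
  have h1 := Complex.abs_re_le_norm (UnitAddTorus.mFourier n x)
  have h2 := Complex.abs_im_le_norm (UnitAddTorus.mFourier n x)
  rw [norm_mFourier_apply] at h1 h2
  rw [torusCas_apply]
  exact (abs_add_le _ _).trans (by linarith)

lemma torusCos_neg (n : Fin 2 → ℤ) : torusCos (-n) = torusCos n := by
  refine Subtype.ext (funext fun x => ?_)
  change (UnitAddTorus.mFourier (-n) x).re = (UnitAddTorus.mFourier n x).re
  rw [UnitAddTorus.mFourier_neg, Complex.conj_re]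

lemma torusSin_neg (n : Fin 2 → ℤ) : torusSin (-n) = -torusSin n := by
  refine Subtype.ext (funext fun x => ?_)
  change (UnitAddTorus.mFourier (-n) x).im = -(UnitAddTorus.mFourier n x).im
  rw [UnitAddTorus.mFourier_neg, Complex.conj_im]

namespace TorusDistribution

lemma pair_add_right (T : TorusDistribution) (φ ψ : SmoothTorusFn) :
    T.pair (φ + ψ) = T.pair φ + T.pair ψ := map_add T.1 φ ψ

lemma pair_neg_right (T : TorusDistribution) (φ : SmoothTorusFn) :
    T.pair (-φ) = -T.pair φ := map_neg T.1 φ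

lemma pair_sub_right (T : TorusDistribution) (φ ψ : SmoothTorusFn) :
    T.pair (φ - ψ) = T.pair φ - T.pair ψ := map_sub T.1 φ ψ

lemma pair_smul_right (T : TorusDistribution) (c : ℝ) (φ : SmoothTorusFn) :
    T.pair (c • φ) = c * T.pair φ := map_smul T.1 c φ

lemma pair_sum_right {ι : Type*} (T : TorusDistribution) (s : Finset ι) (φ : ι → SmoothTorusFn) :
    T.pair (∑ i ∈ s, φ i) = ∑ i ∈ s, T.pair (φ i) := map_sum T.1 φ s

end TorusDistribution

/-- The coefficients of a distribution in the basis `torusCas`. -/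
def casCoeff (T : TorusDistribution) (n : Fin 2 → ℤ) : ℝ := T.pair (torusCas n)

/-- The coefficients at `n` and `-n` are the sum and difference of the cosine and sine parts, so
this is the parallelogram identity. The basis is real and indexed by all of `ℤ²`, so no choice of
half-lattice is needed for white noise. -/
lemma norm_distFourier_sq (T : TorusDistribution) (n : Fin 2 → ℤ) :
    ‖distFourier n T‖ ^ 2 = 1 / 2 * (casCoeff T n ^ 2 + casCoeff T (-n) ^ 2) := by
  have h1 : casCoeff T n = T.pair (torusCos n) + T.pair (torusSin n) := T.pair_add_right _ _
  have h2 : casCoeff T (-n) = T.pair (torusCos n) - T.pair (torusSin n) := by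
    rw [casCoeff, torusCas, T.pair_add_right, torusCos_neg, torusSin_neg, T.pair_neg_right]
    ring
  have h3 : ‖distFourier n T‖ ^ 2 = T.pair (torusCos n) ^ 2 + T.pair (torusSin n) ^ 2 := by
    rw [Complex.sq_norm, Complex.normSq_apply]
    change T.pair (torusCos n) * T.pair (torusCos n) + T.pair (torusSin n) * T.pair (torusSin n) = _
    ring
  rw [h1, h2, h3]
  ring

lemma sobolevWeight_neg (s : ℝ) (n : Fin 2 → ℤ) : sobolevWeight s (-n) = sobolevWeight s n := by
  simp [sobolevWeight]

lemma sobolevWeight_pos (s : ℝ) (n : Fin 2 → ℤ) : 0 < sobolevWeight s n :=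
  Real.rpow_pos_of_pos (by positivity) s

variable {s : ℝ}

lemma hasSum_comp_neg {f : (Fin 2 → ℤ) → ℝ} {a : ℝ} (h : HasSum f a) :
    HasSum (fun n => f (-n)) a := (Equiv.neg (Fin 2 → ℤ)).hasSum_iff.mpr h

lemma mem_sobolevSubmodule_iff {T : TorusDistribution} :
    T ∈ sobolevSubmodule s ↔ Summable fun n => sobolevWeight s n * casCoeff T n ^ 2 := by
  change (Summable fun n => sobolevWeight s n * ‖distFourier n T‖ ^ 2) ↔ _
  constructor
  · intro h
    refine Summable.of_nonneg_of_le
      (fun n => mul_nonneg (sobolevWeight_nonneg s n) (sq_nonneg _)) (fun n => ?_) (h.mul_left 2)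
    rw [norm_distFourier_sq]
    have := mul_nonneg (sobolevWeight_nonneg s n) (sq_nonneg (casCoeff T (-n)))
    nlinarith
  · intro h
    have h2 := (Equiv.neg (Fin 2 → ℤ)).summable_iff.mpr h
    refine ((h.add h2).mul_left (1 / 2)).congr fun n => ?_
    simp only [norm_distFourier_sq, Function.comp_apply, Equiv.neg_apply, sobolevWeight_neg]
    ring

namespace SobolevSpace

lemma summable_casCoeff (T : SobolevSpace s) :
    Summable fun n => sobolevWeight s n * casCoeff T.toDistribution n ^ 2 :=
  mem_sobolevSubmodule_iff.mp T.2

/-- The weights are even in `n`, so averaging over `n` and `-n` does not change the sum. -/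
lemma norm_sq_eq_casCoeff (T : SobolevSpace s) :
    ‖T‖ ^ 2 = ∑' n, sobolevWeight s n * casCoeff T.toDistribution n ^ 2 := by
  rw [norm_sq_eq]
  have h1 := T.summable_casCoeff.hasSum
  have h2 := ((h1.add (hasSum_comp_neg h1)).mul_left (1 / 2)).tsum_eq
  rw [show 1 / 2 * (∑' n, sobolevWeight s n * casCoeff T.toDistribution n ^ 2 +
    ∑' n, sobolevWeight s n * casCoeff T.toDistribution n ^ 2) =
    ∑' n, sobolevWeight s n * casCoeff T.toDistribution n ^ 2 by ring] at h2
  rw [← h2]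
  refine tsum_congr fun n => ?_
  simp only [norm_distFourier_sq, sobolevWeight_neg]
  ring

lemma dist_sq_eq_casCoeff (S T : SobolevSpace s) :
    dist S T ^ 2 = ∑' n, sobolevWeight s n *
      (casCoeff S.toDistribution n - casCoeff T.toDistribution n) ^ 2 := by
  rw [dist_eq_norm, norm_sq_eq_casCoeff]
  rfl

lemma continuous_casCoeff (n : Fin 2 → ℤ) :
    Continuous fun T : SobolevSpace s => casCoeff T.toDistribution n := by
  have hw := sobolevWeight_pos s n
  have hle : ∀ S T : SobolevSpace s,
      |casCoeff S.toDistribution n - casCoeff T.toDistribution n| ≤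
        (√(sobolevWeight s n))⁻¹ * dist S T := by
    intro S T
    have h1 : sobolevWeight s n * (casCoeff S.toDistribution n - casCoeff T.toDistribution n) ^ 2 ≤
        dist S T ^ 2 := by
      rw [dist_eq_norm, norm_sq_eq_casCoeff]
      exact (S - T).summable_casCoeff.le_tsum n
        fun m _ => mul_nonneg (sobolevWeight_nonneg s m) (sq_nonneg _)
    rw [inv_mul_eq_div, le_div_iff₀ (Real.sqrt_pos.mpr hw)]
    refine abs_le_of_sq_le_sq' ?_ dist_nonneg |>.2
    rw [mul_pow, sq_abs, Real.sq_sqrt hw.le]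
    linarith
  refine (LipschitzWith.of_dist_le_mul (K := Real.toNNReal (√(sobolevWeight s n))⁻¹)
    fun S T => ?_).continuous
  rw [Real.dist_eq, Real.coe_toNNReal _ (by positivity)]
  exact hle S T

/-- Dominated convergence for series: locally uniformly bounded coefficients are controlled by
weights that are summable for `s < -1`. -/
lemma continuous_of_casCoeff {α : Type*} [TopologicalSpace α] {f : α → SobolevSpace s}
    (hs : s < -1) (hc : ∀ n, Continuous fun a => casCoeff (f a).toDistribution n)
    (hb : ∀ a₀, ∃ B : ℝ, ∀ᶠ a in 𝓝 a₀, ∀ n, |casCoeff (f a).toDistribution n| ≤ B) :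
    Continuous f := by
  refine continuous_iff_continuousAt.mpr fun a₀ => ?_
  obtain ⟨B, hB⟩ := hb a₀
  rw [ContinuousAt, tendsto_iff_dist_tendsto_zero]
  have h2 : Tendsto (fun a => dist (f a) (f a₀) ^ 2) (𝓝 a₀) (𝓝 0) := by
    simp only [dist_sq_eq_casCoeff]
    have h3 := tendsto_tsum_of_dominated_convergence (𝓕 := 𝓝 a₀)
      (f := fun a n => sobolevWeight s n *
        (casCoeff (f a).toDistribution n - casCoeff (f a₀).toDistribution n) ^ 2)
      (g := fun _ => 0) ((summable_sobolevWeight hs).mul_right ((2 * B) ^ 2)) (fun n => ?_) ?_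
    · simpa using h3
    · have h4 : Tendsto (fun a => sobolevWeight s n *
          (casCoeff (f a).toDistribution n - casCoeff (f a₀).toDistribution n) ^ 2) (𝓝 a₀)
          (𝓝 (sobolevWeight s n *
          (casCoeff (f a₀).toDistribution n - casCoeff (f a₀).toDistribution n) ^ 2)) :=
        ((((hc n).tendsto a₀).sub_const _).pow 2).const_mul _
      simpa using h4
    · filter_upwards [hB] with a ha n
      rw [Real.norm_of_nonneg (mul_nonneg (sobolevWeight_nonneg s n) (sq_nonneg _))]
      refine mul_le_mul_of_nonneg_left ?_ (sobolevWeight_nonneg s n)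
      refine sq_le_sq' ?_ ?_ <;>
      · have h5 := abs_le.mp (ha n)
        have h6 := abs_le.mp (hB.self_of_nhds n)
        linarith
  have h3 := h2.sqrt
  simpa [Real.sqrt_sq dist_nonneg] using h3

end SobolevSpace

end Cas

/-! ### The point vortex measure as a continuous map into negative Sobolev spaces -/

section PointSobolev

variable {N : ℕ} {δ : ℝ}

/-- The point vortex measure as an element of `H^{-1-δ}`. -/
def pointVortexSobolev (hδ : 0 < δ) (p : (Fin N → ℝ) × (Fin N → Torus)) :
    SobolevSpace (-1 - δ) := measureSobolev (pointVortexMeasure p.1 p.2) hδ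

lemma pair_pointVortexSobolev (hδ : 0 < δ) (p : (Fin N → ℝ) × (Fin N → Torus))
    (φ : SmoothTorusFn) :
    (pointVortexSobolev hδ p).toDistribution.pair φ = (√(N : ℝ))⁻¹ * ∑ i, p.1 i * φ.1 (p.2 i) :=
  pair_pointVortexMeasure p.1 p.2 φ

lemma casCoeff_pointVortexSobolev (hδ : 0 < δ) (p : (Fin N → ℝ) × (Fin N → Torus))
    (n : Fin 2 → ℤ) :
    casCoeff (pointVortexSobolev hδ p).toDistribution n =
      (√(N : ℝ))⁻¹ * ∑ i, p.1 i * (torusCas n).1 (p.2 i) :=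
  pair_pointVortexSobolev hδ p _

lemma continuous_pointVortexSobolev (hδ : 0 < δ) :
    Continuous (pointVortexSobolev (N := N) hδ) := by
  refine SobolevSpace.continuous_of_casCoeff (by linarith) (fun n => ?_) fun p₀ => ?_
  · simp only [casCoeff_pointVortexSobolev]
    have := continuous_smoothTorusFn (torusCas n)
    fun_prop
  · set b : (Fin N → ℝ) × (Fin N → Torus) → ℝ := fun p => (√(N : ℝ))⁻¹ * ∑ i, |p.1 i| * 2 with hb
    have hbc : Continuous b := by fun_prop
    refine ⟨b p₀ + 1, ?_⟩
    filter_upwards [hbc.tendsto p₀ |>.eventually (eventually_le_nhds (lt_add_one (b p₀)))] with p hp n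
    refine le_trans ?_ hp
    rw [casCoeff_pointVortexSobolev, abs_mul, abs_of_nonneg (by positivity : 0 ≤ (√(N : ℝ))⁻¹)]
    refine mul_le_mul_of_nonneg_left ?_ (by positivity)
    refine (Finset.abs_sum_le_sum_abs _ _).trans (Finset.sum_le_sum fun i _ => ?_)
    rw [abs_mul]
    exact mul_le_mul_of_nonneg_left (abs_torusCas_le n _) (abs_nonneg _)

end PointSobolev

/-! ### Moment bounds uniform in the number of vortices -/

section Moments

variable {N : ℕ}

lemma integrable_exp_sum (a : Fin N → ℝ) :
    Integrable (fun ξ : Fin N → ℝ => Real.exp (∑ i, a i * ξ i)) (stdGaussianPi N) := by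
  simp only [Real.exp_sum]
  exact Integrable.fintype_prod fun i => integrable_exp_mul_gaussianReal (a i)

lemma integral_exp_sum (a : Fin N → ℝ) :
    ∫ ξ : Fin N → ℝ, Real.exp (∑ i, a i * ξ i) ∂(stdGaussianPi N) =
      Real.exp (∑ i, a i ^ 2 / 2) := by
  simp only [Real.exp_sum]
  rw [integral_fintype_prod_eq_prod (fun i x => Real.exp (a i * x))]
  refine Finset.prod_congr rfl fun i _ => ?_
  have h := congrFun (mgf_id_gaussianReal (μ := 0) (v := 1)) (a i)
  simp only [mgf, id] at h
  rw [h]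
  simp

lemma pow_le_exp_add_exp (x : ℝ) (k : ℕ) :
    x ^ (2 * k) ≤ (2 * k).factorial * (Real.exp x + Real.exp (-x)) := by
  have h1 := Real.pow_div_factorial_le_exp |x| (abs_nonneg x) (2 * k)
  rw [div_le_iff₀ (by positivity), Even.pow_abs (even_two_mul k)] at h1
  refine (h1.trans_eq (mul_comm _ _)).trans (mul_le_mul_of_nonneg_left ?_ (by positivity))
  rcases abs_cases x with ⟨h, _⟩ | ⟨h, _⟩ <;> rw [h]
  · linarith [Real.exp_pos (-x)]
  · linarith [Real.exp_pos x]

/-- The sum is Gaussian with variance at most `σ`; each of the exponentials of plus and minus the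
sum has mean at most `exp(σ/2)`, which bounds every even moment. -/
lemma lintegral_sum_pow_le (a : Fin N → ℝ) {σ : ℝ} (ha : ∑ i, a i ^ 2 ≤ σ) (k : ℕ) :
    ∫⁻ ξ : Fin N → ℝ, ENNReal.ofReal ((∑ i, a i * ξ i) ^ (2 * k)) ∂(stdGaussianPi N) ≤
      ENNReal.ofReal ((2 * k).factorial * (2 * Real.exp (σ / 2))) := by
  have hint : Integrable (fun ξ : Fin N → ℝ => ((2 * k).factorial : ℝ) *
      (Real.exp (∑ i, a i * ξ i) + Real.exp (∑ i, -a i * ξ i))) (stdGaussianPi N) :=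
    ((integrable_exp_sum a).add (integrable_exp_sum fun i => -a i)).const_mul _
  calc _ ≤ ∫⁻ ξ : Fin N → ℝ, ENNReal.ofReal (((2 * k).factorial : ℝ) *
      (Real.exp (∑ i, a i * ξ i) + Real.exp (∑ i, -a i * ξ i))) ∂(stdGaussianPi N) := by
        refine lintegral_mono fun ξ => ENNReal.ofReal_le_ofReal ?_
        refine (pow_le_exp_add_exp _ k).trans_eq ?_
        simp only [neg_mul, Finset.sum_neg_distrib]
    _ = ENNReal.ofReal (∫ ξ : Fin N → ℝ, (((2 * k).factorial : ℝ) *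
      (Real.exp (∑ i, a i * ξ i) + Real.exp (∑ i, -a i * ξ i))) ∂(stdGaussianPi N)) :=
        (ofReal_integral_eq_lintegral_ofReal hint
          (Eventually.of_forall fun ξ => by positivity)).symm
    _ ≤ _ := by
        refine ENNReal.ofReal_le_ofReal ?_
        rw [integral_const_mul, integral_add (integrable_exp_sum a)
          (integrable_exp_sum fun i => -a i), integral_exp_sum, integral_exp_sum]
        refine mul_le_mul_of_nonneg_left ?_ (by positivity)
        have : Real.exp (∑ i, a i ^ 2 / 2) ≤ Real.exp (σ / 2) := by
          rw [← Finset.sum_div]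
          gcongr
        simp only [neg_sq]
        linarith

/-- Given the positions, the squared coefficients are at most `M²/N` each and add up to at most
`M²`, whatever `N` and the positions are. -/
lemma lintegral_pair_pow_le {φ : Torus → ℝ} (hφ : Continuous φ) {M : ℝ} (hM : ∀ x, |φ x| ≤ M)
    (k : ℕ) :
    ∫⁻ p : (Fin N → ℝ) × (Fin N → Torus),
      ENNReal.ofReal (((√(N : ℝ))⁻¹ * ∑ i, p.1 i * φ (p.2 i)) ^ (2 * k)) ∂(vortexLaw N) ≤
      ENNReal.ofReal ((2 * k).factorial * (2 * Real.exp (M ^ 2 / 2))) := by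
  have hm : Measurable fun p : (Fin N → ℝ) × (Fin N → Torus) =>
      ENNReal.ofReal (((√(N : ℝ))⁻¹ * ∑ i, p.1 i * φ (p.2 i)) ^ (2 * k)) :=
    (Continuous.measurable (by fun_prop)).ennreal_ofReal
  rw [vortexLaw, lintegral_prod_symm' _ hm]
  have hx : ∀ x : Fin N → Torus, ∫⁻ ξ : Fin N → ℝ,
      ENNReal.ofReal (((√(N : ℝ))⁻¹ * ∑ i, ξ i * φ (x i)) ^ (2 * k)) ∂(stdGaussianPi N) ≤
      ENNReal.ofReal ((2 * k).factorial * (2 * Real.exp (M ^ 2 / 2))) := by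
    intro x
    have h := lintegral_sum_pow_le (fun i => (√(N : ℝ))⁻¹ * φ (x i)) (σ := M ^ 2) ?_ k
    · refine le_trans (le_of_eq ?_) h
      refine lintegral_congr fun ξ => ?_
      rw [Finset.mul_sum]
      congr 2
      exact Finset.sum_congr rfl fun i _ => by ring
    · have h1 : ∀ i, ((√(N : ℝ))⁻¹ * φ (x i)) ^ 2 ≤ (N : ℝ)⁻¹ * M ^ 2 := fun i => by
        rw [mul_pow, inv_pow, Real.sq_sqrt (Nat.cast_nonneg N)]
        refine mul_le_mul_of_nonneg_left ?_ (by positivity)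
        rw [← sq_abs]
        exact pow_le_pow_left₀ (abs_nonneg _) (hM _) 2
      refine (Finset.sum_le_sum fun i _ => h1 i).trans ?_
      simp only [Finset.sum_const, Finset.card_univ, Fintype.card_fin, nsmul_eq_mul]
      rcases eq_or_ne (N : ℝ) 0 with hN | hN
      · rw [hN, zero_mul]; positivity
      · rw [← mul_assoc, mul_inv_cancel₀ hN, one_mul]
  refine (lintegral_mono hx).trans ?_
  simp

/-- Jensen's inequality with weights not normalised to total mass one. -/
lemma ENNReal.tsum_mul_pow_le {ι : Type*} (w f : ι → ENNReal) {k : ℕ} (hk : 1 ≤ k) :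
    (∑' i, w i * f i) ^ k ≤ (∑' i, w i) ^ (k - 1) * ∑' i, w i * f i ^ k := by
  have hk' : (1 : ℝ) ≤ k := by exact_mod_cast hk
  have hk0 : (k : ℝ) ≠ 0 := by positivity
  have h : ∑' i, w i * f i ≤ (∑' i, w i) ^ (1 - (k : ℝ)⁻¹) * (∑' i, w i * f i ^ k) ^ (k : ℝ)⁻¹ := by
    rw [ENNReal.tsum_eq_iSup_sum]
    refine iSup_le fun t => ?_
    refine (ENNReal.inner_le_weight_mul_Lp_of_nonneg t hk' w f).trans ?_
    simp only [ENNReal.rpow_natCast]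
    gcongr
    · rw [sub_nonneg]
      exact inv_le_one_of_one_le₀ hk'
    · exact ENNReal.sum_le_tsum t
    · exact ENNReal.sum_le_tsum t
  calc (∑' i, w i * f i) ^ k
      ≤ ((∑' i, w i) ^ (1 - (k : ℝ)⁻¹) * (∑' i, w i * f i ^ k) ^ (k : ℝ)⁻¹) ^ k := by gcongr
    _ = _ := by
        rw [mul_pow, ← ENNReal.rpow_natCast, ← ENNReal.rpow_natCast, ← ENNReal.rpow_mul,
          ← ENNReal.rpow_mul, inv_mul_cancel₀ hk0, ENNReal.rpow_one, sub_mul, inv_mul_cancel₀ hk0,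
          one_mul, ← Nat.cast_one, ← Nat.cast_sub hk, ENNReal.rpow_natCast]

lemma SobolevSpace.ofReal_norm_sq {s : ℝ} (T : SobolevSpace s) :
    ENNReal.ofReal (‖T‖ ^ 2) = ∑' n, ENNReal.ofReal (sobolevWeight s n) *
      ENNReal.ofReal (casCoeff T.toDistribution n ^ 2) := by
  rw [norm_sq_eq_casCoeff, ENNReal.ofReal_tsum_of_nonneg
    (fun n => mul_nonneg (sobolevWeight_nonneg s n) (sq_nonneg _)) T.summable_casCoeff]
  exact tsum_congr fun n => ENNReal.ofReal_mul (sobolevWeight_nonneg s n)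

/-- The bound for the moments of order `2k` of the point vortex measure in `H^s`. -/
def sobolevMomentBound (s : ℝ) (k : ℕ) : ℝ :=
  (∑' n, sobolevWeight s n) ^ k * ((2 * k).factorial * (2 * Real.exp (2 ^ 2 / 2)))

/-- By convexity, moments of the weighted sum of squares reduce to moments of single coefficients.
These are bounded uniformly in the frequency because `torusCas` is bounded by `2`, and the weights
are summable. -/
lemma lintegral_norm_pointVortexSobolev_pow_le {δ : ℝ} (hδ : 0 < δ) {k : ℕ} (hk : 1 ≤ k) :
    ∫⁻ p, ENNReal.ofReal (‖pointVortexSobolev (N := N) hδ p‖ ^ (2 * k)) ∂(vortexLaw N) ≤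
      ENNReal.ofReal (sobolevMomentBound (-1 - δ) k) := by
  set s := -1 - δ
  have hs : s < -1 := by simp only [s]; linarith
  set W := ∑' n, ENNReal.ofReal (sobolevWeight s n) with hW
  set M := ((2 * k).factorial : ℝ) * (2 * Real.exp (2 ^ 2 / 2)) with hM
  have hWr : W = ENNReal.ofReal (∑' n, sobolevWeight s n) :=
    (ENNReal.ofReal_tsum_of_nonneg (sobolevWeight_nonneg s) (summable_sobolevWeight hs)).symm
  have hpt : ∀ p, ENNReal.ofReal (‖pointVortexSobolev (N := N) hδ p‖ ^ (2 * k)) ≤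
      W ^ (k - 1) * ∑' n, ENNReal.ofReal (sobolevWeight s n) * ENNReal.ofReal
        (((√(N : ℝ))⁻¹ * ∑ i, p.1 i * (torusCas n).1 (p.2 i)) ^ (2 * k)) := by
    intro p
    rw [pow_mul, ENNReal.ofReal_pow (sq_nonneg _), SobolevSpace.ofReal_norm_sq]
    refine (ENNReal.tsum_mul_pow_le _ _ hk).trans (le_of_eq ?_)
    simp only [← ENNReal.ofReal_pow (sq_nonneg _), casCoeff_pointVortexSobolev, ← pow_mul]
    rfl
  have hmeas : ∀ n, Measurable fun p : (Fin N → ℝ) × (Fin N → Torus) =>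
      ENNReal.ofReal (((√(N : ℝ))⁻¹ * ∑ i, p.1 i * (torusCas n).1 (p.2 i)) ^ (2 * k)) := by
    intro n
    have := continuous_smoothTorusFn (torusCas n)
    exact (Continuous.measurable (by fun_prop)).ennreal_ofReal
  calc _ ≤ ∫⁻ p, W ^ (k - 1) * ∑' n, ENNReal.ofReal (sobolevWeight s n) * ENNReal.ofReal
        (((√(N : ℝ))⁻¹ * ∑ i, p.1 i * (torusCas n).1 (p.2 i)) ^ (2 * k)) ∂(vortexLaw N) :=
        lintegral_mono hpt
    _ = W ^ (k - 1) * ∑' n, ENNReal.ofReal (sobolevWeight s n) * ∫⁻ p, ENNReal.ofReal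
        (((√(N : ℝ))⁻¹ * ∑ i, p.1 i * (torusCas n).1 (p.2 i)) ^ (2 * k)) ∂(vortexLaw N) := by
        rw [lintegral_const_mul _ (Measurable.tsum fun n => (hmeas n).const_mul _),
          lintegral_tsum fun n => ((hmeas n).const_mul _).aemeasurable]
        congr 1
        exact tsum_congr fun n => lintegral_const_mul _ (hmeas n)
    _ ≤ W ^ (k - 1) * ∑' n, ENNReal.ofReal (sobolevWeight s n) * ENNReal.ofReal M := by
        gcongr with n
        exact lintegral_pair_pow_le (continuous_smoothTorusFn (torusCas n)) (abs_torusCas_le n) k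
    _ = W ^ k * ENNReal.ofReal M := by
        rw [ENNReal.tsum_mul_right, ← mul_assoc, ← pow_succ, Nat.sub_add_cancel hk]
    _ = _ := by
        have h0 : 0 ≤ ∑' n, sobolevWeight s n := tsum_nonneg (sobolevWeight_nonneg s)
        rw [hWr, ← ENNReal.ofReal_pow h0, ← ENNReal.ofReal_mul (by positivity), sobolevMomentBound]

lemma rpow_le_one_add_pow {x p : ℝ} (hx : 0 ≤ x) {m : ℕ} (hp : 0 ≤ p) (hm : p ≤ m) :
    x ^ p ≤ 1 + x ^ m := by
  rcases le_total x 1 with h | h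
  · have := Real.rpow_le_one hx h hp
    have := pow_nonneg hx m
    linarith
  · have := Real.rpow_le_rpow_of_exponent_le h hm
    rw [Real.rpow_natCast] at this
    linarith

lemma integrable_norm_pointVortexSobolev_pow {δ : ℝ} (hδ : 0 < δ) {k : ℕ} (hk : 1 ≤ k) :
    Integrable (fun p => ‖pointVortexSobolev (N := N) hδ p‖ ^ (2 * k)) (vortexLaw N) := by
  have hc := continuous_pointVortexSobolev (N := N) hδ
  refine ⟨(Continuous.aestronglyMeasurable (by fun_prop)), ?_⟩
  rw [hasFiniteIntegral_iff_ofReal (Eventually.of_forall fun p => by positivity)]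
  exact (lintegral_norm_pointVortexSobolev_pow_le hδ hk).trans_lt ENNReal.ofReal_lt_top

lemma integrable_norm_pointVortexSobolev_rpow {δ : ℝ} (hδ : 0 < δ) {p : ℝ} (hp : 1 ≤ p) :
    Integrable (fun q => ‖pointVortexSobolev (N := N) hδ q‖ ^ p) (vortexLaw N) ∧
    ∫ q, ‖pointVortexSobolev (N := N) hδ q‖ ^ p ∂(vortexLaw N) ≤
      1 + sobolevMomentBound (-1 - δ) ⌈p⌉₊ := by
  have hc := continuous_pointVortexSobolev (N := N) hδ
  have hk : 1 ≤ ⌈p⌉₊ := Nat.one_le_ceil_iff.mpr (by linarith)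
  have hle : p ≤ (2 * ⌈p⌉₊ : ℕ) := by
    have := Nat.le_ceil p
    push_cast
    linarith
  have hI := integrable_norm_pointVortexSobolev_pow (N := N) hδ hk
  have hI' := (integrable_const (1 : ℝ)).add hI
  have hpt : ∀ q, ‖pointVortexSobolev (N := N) hδ q‖ ^ p ≤
      1 + ‖pointVortexSobolev (N := N) hδ q‖ ^ (2 * ⌈p⌉₊) := fun q =>
    rpow_le_one_add_pow (norm_nonneg _) (by linarith) hle
  have hI2 : Integrable (fun q => ‖pointVortexSobolev (N := N) hδ q‖ ^ p) (vortexLaw N) := by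
    refine hI'.mono' ?_ (Eventually.of_forall fun q => ?_)
    · exact (hc.norm.rpow_const fun _ => Or.inr (by linarith)).aestronglyMeasurable
    · rw [Real.norm_of_nonneg (by positivity)]
      exact hpt q
  refine ⟨hI2, (integral_mono hI2 hI' hpt).trans ?_⟩
  simp only [Pi.add_apply]
  rw [integral_add (integrable_const _) hI]
  simp only [integral_const, probReal_univ, smul_eq_mul, mul_one, add_le_add_iff_left]
  have h0 : 0 ≤ sobolevMomentBound (-1 - δ) ⌈p⌉₊ :=
    mul_nonneg (pow_nonneg (tsum_nonneg (sobolevWeight_nonneg _)) _) (by positivity)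
  rw [← ENNReal.ofReal_le_ofReal_iff h0, ofReal_integral_eq_lintegral_ofReal hI
    (Eventually.of_forall fun p => by positivity)]
  exact lintegral_norm_pointVortexSobolev_pow_le hδ hk

end Moments

end


noncomputable section

/-! ### Derivatives of smooth functions on the torus -/

section Partial

lemma contDiff_smoothTorusFn (φ : SmoothTorusFn) :
    ContDiff ℝ ((⊤ : ℕ∞) : WithTop ℕ∞) (fun x : Plane => φ.1 (torusProj x)) := φ.2

lemma mem_smoothTorusFn {φ : Torus → ℝ} : φ ∈ SmoothTorusFn ↔
    ContDiff ℝ ((⊤ : ℕ∞) : WithTop ℕ∞) (fun x : Plane => φ (torusProj x)) := Iff.rfl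

lemma torusPartial_smooth_torusProj (φ : SmoothTorusFn) (i : Fin 2) (x : Plane) :
    torusPartial i φ.1 (torusProj x) =
      fderiv ℝ (fun x : Plane => φ.1 (torusProj x)) x (EuclideanSpace.single i 1) :=
  torusPartial_torusProj ((contDiff_smoothTorusFn φ).differentiable (by simp) x) i

/-- The partial derivative of a smooth function on the torus. -/
def smoothPartial (i : Fin 2) (φ : SmoothTorusFn) : SmoothTorusFn :=
  ⟨torusPartial i φ.1, by
    have h : ContDiff ℝ ((⊤ : ℕ∞) : WithTop ℕ∞) (fun x : Plane =>
        fderiv ℝ (fun x : Plane => φ.1 (torusProj x)) x (EuclideanSpace.single i 1)) :=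
      ((contDiff_smoothTorusFn φ).fderiv_right (m := ((⊤ : ℕ∞) : WithTop ℕ∞)) le_rfl).clm_apply
        contDiff_const
    rw [mem_smoothTorusFn]
    simpa only [torusPartial_smooth_torusProj] using h⟩

/-- `M` bounds the derivatives of `φ` up to order `k`. -/
def DerivBound (k : ℕ) (φ : SmoothTorusFn) (M : ℝ) : Prop :=
  ∀ j ≤ k, ∀ x : Plane, ‖iteratedFDeriv ℝ j (fun y : Plane => φ.1 (torusProj y)) x‖ ≤ M

lemma DerivBound.abs_le {k : ℕ} {φ : SmoothTorusFn} {M : ℝ} (h : DerivBound k φ M) (p : Torus) :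
    |φ.1 p| ≤ M := by
  obtain ⟨x, rfl⟩ := torusProj_surjective p
  simpa using h 0 (Nat.zero_le k) x

/-- Evaluation at a unit vector has norm at most one, so a partial derivative costs one order and no
constant. -/
lemma DerivBound.smoothPartial {k : ℕ} {φ : SmoothTorusFn} {M : ℝ} (h : DerivBound (k + 1) φ M)
    (i : Fin 2) : DerivBound k (smoothPartial i φ) M := by
  intro j hj x
  have hφ := contDiff_smoothTorusFn φ
  set L : (Plane →L[ℝ] ℝ) →L[ℝ] ℝ := ContinuousLinearMap.apply ℝ ℝ (EuclideanSpace.single i (1 : ℝ))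
  have hL : ‖L‖ ≤ 1 := by
    refine ContinuousLinearMap.opNorm_le_bound _ zero_le_one fun f => ?_
    rw [one_mul]
    have := f.le_opNorm (EuclideanSpace.single i (1 : ℝ))
    simpa [L] using this
  have h1 : (fun y : Plane => (_root_.smoothPartial i φ).1 (torusProj y)) =
      L ∘ fderiv ℝ (fun x : Plane => φ.1 (torusProj x)) := by
    funext y
    exact torusPartial_smooth_torusProj φ i y
  rw [h1]
  have hd : ContDiff ℝ ((⊤ : ℕ∞) : WithTop ℕ∞) (fderiv ℝ (fun x : Plane => φ.1 (torusProj x))) :=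
    hφ.fderiv_right (m := ((⊤ : ℕ∞) : WithTop ℕ∞)) le_rfl
  refine (L.norm_iteratedFDeriv_comp_left (n := j) hd.contDiffAt (by exact_mod_cast le_top)).trans ?_
  rw [norm_iteratedFDeriv_fderiv]
  calc _ ≤ 1 * ‖iteratedFDeriv ℝ (j + 1) (fun y : Plane => φ.1 (torusProj y)) x‖ := by gcongr
    _ ≤ M := by
      rw [one_mul]
      exact h (j + 1) (by omega) x

lemma exists_derivBound (k : ℕ) (φ : SmoothTorusFn) : ∃ M, DerivBound k φ M := by
  have h : ∀ j, ∃ C, ∀ x, ‖iteratedFDeriv ℝ j (fun y : Plane => φ.1 (torusProj y)) x‖ ≤ C := by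
    intro j
    refine exists_norm_le_of_periodic
      ((contDiff_smoothTorusFn φ).continuous_iteratedFDeriv (by exact_mod_cast le_top))
      fun x y hxy => ?_
    have h1 : (fun z : Plane => φ.1 (torusProj (z + (y - x)))) = fun z => φ.1 (torusProj z) := by
      funext z
      rw [torusProj_add, torusProj_sub, hxy, sub_self, add_zero]
    have h2 := iteratedFDeriv_comp_add_right (𝕜 := ℝ) (f := fun z : Plane => φ.1 (torusProj z))
      j (y - x) x
    rw [h1, add_sub_cancel] at h2
    exact h2
  choose C hC using h
  refine ⟨∑ j ∈ Finset.range (k + 1), |C j|, fun j hj x => ?_⟩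
  refine (hC j x).trans ((le_abs_self _).trans ?_)
  exact Finset.single_le_sum (f := fun j => |C j|) (fun j _ => abs_nonneg _)
    (Finset.mem_range.mpr (by omega))

end Partial

/-! ### Decay of Fourier coefficients of smooth functions -/

section Coefficients

/-- `∫ φ e_n`. -/
def torusFourier (φ : SmoothTorusFn) (n : Fin 2 → ℤ) : ℂ :=
  ∫ x, (φ.1 x : ℂ) * UnitAddTorus.mFourier n x

lemma mFourier_apply_add (n : Fin 2 → ℤ) (p q : Torus) :
    UnitAddTorus.mFourier n (p + q) = UnitAddTorus.mFourier n p * UnitAddTorus.mFourier n q := by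
  obtain ⟨x, rfl⟩ := torusProj_surjective p
  obtain ⟨y, rfl⟩ := torusProj_surjective q
  rw [← torusProj_add, mFourier_torusProj, mFourier_torusProj, mFourier_torusProj,
    ← Finset.prod_mul_distrib]
  refine Finset.prod_congr rfl fun i _ => ?_
  rw [← Complex.exp_add]
  congr 1
  rw [PiLp.add_apply]
  push_cast
  ring

lemma mFourier_single_coe (n : Fin 2 → ℤ) (i : Fin 2) (s : ℝ) :
    UnitAddTorus.mFourier n (Pi.single i (s : UnitAddCircle)) =
      Complex.exp (2 * Real.pi * Complex.I * n i * s) := by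
  rw [← torusProj_smul_single, mFourier_torusProj, Finset.prod_eq_single i]
  · simp
  · intro j _ hj
    simp [hj]
  · simp

lemma hasDerivAt_translate (φ : SmoothTorusFn) (i : Fin 2) (p : Torus) (s : ℝ) :
    HasDerivAt (fun s : ℝ => φ.1 (p + Pi.single i (s : UnitAddCircle)))
      ((smoothPartial i φ).1 (p + Pi.single i (s : UnitAddCircle))) s := by
  obtain ⟨x, rfl⟩ := torusProj_surjective p
  have h1 : ∀ s : ℝ, torusProj x + Pi.single i (s : UnitAddCircle) =
      torusProj (x + s • EuclideanSpace.single i (1 : ℝ)) := fun s => by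
    rw [torusProj_add, torusProj_smul_single]
  have h2 : HasDerivAt (fun s : ℝ => x + s • EuclideanSpace.single i (1 : ℝ))
      (EuclideanSpace.single i (1 : ℝ)) s := by
    simpa using ((hasDerivAt_id s).smul_const (EuclideanSpace.single i (1 : ℝ))).const_add x
  have h3 := (((contDiff_smoothTorusFn φ).differentiable (by simp)
    (x + s • EuclideanSpace.single i (1 : ℝ))).hasFDerivAt).comp_hasDerivAt s h2
  simp only [h1]
  change HasDerivAt _ (torusPartial i φ.1 _) s
  rw [torusPartial_smooth_torusProj]
  exact h3

lemma continuous_ofReal_mul_mFourier (φ : SmoothTorusFn) (n : Fin 2 → ℤ) :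
    Continuous fun x => (φ.1 x : ℂ) * UnitAddTorus.mFourier n x :=
  (Complex.continuous_ofReal.comp (continuous_smoothTorusFn φ)).mul (UnitAddTorus.mFourier n).continuous

lemma integrable_of_continuous {E : Type*} [NormedAddCommGroup E] {f : Torus → E}
    (hf : Continuous f) : Integrable f :=
  hf.integrable_of_hasCompactSupport (HasCompactSupport.of_compactSpace _)

/-- Translating `φ` by `s` in direction `i` multiplies its coefficient by `exp(-2πi n_i s)`;
differentiate at `s = 0`. The minus sign reflects the pairing with `e_n` rather than its conjugate.
-/
lemma torusFourier_smoothPartial (φ : SmoothTorusFn) (i : Fin 2) (n : Fin 2 → ℤ) :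
    torusFourier (smoothPartial i φ) n = -(2 * Real.pi * Complex.I * n i) * torusFourier φ n := by
  set F : ℝ → Torus → ℂ := fun s p =>
    (φ.1 (p + Pi.single i (s : UnitAddCircle)) : ℂ) * UnitAddTorus.mFourier n p with hF
  set F' : ℝ → Torus → ℂ := fun s p =>
    ((smoothPartial i φ).1 (p + Pi.single i (s : UnitAddCircle)) : ℂ) * UnitAddTorus.mFourier n p
    with hF'
  have hc : ∀ (ψ : SmoothTorusFn) (s : ℝ), Continuous fun p : Torus =>
      (ψ.1 (p + Pi.single i (s : UnitAddCircle)) : ℂ) * UnitAddTorus.mFourier n p := fun ψ s =>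
    (Complex.continuous_ofReal.comp ((continuous_smoothTorusFn ψ).comp
      (continuous_add_const _))).mul (UnitAddTorus.mFourier n).continuous
  obtain ⟨M, hM⟩ := exists_derivBound 0 (smoothPartial i φ)
  have h1 : HasDerivAt (fun s => ∫ p, F s p) (∫ p, F' 0 p) 0 := by
    refine (hasDerivAt_integral_of_dominated_loc_of_deriv_le (s := univ) (bound := fun _ => M)
      univ_mem (Eventually.of_forall fun s => (hc φ s).aestronglyMeasurable)
      (integrable_of_continuous (hc φ 0)) (hc _ 0).aestronglyMeasurable
      (Eventually.of_forall fun p s _ => ?_) (integrable_const M)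
      (Eventually.of_forall fun p s _ => ?_)).2
    · rw [norm_mul, norm_mFourier_apply, mul_one, Complex.norm_real]
      exact hM.abs_le _
    · exact (hasDerivAt_translate φ i p s).ofReal_comp.mul_const _
  have h2 : ∀ s, ∫ p, F s p =
      Complex.exp (-(2 * Real.pi * Complex.I * n i) * s) * torusFourier φ n := by
    intro s
    have h3 := integral_add_right_eq_self (μ := (volume : Measure Torus))
      (fun p => (φ.1 p : ℂ) * UnitAddTorus.mFourier n (p - Pi.single i (s : UnitAddCircle)))
      (Pi.single i (s : UnitAddCircle))
    simp only [add_sub_cancel_right] at h3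
    rw [hF, h3, torusFourier, ← integral_const_mul]
    refine integral_congr_ae (Eventually.of_forall fun p => ?_)
    have h4 : -(Pi.single i (s : UnitAddCircle) : Torus) = Pi.single i ((-s : ℝ) : UnitAddCircle) := by
      rw [← Pi.single_neg]
      rfl
    simp only
    rw [sub_eq_add_neg, mFourier_apply_add, h4, mFourier_single_coe]
    push_cast
    ring_nf
  simp only [h2] at h1
  have h5 : HasDerivAt (fun s : ℝ => Complex.exp (-(2 * Real.pi * Complex.I * n i) * s) *
      torusFourier φ n) (-(2 * Real.pi * Complex.I * n i) * torusFourier φ n) 0 := by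
    have h6 : HasDerivAt (fun s : ℝ => -(2 * Real.pi * Complex.I * n i) * (s : ℂ))
        (-(2 * Real.pi * Complex.I * n i) * 1) 0 :=
      (Complex.ofRealCLM.hasDerivAt (x := (0 : ℝ))).const_mul _
    simpa using h6.cexp.mul_const (torusFourier φ n)
  have h7 := h1.unique h5
  rw [← h7, torusFourier]
  simp [hF']

lemma norm_torusFourier_le {k : ℕ} {φ : SmoothTorusFn} {M : ℝ} (h : DerivBound k φ M)
    (n : Fin 2 → ℤ) : ‖n‖ ^ k * ‖torusFourier φ n‖ ≤ M := by
  induction k generalizing φ with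
  | zero =>
    rw [pow_zero, one_mul]
    refine (norm_integral_le_of_norm_le_const (C := M) (Eventually.of_forall fun p => ?_)).trans ?_
    · rw [norm_mul, norm_mFourier_apply, mul_one, Complex.norm_real]
      exact h.abs_le _
    · simp
  | succ k ih =>
    -- Differentiate in the direction where `|n_i|` attains the supremum norm; the factor `2π |n_i|`
    -- then dominates `‖n‖`.
    obtain ⟨i, hi⟩ : ∃ i, ‖n‖ = ‖n i‖ := by
      obtain ⟨i, -, hi⟩ := Finset.exists_mem_eq_sup' (s := (Finset.univ : Finset (Fin 2)))
        Finset.univ_nonempty (fun i => ‖n i‖)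
      refine ⟨i, le_antisymm ?_ (norm_le_pi_norm n i)⟩
      refine (pi_norm_le_iff_of_nonneg (norm_nonneg _)).mpr fun j => ?_
      rw [← hi]
      exact Finset.le_sup' (fun i => ‖n i‖) (Finset.mem_univ j)
    refine le_trans ?_ (ih (h.smoothPartial i))
    rw [torusFourier_smoothPartial, norm_mul, pow_succ, mul_assoc]
    gcongr
    rw [hi]
    simp only [norm_neg, norm_mul, Complex.norm_ofNat, Complex.norm_real, Complex.norm_I, mul_one,
      Complex.norm_intCast, Real.norm_of_nonneg Real.pi_pos.le, Int.norm_eq_abs]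
    have := Real.two_le_pi
    nlinarith [abs_nonneg ((n i : ℤ) : ℝ)]

/-- The coefficients of a smooth function in the basis `torusCas`. -/
def smoothCoeff (φ : SmoothTorusFn) (n : Fin 2 → ℤ) : ℝ := ∫ x, φ.1 x * (torusCas n).1 x

lemma smoothCoeff_eq (φ : SmoothTorusFn) (n : Fin 2 → ℤ) :
    smoothCoeff φ n = (torusFourier φ n).re + (torusFourier φ n).im := by
  have hI := integrable_of_continuous (continuous_ofReal_mul_mFourier φ n)
  have h1 : (torusFourier φ n).re = ∫ x, ((φ.1 x : ℂ) * UnitAddTorus.mFourier n x).re :=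
    (integral_re hI).symm
  have h2 : (torusFourier φ n).im = ∫ x, ((φ.1 x : ℂ) * UnitAddTorus.mFourier n x).im :=
    (integral_im hI).symm
  have hre : Integrable fun x => ((φ.1 x : ℂ) * UnitAddTorus.mFourier n x).re := hI.re
  have him : Integrable fun x => ((φ.1 x : ℂ) * UnitAddTorus.mFourier n x).im := hI.im
  rw [h1, h2, smoothCoeff, ← integral_add hre him]
  refine integral_congr_ae (Eventually.of_forall fun x => ?_)
  simp only [torusCas_apply, Complex.re_ofReal_mul, Complex.im_ofReal_mul]
  ring

lemma abs_smoothCoeff_le {k : ℕ} {φ : SmoothTorusFn} {M : ℝ} (h : DerivBound k φ M)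
    (n : Fin 2 → ℤ) : ‖n‖ ^ k * |smoothCoeff φ n| ≤ 2 * M := by
  have h1 := norm_torusFourier_le h n
  have h2 : |smoothCoeff φ n| ≤ 2 * ‖torusFourier φ n‖ := by
    rw [smoothCoeff_eq]
    refine (abs_add_le _ _).trans ?_
    linarith [Complex.abs_re_le_norm (torusFourier φ n), Complex.abs_im_le_norm (torusFourier φ n)]
  calc _ ≤ ‖n‖ ^ k * (2 * ‖torusFourier φ n‖) := by gcongr
    _ ≤ _ := by linarith

/-- Three derivatives beyond `k` leave a factor `‖n‖^{-3}`, summable over the nonzero vectors of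
`ℤ²`. -/
lemma summable_norm_pow_mul_smoothCoeff (φ : SmoothTorusFn) (k : ℕ) :
    Summable fun n => ‖n‖ ^ k * |smoothCoeff φ n| := by
  obtain ⟨M, hM⟩ := exists_derivBound (k + 3) φ
  have h := (EisensteinSeries.summable_one_div_norm_rpow (k := 3) (by norm_num)).mul_left (2 * M)
  refine Summable.of_norm_bounded_eventually h ?_
  have h0 : ∀ᶠ n : Fin 2 → ℤ in cofinite, n ≠ 0 := by simp
  filter_upwards [h0] with n hn
  have hpos : 0 < ‖n‖ := norm_pos_iff.mpr hn
  have h1 := abs_smoothCoeff_le hM n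
  rw [Real.norm_of_nonneg (by positivity), Real.rpow_neg hpos.le, ← div_eq_mul_inv,
    le_div_iff₀ (by positivity)]
  refine le_trans (le_of_eq ?_) h1
  rw [pow_add, show (3 : ℝ) = ((3 : ℕ) : ℝ) by norm_num, Real.rpow_natCast]
  ring

lemma summable_abs_smoothCoeff (φ : SmoothTorusFn) : Summable fun n => |smoothCoeff φ n| := by
  simpa using summable_norm_pow_mul_smoothCoeff φ 0

end Coefficients

/-! ### Trigonometric expansion, orthonormality and Parseval's identity -/

section Series

lemma volume_torus_eq :
    (volume : Measure Torus) = Measure.pi fun _ : Fin 2 => AddCircle.haarAddCircle := by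
  have h : (volume : Measure UnitAddCircle) = AddCircle.haarAddCircle := by
    rw [AddCircle.volume_eq_smul_haarAddCircle, ENNReal.ofReal_one, one_smul]
  rw [volume_pi, h]

lemma mFourierCoeff_eq_torusFourier (φ : SmoothTorusFn) (n : Fin 2 → ℤ) :
    UnitAddTorus.mFourierCoeff (fun x => (φ.1 x : ℂ)) n = torusFourier φ (-n) := by
  rw [torusFourier, volume_torus_eq, UnitAddTorus.mFourierCoeff]
  refine integral_congr_ae (Eventually.of_forall fun x => ?_)
  simp only [smul_eq_mul]
  ring

lemma summable_torusFourier (φ : SmoothTorusFn) : Summable (torusFourier φ) := by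
  obtain ⟨M, hM⟩ := exists_derivBound 3 φ
  have h := (EisensteinSeries.summable_one_div_norm_rpow (k := 3) (by norm_num)).mul_left M
  refine Summable.of_norm_bounded_eventually h ?_
  have h0 : ∀ᶠ n : Fin 2 → ℤ in cofinite, n ≠ 0 := by simp
  filter_upwards [h0] with n hn
  have hpos : 0 < ‖n‖ := norm_pos_iff.mpr hn
  have h1 := norm_torusFourier_le hM n
  rw [Real.rpow_neg hpos.le, ← div_eq_mul_inv, le_div_iff₀ (by positivity),
    show (3 : ℝ) = ((3 : ℕ) : ℝ) by norm_num, Real.rpow_natCast, mul_comm]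
  exact h1

lemma hasSum_torusFourier (φ : SmoothTorusFn) (x : Torus) :
    HasSum (fun n => torusFourier φ n * (starRingEnd ℂ) (UnitAddTorus.mFourier n x))
      (φ.1 x : ℂ) := by
  let f : C(Torus, ℂ) := ⟨fun x => (φ.1 x : ℂ),
    Complex.continuous_ofReal.comp (continuous_smoothTorusFn φ)⟩
  have hcoef : UnitAddTorus.mFourierCoeff f = fun n => torusFourier φ (-n) :=
    funext fun n => mFourierCoeff_eq_torusFourier φ n
  have hs : Summable (UnitAddTorus.mFourierCoeff f) := by
    rw [hcoef]
    exact (Equiv.neg (Fin 2 → ℤ)).summable_iff.mpr (summable_torusFourier φ)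
  have h := UnitAddTorus.hasSum_mFourier_series_apply_of_summable hs x
  rw [hcoef] at h
  refine HasSum.congr_fun ((Equiv.neg (Fin 2 → ℤ)).hasSum_iff.mpr h) fun n => ?_
  simp [UnitAddTorus.mFourier_neg]

lemma torusFourier_neg (φ : SmoothTorusFn) (n : Fin 2 → ℤ) :
    torusFourier φ (-n) = (starRingEnd ℂ) (torusFourier φ n) := by
  rw [torusFourier, torusFourier, ← integral_conj]
  refine integral_congr_ae (Eventually.of_forall fun x => ?_)
  simp [UnitAddTorus.mFourier_neg]

/-- The expansion of a smooth function in the basis `torusCas`. -/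
lemma hasSum_smoothCoeff (φ : SmoothTorusFn) (x : Torus) :
    HasSum (fun n => smoothCoeff φ n * (torusCas n).1 x) (φ.1 x) := by
  have h1 := Complex.hasSum_re (hasSum_torusFourier φ x)
  have hs : Summable fun n => torusFourier φ n * UnitAddTorus.mFourier n x := by
    refine Summable.of_norm ((summable_torusFourier φ).norm.congr fun n => ?_)
    rw [norm_mul, norm_mFourier_apply, mul_one]
  have h2 := Complex.hasSum_im hs.hasSum
  have h3 := hasSum_comp_neg h2
  have h4 : (fun n => (torusFourier φ (-n) * UnitAddTorus.mFourier (-n) x).im) =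
      fun n => -(torusFourier φ n * UnitAddTorus.mFourier n x).im := by
    funext n
    rw [torusFourier_neg, UnitAddTorus.mFourier_neg, ← map_mul, Complex.conj_im]
  rw [h4] at h3
  -- The imaginary parts are odd in `n` and sum to zero. Adding this null series to the real one
  -- completes the product `(Re + Im)(Re + Im)` of the coefficient and the basis function.
  have h5 : (∑' n, torusFourier φ n * UnitAddTorus.mFourier n x).im = 0 := by
    have := h3.unique h2.neg
    linarith
  rw [h5] at h2
  have h6 := h1.add h2
  rw [Complex.ofReal_re, add_zero] at h6
  refine HasSum.congr_fun h6 fun n => ?_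
  simp only [smoothCoeff_eq, torusCas_apply, Complex.mul_re, Complex.mul_im, Complex.conj_re,
    Complex.conj_im]
  ring

/-- For `n ≠ 0`, apply the derivative rule to the constant function: a nonzero multiple of the
integral equals the coefficient of the zero function. -/
lemma integral_mFourier (n : Fin 2 → ℤ) :
    ∫ x : Torus, UnitAddTorus.mFourier n x = if n = 0 then 1 else 0 := by
  split_ifs with h
  · subst h
    simp [UnitAddTorus.mFourier_zero]
  obtain ⟨i, hi⟩ : ∃ i, n i ≠ 0 := by
    by_contra! hc
    exact h (funext hc)
  let one : SmoothTorusFn := ⟨fun _ => 1, mem_smoothTorusFn.mpr contDiff_const⟩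
  have h1 : torusFourier one n = ∫ x : Torus, UnitAddTorus.mFourier n x := by
    simp [torusFourier, one]
  have h2 : torusFourier (smoothPartial i one) n = 0 := by
    have : ∀ x, (smoothPartial i one).1 x = 0 := fun x => by
      simp [smoothPartial, torusPartial, one]
    simp [torusFourier, this]
  rw [torusFourier_smoothPartial, h1] at h2
  refine (mul_eq_zero.mp h2).resolve_left ?_
  simp [hi, Real.pi_ne_zero]

/-- The product of two basis functions is `Re e_{n-m} + Im e_{n+m}`; the second integral is zero
even at `n = -m`, where the integrand is the imaginary part of `1`. -/
lemma smoothCoeff_torusCas (m n : Fin 2 → ℤ) :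
    smoothCoeff (torusCas m) n = if n = m then 1 else 0 := by
  have h1 : ∀ x, (torusCas m).1 x * (torusCas n).1 x =
      (UnitAddTorus.mFourier (n - m) x).re + (UnitAddTorus.mFourier (n + m) x).im := by
    intro x
    rw [sub_eq_add_neg, UnitAddTorus.mFourier_add, UnitAddTorus.mFourier_add,
      UnitAddTorus.mFourier_neg, torusCas_apply, torusCas_apply]
    simp only [Complex.mul_re, Complex.mul_im, Complex.conj_re, Complex.conj_im]
    ring
  have hI : ∀ k : Fin 2 → ℤ, Integrable fun x : Torus => UnitAddTorus.mFourier k x := fun k =>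
    integrable_of_continuous (UnitAddTorus.mFourier k).continuous
  have hre : ∀ k : Fin 2 → ℤ, ∫ x : Torus, (UnitAddTorus.mFourier k x).re =
      (∫ x : Torus, UnitAddTorus.mFourier k x).re := fun k => integral_re (hI k)
  have him : ∀ k : Fin 2 → ℤ, ∫ x : Torus, (UnitAddTorus.mFourier k x).im =
      (∫ x : Torus, UnitAddTorus.mFourier k x).im := fun k => integral_im (hI k)
  simp only [smoothCoeff, h1]
  have hIre : Integrable fun x : Torus => (UnitAddTorus.mFourier (n - m) x).re := (hI _).re
  have hIim : Integrable fun x : Torus => (UnitAddTorus.mFourier (n + m) x).im := (hI _).im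
  rw [integral_add hIre hIim, hre, him, integral_mFourier, integral_mFourier]
  simp only [sub_eq_zero]
  split_ifs <;> simp

lemma hasSum_smoothCoeff_sq (φ : SmoothTorusFn) :
    HasSum (fun n => smoothCoeff φ n ^ 2) (∫ x, φ.1 x ^ 2) := by
  obtain ⟨M, hM⟩ := exists_derivBound 0 φ
  have hc := continuous_smoothTorusFn φ
  have hcc : ∀ n, Continuous fun x => smoothCoeff φ n * (torusCas n).1 x * φ.1 x := fun n => by
    have := continuous_smoothTorusFn (torusCas n)
    fun_prop
  have h := hasSum_integral_of_summable_integral_norm (μ := (volume : Measure Torus))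
    (F := fun n x => smoothCoeff φ n * (torusCas n).1 x * φ.1 x)
    (fun n => integrable_of_continuous (hcc n)) ?_
  · have h1 : ∀ x, ∑' n, smoothCoeff φ n * (torusCas n).1 x * φ.1 x = φ.1 x ^ 2 := fun x => by
      rw [sq]
      exact ((hasSum_smoothCoeff φ x).mul_right (φ.1 x)).tsum_eq
    simp only [h1] at h
    refine HasSum.congr_fun h fun n => ?_
    simp only [mul_assoc]
    rw [integral_const_mul, sq, smoothCoeff]
    simp only [mul_comm]
  · refine Summable.of_nonneg_of_le (fun n => integral_nonneg fun x => norm_nonneg _) (fun n => ?_)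
      ((summable_abs_smoothCoeff φ).mul_right (2 * M))
    have h2 : ∀ x, ‖smoothCoeff φ n * (torusCas n).1 x * φ.1 x‖ ≤ |smoothCoeff φ n| * (2 * M) := by
      intro x
      rw [Real.norm_eq_abs, abs_mul, abs_mul, mul_assoc]
      have := hM.abs_le x
      have := abs_torusCas_le n x
      gcongr
    refine (integral_mono (integrable_of_continuous (hcc n).norm) (integrable_const _) h2).trans ?_
    simp

end Series

/-! ### Convergence of the expansion in all derivatives and against distributions -/

section Expansion

/-- The linear form `x ↦ 2π n·x`. -/
def phaseCLM (n : Fin 2 → ℤ) : Plane →L[ℝ] ℝ :=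
  ∑ i, (2 * Real.pi * n i) • EuclideanSpace.proj i

lemma norm_phaseCLM_le (n : Fin 2 → ℤ) : ‖phaseCLM n‖ ≤ 4 * Real.pi * ‖n‖ := by
  refine (norm_sum_le _ _).trans ?_
  have h : ∀ i, ‖(2 * Real.pi * (n i : ℝ)) • (EuclideanSpace.proj i : Plane →L[ℝ] ℝ)‖ ≤
      2 * Real.pi * ‖n‖ := by
    intro i
    have h1 : ‖(EuclideanSpace.proj i : Plane →L[ℝ] ℝ)‖ ≤ 1 :=
      ContinuousLinearMap.opNorm_le_bound _ zero_le_one fun x => by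
        rw [one_mul]
        exact PiLp.norm_apply_le x i
    have h2 : ‖(n i : ℝ)‖ ≤ ‖n‖ := by
      rw [Real.norm_eq_abs, ← Int.norm_eq_abs]
      exact norm_le_pi_norm n i
    rw [norm_smul, norm_mul, norm_mul, Real.norm_ofNat, Real.norm_of_nonneg Real.pi_pos.le]
    calc _ ≤ 2 * Real.pi * ‖n‖ * 1 := by gcongr
      _ = _ := mul_one _
  refine (Finset.sum_le_sum fun i _ => h i).trans (le_of_eq ?_)
  simp
  ring

lemma torusCas_torusProj (n : Fin 2 → ℤ) (x : Plane) :
    (torusCas n).1 (torusProj x) = Real.cos (phaseCLM n x) + Real.sin (phaseCLM n x) := by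
  have h : UnitAddTorus.mFourier n (torusProj x) = Complex.exp ((phaseCLM n x : ℝ) * Complex.I) := by
    rw [mFourier_torusProj, ← Complex.exp_sum]
    congr 1
    simp only [phaseCLM, sum_apply, smul_apply, PiLp.proj_apply, smul_eq_mul]
    push_cast
    rw [Finset.sum_mul]
    exact Finset.sum_congr rfl fun i _ => by ring
  rw [torusCas_apply, h, Complex.exp_ofReal_mul_I_re, Complex.exp_ofReal_mul_I_im]

lemma norm_iteratedFDeriv_torusCas_le (n : Fin 2 → ℤ) (k : ℕ) (x : Plane) :
    ‖iteratedFDeriv ℝ k (fun y : Plane => (torusCas n).1 (torusProj y)) x‖ ≤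
      2 * (4 * Real.pi * ‖n‖) ^ k := by
  have h1 : (fun y : Plane => (torusCas n).1 (torusProj y)) =
      (fun t => Real.cos t + Real.sin t) ∘ phaseCLM n := funext fun y => torusCas_torusProj n y
  have hcd : ContDiff ℝ ((⊤ : ℕ∞) : WithTop ℕ∞) fun t : ℝ => Real.cos t + Real.sin t :=
    Real.contDiff_cos.add Real.contDiff_sin
  rw [h1, (phaseCLM n).iteratedFDeriv_comp_right hcd x (i := k) (by exact_mod_cast le_top)]
  refine (ContinuousMultilinearMap.norm_compContinuousLinearMap_le _ _).trans ?_
  rw [Finset.prod_const, Finset.card_univ, Fintype.card_fin, norm_iteratedFDeriv_eq_norm_iteratedDeriv]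
  have h2 : ‖iteratedDeriv k (fun t : ℝ => Real.cos t + Real.sin t) (phaseCLM n x)‖ ≤ 2 := by
    rw [iteratedDeriv_fun_add Real.contDiff_cos.contDiffAt Real.contDiff_sin.contDiffAt]
    refine (norm_add_le _ _).trans ?_
    have := Real.abs_iteratedDeriv_cos_le_one k (phaseCLM n x)
    have := Real.abs_iteratedDeriv_sin_le_one k (phaseCLM n x)
    simp only [Real.norm_eq_abs]
    linarith
  gcongr
  exact norm_phaseCLM_le n

/-- The bound for the derivatives of order `k` of the terms of the trigonometric expansion. -/
def expansionBound (φ : SmoothTorusFn) (k : ℕ) (n : Fin 2 → ℤ) : ℝ :=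
  |smoothCoeff φ n| * (2 * (4 * Real.pi * ‖n‖) ^ k)

lemma summable_expansionBound (φ : SmoothTorusFn) (k : ℕ) : Summable (expansionBound φ k) := by
  refine ((summable_norm_pow_mul_smoothCoeff φ k).mul_left (2 * (4 * Real.pi) ^ k)).congr fun n => ?_
  rw [expansionBound, mul_pow]
  ring

/-- The remainder is the tail of the series, differentiated term by term. Summing the tails over all
orders up to `k` provides one bound for all these derivatives, tending to zero as `s` grows. -/
lemma derivBound_sub_sum (φ : SmoothTorusFn) (k : ℕ) (s : Finset (Fin 2 → ℤ)) :
    DerivBound k (φ - ∑ n ∈ s, smoothCoeff φ n • torusCas n)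
      (∑ j ∈ Finset.range (k + 1), ∑' n : {n // n ∉ s}, expansionBound φ j n) := by
  intro j hj x
  have hnn : ∀ j n, 0 ≤ expansionBound φ j n := fun j n => by
    unfold expansionBound; positivity
  have hfun : (fun y : Plane => (φ - ∑ n ∈ s, smoothCoeff φ n • torusCas n).1 (torusProj y)) =
      fun y => ∑' n : {n // n ∉ s}, smoothCoeff φ n * (torusCas (n : Fin 2 → ℤ)).1 (torusProj y) := by
    funext y
    have h1 := hasSum_smoothCoeff φ (torusProj y)
    have h2 := (h1.summable.sum_add_tsum_subtype_compl s)
    rw [h1.tsum_eq] at h2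
    have h3 : (φ - ∑ n ∈ s, smoothCoeff φ n • torusCas n).1 (torusProj y) =
        φ.1 (torusProj y) - ∑ n ∈ s, smoothCoeff φ n * (torusCas n).1 (torusProj y) := by
      rw [Submodule.coe_sub, Submodule.coe_sum, Pi.sub_apply, Finset.sum_apply]
      rfl
    rw [h3, ← h2, add_sub_cancel_left]
  have hcd : ∀ n : {n // n ∉ s}, ContDiff ℝ ((⊤ : ℕ∞) : WithTop ℕ∞) fun y : Plane =>
      smoothCoeff φ n * (torusCas (n : Fin 2 → ℤ)).1 (torusProj y) := fun n =>
    contDiff_const.mul (contDiff_smoothTorusFn _)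
  have hbd : ∀ (j : ℕ) (n : {n // n ∉ s}) (y : Plane), ‖iteratedFDeriv ℝ j (fun y : Plane =>
      smoothCoeff φ n * (torusCas (n : Fin 2 → ℤ)).1 (torusProj y)) y‖ ≤ expansionBound φ j n := by
    intro j n y
    have h1 : (fun y : Plane => smoothCoeff φ n * (torusCas (n : Fin 2 → ℤ)).1 (torusProj y)) =
        smoothCoeff φ n • fun y : Plane => (torusCas (n : Fin 2 → ℤ)).1 (torusProj y) := rfl
    rw [h1, iteratedFDeriv_const_smul_apply
      ((contDiff_smoothTorusFn _).of_le (by exact_mod_cast le_top)).contDiffAt, norm_smul,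
      Real.norm_eq_abs, expansionBound]
    gcongr
    exact norm_iteratedFDeriv_torusCas_le _ _ _
  have hsum : ∀ j, Summable fun n : {n // n ∉ s} => expansionBound φ j n := fun j =>
    (summable_expansionBound φ j).subtype _
  rw [hfun, iteratedFDeriv_tsum_apply (N := ⊤) hcd (fun j _ => hsum j)
    (fun j n y _ => hbd j n y) le_top]
  refine (tsum_of_norm_bounded (hsum j).hasSum fun n => hbd j n x).trans ?_
  exact Finset.single_le_sum (f := fun j => ∑' n : {n // n ∉ s}, expansionBound φ j n)
    (fun j _ => tsum_nonneg fun n => hnn j n) (Finset.mem_range.mpr (by omega))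

/-- A distribution is determined by its coefficients. -/
lemma TorusDistribution.hasSum_pair (T : TorusDistribution) (φ : SmoothTorusFn) :
    HasSum (fun n => smoothCoeff φ n * casCoeff T n) (T.pair φ) := by
  obtain ⟨k, C, hC⟩ := T.2
  -- A distribution has finite order `k`, so only finitely many derivative tails have to be small.
  have h0 : Tendsto (fun s : Finset (Fin 2 → ℤ) => C *
      ∑ j ∈ Finset.range (k + 1), ∑' n : {n // n ∉ s}, expansionBound φ j n) atTop (𝓝 0) := by
    have h1 := tendsto_finsetSum (Finset.range (k + 1)) fun j (_ : j ∈ Finset.range (k + 1)) =>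
      tendsto_tsum_compl_atTop_zero (expansionBound φ j)
    simpa using h1.const_mul C
  rw [HasSum, tendsto_iff_dist_tendsto_zero]
  refine squeeze_zero (fun _ => dist_nonneg) (fun s => ?_) h0
  have h2 := hC _ _ (derivBound_sub_sum φ k s)
  have h3 : T.1 (φ - ∑ n ∈ s, smoothCoeff φ n • torusCas n) =
      T.pair φ - ∑ n ∈ s, smoothCoeff φ n * casCoeff T n := by
    change T.pair _ = _
    rw [pair_sub_right, pair_sum_right]
    simp only [pair_smul_right, casCoeff]
  rw [h3] at h2
  rwa [dist_comm, Real.dist_eq]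

end Expansion

end


noncomputable section

/-! ### Distributions with prescribed coefficients of polynomial growth -/

section OfCoeff

lemma DerivBound.mono {k l : ℕ} {φ : SmoothTorusFn} {M : ℝ} (h : DerivBound l φ M) (hkl : k ≤ l) :
    DerivBound k φ M := fun j hj => h j (hj.trans hkl)

lemma DerivBound.max_norm_pow_mul_abs_smoothCoeff_le {k : ℕ} {φ : SmoothTorusFn} {M : ℝ}
    (h : DerivBound k φ M) (n : Fin 2 → ℤ) :
    max 1 ‖n‖ ^ k * |smoothCoeff φ n| ≤ 2 * M := by
  rcases max_choice 1 ‖n‖ with hn | hn <;> rw [hn]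
  · simpa using abs_smoothCoeff_le (h.mono (Nat.zero_le k)) n
  · exact abs_smoothCoeff_le h n

lemma summable_max_norm_pow_inv : Summable fun n : Fin 2 → ℤ => (max 1 ‖n‖ ^ 3)⁻¹ := by
  have h := EisensteinSeries.summable_one_div_norm_rpow (k := 3) (by norm_num)
  refine Summable.of_norm_bounded_eventually h ?_
  have h0 : ∀ᶠ n : Fin 2 → ℤ in cofinite, n ≠ 0 := by simp
  filter_upwards [h0] with n hn
  have hpos : 0 < ‖n‖ := norm_pos_iff.mpr hn
  rw [Real.norm_of_nonneg (by positivity), Real.rpow_neg hpos.le,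
    show (3 : ℝ) = ((3 : ℕ) : ℝ) by norm_num, Real.rpow_natCast]
  gcongr
  exact le_max_right _ _

lemma smoothCoeff_add (φ ψ : SmoothTorusFn) (n : Fin 2 → ℤ) :
    smoothCoeff (φ + ψ) n = smoothCoeff φ n + smoothCoeff ψ n := by
  have h : ∀ φ : SmoothTorusFn, Integrable fun x => φ.1 x * (torusCas n).1 x := fun φ =>
    integrable_of_continuous
      ((continuous_smoothTorusFn φ).mul (continuous_smoothTorusFn (torusCas n)))
  rw [smoothCoeff, smoothCoeff, smoothCoeff, ← integral_add (h φ) (h ψ)]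
  refine integral_congr_ae (Eventually.of_forall fun x => ?_)
  exact add_mul (φ.1 x) (ψ.1 x) _

lemma smoothCoeff_smul (a : ℝ) (φ : SmoothTorusFn) (n : Fin 2 → ℤ) :
    smoothCoeff (a • φ) n = a * smoothCoeff φ n := by
  rw [smoothCoeff, smoothCoeff, ← integral_const_mul]
  exact integral_congr_ae (Eventually.of_forall fun x => mul_assoc a (φ.1 x) _)

variable {c : (Fin 2 → ℤ) → ℝ} {B : ℝ} {m : ℕ}

/-- Of the `m + 3` derivatives, `m` absorb the growth of `c` and three make the bound summable over
`ℤ²`; the maximum with `1` includes the zero frequency. -/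
lemma abs_smoothCoeff_mul_le (h : ∀ n, |c n| ≤ B * max 1 ‖n‖ ^ m) {φ : SmoothTorusFn} {M : ℝ}
    (hφ : DerivBound (m + 3) φ M) (n : Fin 2 → ℤ) :
    ‖smoothCoeff φ n * c n‖ ≤ 2 * M * B * (max 1 ‖n‖ ^ 3)⁻¹ := by
  have hx : (0 : ℝ) < max 1 ‖n‖ := by positivity
  have h1 := hφ.max_norm_pow_mul_abs_smoothCoeff_le n
  have hB : 0 ≤ B := by
    have := (abs_nonneg _).trans (h n)
    exact nonneg_of_mul_nonneg_left this (by positivity)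
  rw [← div_eq_mul_inv, le_div_iff₀ (by positivity), Real.norm_eq_abs, abs_mul]
  calc |smoothCoeff φ n| * |c n| * max 1 ‖n‖ ^ 3
      ≤ |smoothCoeff φ n| * (B * max 1 ‖n‖ ^ m) * max 1 ‖n‖ ^ 3 := by gcongr; exact h n
    _ = (max 1 ‖n‖ ^ (m + 3) * |smoothCoeff φ n|) * B := by ring
    _ ≤ _ := by gcongr

lemma summable_smoothCoeff_mul (h : ∀ n, |c n| ≤ B * max 1 ‖n‖ ^ m) (φ : SmoothTorusFn) :
    Summable fun n => smoothCoeff φ n * c n := by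
  obtain ⟨M, hM⟩ := exists_derivBound (m + 3) φ
  exact Summable.of_norm_bounded (summable_max_norm_pow_inv.mul_left _)
    (abs_smoothCoeff_mul_le h hM)

/-- The distribution with prescribed coefficients of polynomial growth. -/
def coeffDistribution (c : (Fin 2 → ℤ) → ℝ) (B : ℝ) (m : ℕ)
    (h : ∀ n, |c n| ≤ B * max 1 ‖n‖ ^ m) : TorusDistribution :=
  ⟨{  toFun := fun φ => ∑' n, smoothCoeff φ n * c n
      map_add' := fun φ ψ => by
        simp only [smoothCoeff_add, add_mul]
        exact (summable_smoothCoeff_mul h φ).tsum_add (summable_smoothCoeff_mul h ψ)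
      map_smul' := fun a φ => by
        simp only [smoothCoeff_smul, mul_assoc, RingHom.id_apply, smul_eq_mul]
        exact tsum_mul_left },
    m + 3, 2 * B * ∑' n : Fin 2 → ℤ, (max 1 ‖n‖ ^ 3)⁻¹, fun φ M hM => by
      have h1 := tsum_of_norm_bounded (summable_max_norm_pow_inv.mul_left (2 * M * B)).hasSum
        (abs_smoothCoeff_mul_le h hM)
      refine (le_of_eq ?_).trans (h1.trans (le_of_eq ?_))
      · exact (Real.norm_eq_abs _).symm
      · rw [tsum_mul_left]; ring⟩

lemma casCoeff_coeffDistribution (h : ∀ n, |c n| ≤ B * max 1 ‖n‖ ^ m) (n : Fin 2 → ℤ) :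
    casCoeff (coeffDistribution c B m h) n = c n := by
  change ∑' k, smoothCoeff (torusCas n) k * c k = c n
  simp [smoothCoeff_torusCas]

/-- Each term of the Sobolev sum is at most the whole sum, so `c n` is at most the square root of
that sum times the inverse weight. This is what allows `coeffDistribution` to realise Sobolev
sequences. -/
lemma exists_growth_of_summable {s : ℝ}
    (hc : Summable fun n => sobolevWeight s n * c n ^ 2) :
    ∃ (B : ℝ) (m : ℕ), ∀ n, |c n| ≤ B * max 1 ‖n‖ ^ m := by
  obtain ⟨m, hm⟩ := exists_nat_ge (-s)
  set S := ∑' n, sobolevWeight s n * c n ^ 2 with hS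
  -- The factor `3` comes from `1 + n_0² + n_1² ≤ 3 max(1, ‖n‖)²`, and the integer `m` exceeds `-s`.
  refine ⟨√(S * 3 ^ m), m, fun n => ?_⟩
  have hS0 : 0 ≤ S := tsum_nonneg fun n => mul_nonneg (sobolevWeight_nonneg s n) (sq_nonneg _)
  have h1 : sobolevWeight s n * c n ^ 2 ≤ S :=
    hc.le_tsum n fun k _ => mul_nonneg (sobolevWeight_nonneg s k) (sq_nonneg _)
  have hx : (1 : ℝ) ≤ max 1 ‖n‖ := le_max_left _ _
  have h2 : 1 + ∑ i, (n i : ℝ) ^ 2 ≤ 3 * max 1 ‖n‖ ^ 2 := by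
    have h3 : ∀ i, (n i : ℝ) ^ 2 ≤ max 1 ‖n‖ ^ 2 := fun i => by
      rw [← sq_abs, ← Int.norm_eq_abs]
      exact pow_le_pow_left₀ (norm_nonneg _) ((norm_le_pi_norm n i).trans (le_max_right _ _)) 2
    rw [Fin.sum_univ_two]
    have := one_le_pow₀ hx (n := 2)
    linarith [h3 0, h3 1]
  have h4 : (sobolevWeight s n)⁻¹ ≤ 3 ^ m * (max 1 ‖n‖ ^ m) ^ 2 := by
    rw [sobolevWeight, ← Real.rpow_neg (by positivity)]
    calc (1 + ∑ i, (n i : ℝ) ^ 2) ^ (-s) ≤ (1 + ∑ i, (n i : ℝ) ^ 2) ^ (m : ℝ) :=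
          Real.rpow_le_rpow_of_exponent_le
            (le_add_of_nonneg_right (Finset.sum_nonneg fun i _ => sq_nonneg _)) hm
      _ ≤ (3 * max 1 ‖n‖ ^ 2) ^ (m : ℝ) := by gcongr
      _ = _ := by rw [Real.rpow_natCast, mul_pow, ← pow_mul, ← pow_mul, mul_comm 2 m]
  refine abs_le_of_sq_le_sq ?_ (by positivity)
  rw [mul_pow, Real.sq_sqrt (by positivity)]
  have hw := sobolevWeight_pos s n
  calc c n ^ 2 ≤ S * (sobolevWeight s n)⁻¹ := by
        rw [← div_eq_mul_inv, le_div_iff₀ hw]; linarith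
    _ ≤ S * (3 ^ m * (max 1 ‖n‖ ^ m) ^ 2) := by gcongr
    _ = _ := by ring

end OfCoeff

/-! ### Finite-dimensional approximation in Sobolev spaces -/

namespace SobolevSpace

variable {s : ℝ}

open Classical in
/-- The element of `H^s` with coefficients `c` if `∑ (1 + |n|²)^s c_n² < ∞`, and `0` otherwise. -/
def ofCoeff (s : ℝ) (c : (Fin 2 → ℤ) → ℝ) : SobolevSpace s :=
  if h : Summable fun n => sobolevWeight s n * c n ^ 2 then
    ⟨coeffDistribution c _ _ (exists_growth_of_summable h).choose_spec.choose_spec,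
      mem_sobolevSubmodule_iff.mpr (by simpa only [casCoeff_coeffDistribution] using h)⟩
  else 0

lemma casCoeff_ofCoeff {c : (Fin 2 → ℤ) → ℝ} (h : Summable fun n => sobolevWeight s n * c n ^ 2)
    (n : Fin 2 → ℤ) : casCoeff (ofCoeff s c).toDistribution n = c n := by
  have e : (ofCoeff s c).toDistribution = coeffDistribution c _ _
      (exists_growth_of_summable h).choose_spec.choose_spec :=
    congrArg toDistribution (dif_pos h)
  rw [e, casCoeff_coeffDistribution]

/-- The trigonometric polynomial with coefficients `v` at the frequencies in `F`. -/
def trigPoly (s : ℝ) (F : Finset (Fin 2 → ℤ)) (v : EuclideanSpace ℝ F) : SobolevSpace s :=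
  ofCoeff s fun n => if h : n ∈ F then v ⟨n, h⟩ else 0

/-- The coefficients of `T` at the frequencies in `F`. -/
def coeffVec (F : Finset (Fin 2 → ℤ)) (T : SobolevSpace s) : EuclideanSpace ℝ F :=
  WithLp.toLp 2 fun n => casCoeff T.toDistribution n.1

lemma casCoeff_trigPoly (F : Finset (Fin 2 → ℤ)) (v : EuclideanSpace ℝ F) (n : Fin 2 → ℤ) :
    casCoeff (trigPoly s F v).toDistribution n = if h : n ∈ F then v ⟨n, h⟩ else 0 := by
  refine casCoeff_ofCoeff (summable_of_ne_finset_zero (s := F) fun n hn => ?_) n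
  simp [hn]

lemma continuous_trigPoly (hs : s < -1) (F : Finset (Fin 2 → ℤ)) :
    Continuous (trigPoly s F) := by
  refine continuous_of_casCoeff hs (fun n => ?_) fun v₀ => ⟨‖v₀‖ + 1, ?_⟩
  · simp only [casCoeff_trigPoly]
    split_ifs <;> fun_prop
  · filter_upwards [continuous_norm.tendsto v₀ |>.eventually
      (eventually_le_nhds (lt_add_one ‖v₀‖))] with v hv n
    rw [casCoeff_trigPoly]
    split_ifs with h
    · exact (PiLp.norm_apply_le v ⟨n, h⟩).trans hv
    · rw [abs_zero]; positivity

lemma continuous_coeffVec (F : Finset (Fin 2 → ℤ)) :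
    Continuous (coeffVec (s := s) F) :=
  (PiLp.continuous_toLp 2 _).comp (continuous_pi fun n => continuous_casCoeff n.1)

lemma hasSum_dist_sq_trigPoly_coeffVec (F : Finset (Fin 2 → ℤ)) (T : SobolevSpace s) :
    HasSum (fun n => if n ∈ F then 0 else sobolevWeight s n * casCoeff T.toDistribution n ^ 2)
      (dist (trigPoly s F (coeffVec F T)) T ^ 2) := by
  have h : (fun n => if n ∈ F then 0 else sobolevWeight s n * casCoeff T.toDistribution n ^ 2) =
      fun n => sobolevWeight s n * (casCoeff (trigPoly s F (coeffVec F T)).toDistribution n -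
        casCoeff T.toDistribution n) ^ 2 := by
    funext n
    rw [casCoeff_trigPoly]
    split_ifs with hn
    · simp [coeffVec]
    · simp
  rw [dist_sq_eq_casCoeff, h]
  exact (summable_casCoeff (trigPoly s F (coeffVec F T) - T)).hasSum

lemma tendsto_trigPoly_coeffVec (T : SobolevSpace s) :
    Tendsto (fun F => trigPoly s F (coeffVec F T)) atTop (𝓝 T) := by
  rw [tendsto_iff_dist_tendsto_zero]
  have h2 : Tendsto (fun F => dist (trigPoly s F (coeffVec F T)) T ^ 2) atTop (𝓝 0) := by
    have h3 : ∀ F : Finset (Fin 2 → ℤ), dist (trigPoly s F (coeffVec F T)) T ^ 2 =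
        ∑' n, sobolevWeight s n * casCoeff T.toDistribution n ^ 2 -
          ∑ n ∈ F, sobolevWeight s n * casCoeff T.toDistribution n ^ 2 := fun F => by
      have h4 := hasSum_sum_of_ne_finset_zero (f := fun n => if n ∈ F then
        sobolevWeight s n * casCoeff T.toDistribution n ^ 2 else 0) (s := F)
        (L := SummationFilter.unconditional _) (fun n hn => by simp [hn])
      rw [Finset.sum_congr rfl fun n (hn : n ∈ F) => if_pos hn] at h4
      have h5 := ((hasSum_dist_sq_trigPoly_coeffVec F T).add h4).unique
        (T.summable_casCoeff.hasSum.congr_fun fun n => by split_ifs <;> simp)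
      linarith
    simp only [h3]
    have h6 := (tendsto_const_nhds (x := ∑' n, sobolevWeight s n *
      casCoeff T.toDistribution n ^ 2)).sub T.summable_casCoeff.hasSum
    simpa using h6
  have h3 := h2.sqrt
  simpa [Real.sqrt_sq dist_nonneg] using h3

/-- Pairing with a smooth function is a pointwise limit of finite combinations of coefficients, each
of which is continuous on `H^s`. -/
lemma measurable_pair (φ : SmoothTorusFn) :
    Measurable fun T : SobolevSpace s => T.toDistribution.pair φ := by
  have h : ∀ T : SobolevSpace s, HasSum
      (fun n => smoothCoeff φ n * casCoeff T.toDistribution n) (T.toDistribution.pair φ) :=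
    fun T => T.toDistribution.hasSum_pair φ
  have hm : ∀ F : Finset (Fin 2 → ℤ), Measurable fun T : SobolevSpace s =>
      ∑ n ∈ F, smoothCoeff φ n * casCoeff T.toDistribution n := fun F =>
    Finset.measurable_fun_sum _ fun n _ => (continuous_casCoeff n).measurable.const_mul _
  have hlim : Tendsto (fun (F : Finset (Fin 2 → ℤ)) (T : SobolevSpace s) =>
      ∑ n ∈ F, smoothCoeff φ n * casCoeff T.toDistribution n) atTop
      (𝓝 fun T => T.toDistribution.pair φ) := tendsto_pi_nhds.mpr h
  exact measurable_of_tendsto_metrizable' atTop hm hlim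

end SobolevSpace
end


noncomputable section

/-! ### Characteristic functions and moments of independent Gaussian families -/

section GaussianProduct

lemma integral_cexp_sum_gaussian {ι : Type*} [Fintype ι] (a : ι → ℝ) :
    ∫ ξ : ι → ℝ, Complex.exp (((∑ i, a i * ξ i : ℝ) : ℂ) * Complex.I)
      ∂(Measure.pi fun _ => gaussianReal 0 1) =
      ((Real.exp (-(∑ i, a i ^ 2) / 2) : ℝ) : ℂ) := by
  have h : ∀ ξ : ι → ℝ, Complex.exp (((∑ i, a i * ξ i : ℝ) : ℂ) * Complex.I) =
      ∏ i, Complex.exp ((a i : ℂ) * (ξ i : ℂ) * Complex.I) := fun ξ => by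
    rw [← Complex.exp_sum]
    push_cast
    rw [Finset.sum_mul]
  simp only [h]
  rw [integral_fintype_prod_eq_prod (fun i (x : ℝ) => Complex.exp ((a i : ℂ) * (x : ℂ) * Complex.I)),
    Complex.ofReal_exp, show ((-(∑ i, a i ^ 2) / 2 : ℝ) : ℂ) = ∑ i, (-(a i : ℂ) ^ 2 / 2) by
      push_cast; rw [← Finset.sum_neg_distrib, Finset.sum_div], Complex.exp_sum]
  refine Finset.prod_congr rfl fun i _ => ?_
  rw [← charFun_apply_real, charFun_gaussianReal]
  congr 1
  simp
  ring

/-- The law of a family of independent standard Gaussian variables indexed by `ℤ²`. -/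
def gaussianCoeff : Measure ((Fin 2 → ℤ) → ℝ) := Measure.infinitePi fun _ => gaussianReal 0 1

instance : IsProbabilityMeasure gaussianCoeff :=
  inferInstanceAs (IsProbabilityMeasure (Measure.infinitePi _))

lemma integral_cexp_sum_gaussianCoeff (F : Finset (Fin 2 → ℤ)) (a : (Fin 2 → ℤ) → ℝ) :
    ∫ g, Complex.exp (((∑ n ∈ F, a n * g n : ℝ) : ℂ) * Complex.I) ∂gaussianCoeff =
      ((Real.exp (-(∑ n ∈ F, a n ^ 2) / 2) : ℝ) : ℂ) := by
  have hc : Continuous fun y : F → ℝ =>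
      Complex.exp (((∑ n : F, a n * y n : ℝ) : ℂ) * Complex.I) := by fun_prop
  have h := integral_restrict_infinitePi (μ := fun _ : Fin 2 → ℤ => gaussianReal 0 1) (s := F)
    hc.aestronglyMeasurable
  rw [integral_cexp_sum_gaussian (fun n : F => a n)] at h
  rw [← Finset.sum_coe_sort F fun n => a n ^ 2, ← h]
  refine integral_congr_ae (Eventually.of_forall fun g => ?_)
  simp only [Finset.restrict]
  rw [← Finset.sum_coe_sort F fun n => a n * g n]

lemma integral_sq_gaussianReal (v : NNReal) : ∫ x, x ^ 2 ∂(gaussianReal 0 v) = v := by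
  have h := variance_of_integral_eq_zero (X := id) (μ := gaussianReal 0 v) aemeasurable_id
    (by simp)
  rw [variance_id_gaussianReal] at h
  exact h.symm

lemma integrable_sq_gaussianReal (v : NNReal) :
    Integrable (fun x => x ^ 2) (gaussianReal 0 v) :=
  (memLp_id_gaussianReal (μ := 0) (v := v) 2).integrable_sq

lemma lintegral_sq_gaussianCoeff (n : Fin 2 → ℤ) :
    ∫⁻ g, ENNReal.ofReal (g n ^ 2) ∂gaussianCoeff = 1 := by
  have h := measurePreserving_eval_infinitePi (fun _ : Fin 2 → ℤ => gaussianReal 0 1) n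
  have h2 := h.lintegral_comp (f := fun x : ℝ => ENNReal.ofReal (x ^ 2)) (by fun_prop)
  have h3 := ofReal_integral_eq_lintegral_ofReal (integrable_sq_gaussianReal 1)
    (Eventually.of_forall fun x => sq_nonneg x)
  rw [integral_sq_gaussianReal] at h3
  rw [← h3] at h2
  refine h2.trans ?_
  simp

end GaussianProduct

/-! ### Construction of white noise in negative Sobolev spaces -/

section Noise

variable {s : ℝ}

/-- By Tonelli, bounded second moments give the weighted sum of squares a finite expectation, so it
is almost surely finite. -/
lemma ae_summable_of_lintegral_sq_le {α : Type*} [MeasurableSpace α] {P : Measure α}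
    (hs : s < -1) {c : α → (Fin 2 → ℤ) → ℝ} (hc : ∀ n, Measurable fun ω => c ω n) {B : ENNReal}
    (hB : B ≠ ⊤) (h : ∀ n, ∫⁻ ω, ENNReal.ofReal (c ω n ^ 2) ∂P ≤ B) :
    ∀ᵐ ω ∂P, Summable fun n => sobolevWeight s n * c ω n ^ 2 := by
  have hm : ∀ n, Measurable fun ω => ENNReal.ofReal (sobolevWeight s n * c ω n ^ 2) := fun n =>
    (((hc n).pow_const 2).const_mul _).ennreal_ofReal
  have h1 : ∫⁻ ω, ∑' n, ENNReal.ofReal (sobolevWeight s n * c ω n ^ 2) ∂P ≠ ⊤ := by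
    rw [lintegral_tsum fun n => (hm n).aemeasurable]
    have h2 : ∀ n, ∫⁻ ω, ENNReal.ofReal (sobolevWeight s n * c ω n ^ 2) ∂P ≤
        ENNReal.ofReal (sobolevWeight s n) * B := fun n => by
      simp only [ENNReal.ofReal_mul (sobolevWeight_nonneg s n)]
      rw [lintegral_const_mul _ ((hc n).pow_const 2).ennreal_ofReal]
      gcongr
      exact h n
    refine ne_top_of_le_ne_top ?_ (ENNReal.tsum_le_tsum h2)
    rw [ENNReal.tsum_mul_right]
    exact ENNReal.mul_ne_top (summable_sobolevWeight hs).tsum_ofReal_ne_top hB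
  filter_upwards [ae_lt_top (Measurable.tsum hm) h1] with ω hω
  refine (ENNReal.summable_toReal hω.ne).congr fun n => ?_
  rw [ENNReal.toReal_ofReal (mul_nonneg (sobolevWeight_nonneg s n) (sq_nonneg _))]

lemma ae_summable_gaussianCoeff (hs : s < -1) :
    ∀ᵐ g ∂gaussianCoeff, Summable fun n => sobolevWeight s n * g n ^ 2 :=
  ae_summable_of_lintegral_sq_le hs (fun n => measurable_pi_apply n) ENNReal.one_ne_top
    fun n => (lintegral_sq_gaussianCoeff n).le

open SobolevSpace in
-- `ofCoeff` is defined by cases; on the almost sure event of summability it is the limit of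
-- trigonometric polynomials, each continuous in finitely many coefficients.
lemma aemeasurable_ofCoeff (hs : s < -1) : AEMeasurable (ofCoeff s) gaussianCoeff := by
  have hm : ∀ F : Finset (Fin 2 → ℤ), Measurable fun g : (Fin 2 → ℤ) → ℝ =>
      trigPoly s F (WithLp.toLp 2 fun n : F => g n.1) := fun F => by
    have hc : Continuous fun g : (Fin 2 → ℤ) → ℝ => WithLp.toLp 2 fun n : F => g n.1 := by fun_prop
    have h2 : Measurable fun g : (Fin 2 → ℤ) → ℝ => WithLp.toLp 2 fun n : F => g n.1 := by fun_prop
    exact (continuous_trigPoly hs F).measurable.comp h2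
  refine aemeasurable_of_tendsto_metrizable_ae (atTop : Filter (Finset (Fin 2 → ℤ)))
    (fun F => (hm F).aemeasurable) ?_
  filter_upwards [ae_summable_gaussianCoeff hs] with g hg
  have h := tendsto_trigPoly_coeffVec (ofCoeff s g)
  simp only [coeffVec, casCoeff_ofCoeff hg] at h
  exact h

/-- The law of white noise on `H^s`. -/
def whiteNoiseLaw (s : ℝ) : Measure (SobolevSpace s) := gaussianCoeff.map (SobolevSpace.ofCoeff s)

lemma isProbabilityMeasure_whiteNoiseLaw (hs : s < -1) : IsProbabilityMeasure (whiteNoiseLaw s) :=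
  Measure.isProbabilityMeasure_map (aemeasurable_ofCoeff hs)

lemma hasLaw_ofCoeff (hs : s < -1) :
    HasLaw (SobolevSpace.ofCoeff s) (whiteNoiseLaw s) gaussianCoeff :=
  ⟨aemeasurable_ofCoeff hs, rfl⟩

/-- Partial sums of the pairing have explicit Gaussian characteristic functions, and Parseval's
identity gives the limit of their variances. Integrands of modulus one pass to the limit. -/
lemma integral_cexp_pair_whiteNoiseLaw (hs : s < -1) (φ : SmoothTorusFn) (t : ℝ) :
    ∫ T, Complex.exp (((t * T.toDistribution.pair φ : ℝ) : ℂ) * Complex.I) ∂(whiteNoiseLaw s) =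
      ((Real.exp (-(t ^ 2 * ∫ x, φ.1 x ^ 2) / 2) : ℝ) : ℂ) := by
  have hm : Measurable fun T : SobolevSpace s =>
      Complex.exp (((t * T.toDistribution.pair φ : ℝ) : ℂ) * Complex.I) := by
    have := SobolevSpace.measurable_pair (s := s) φ
    fun_prop
  have h1 := (hasLaw_ofCoeff hs).integral_comp hm.aestronglyMeasurable
  rw [← h1]
  have h2 : Tendsto (fun F : Finset (Fin 2 → ℤ) => ∫ g, Complex.exp
      (((∑ n ∈ F, (t * smoothCoeff φ n) * g n : ℝ) : ℂ) * Complex.I) ∂gaussianCoeff) atTop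
      (𝓝 (∫ g, ((fun T : SobolevSpace s =>
        Complex.exp (((t * T.toDistribution.pair φ : ℝ) : ℂ) * Complex.I)) ∘
          SobolevSpace.ofCoeff s) g ∂gaussianCoeff)) := by
    refine tendsto_integral_filter_of_dominated_convergence (fun _ => 1)
      (Eventually.of_forall fun F => ?_) (Eventually.of_forall fun F =>
        Eventually.of_forall fun g => ?_) (integrable_const _) ?_
    · exact Measurable.aestronglyMeasurable (by fun_prop)
    · rw [Complex.norm_exp_ofReal_mul_I]
    · filter_upwards [ae_summable_gaussianCoeff hs] with g hg
      have h3 : HasSum (fun n => smoothCoeff φ n *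
          casCoeff (SobolevSpace.ofCoeff s g).toDistribution n)
          ((SobolevSpace.ofCoeff s g).toDistribution.pair φ) :=
        (SobolevSpace.ofCoeff s g).toDistribution.hasSum_pair φ
      simp only [SobolevSpace.casCoeff_ofCoeff hg] at h3
      have h4 := h3.mul_left t
      simp only [← mul_assoc] at h4
      have hc : Continuous fun x : ℝ => Complex.exp ((x : ℂ) * Complex.I) := by fun_prop
      exact (hc.tendsto _).comp h4
  refine tendsto_nhds_unique h2 ?_
  simp only [integral_cexp_sum_gaussianCoeff]
  have h5 := (hasSum_smoothCoeff_sq φ).mul_left (t ^ 2)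
  have hc : Continuous fun x : ℝ => ((Real.exp (-x / 2) : ℝ) : ℂ) := by fun_prop
  have h6 := (hc.tendsto _).comp h5
  refine h6.congr fun F => ?_
  simp only [Function.comp_apply, mul_pow]

lemma hasLaw_pair_whiteNoiseLaw (hs : s < -1) (φ : SmoothTorusFn) :
    HasLaw (fun T : SobolevSpace s => T.toDistribution.pair φ)
      (gaussianReal 0 (Real.toNNReal (∫ x, φ.1 x ^ 2))) (whiteNoiseLaw s) := by
  have hp := isProbabilityMeasure_whiteNoiseLaw hs
  have hm := SobolevSpace.measurable_pair (s := s) φ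
  refine ⟨hm.aemeasurable, ?_⟩
  have := Measure.isProbabilityMeasure_map (μ := whiteNoiseLaw s) hm.aemeasurable
  refine Measure.ext_of_charFun (funext fun t => ?_)
  rw [charFun_apply_real, charFun_gaussianReal, integral_map hm.aemeasurable
    (Continuous.aestronglyMeasurable (by fun_prop))]
  have h := integral_cexp_pair_whiteNoiseLaw hs φ t
  simp only [Complex.ofReal_mul] at h
  rw [h, Complex.ofReal_exp, Real.coe_toNNReal _ (integral_nonneg fun x => sq_nonneg _)]
  congr 1
  push_cast
  ring

lemma isWhiteNoise_whiteNoiseLaw (hs : s < -1) :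
    IsWhiteNoise (fun T : SobolevSpace s => T.toDistribution) (whiteNoiseLaw s) := by
  refine ⟨hasLaw_pair_whiteNoiseLaw hs, fun φ ψ => ?_⟩
  have hsq : ∀ φ : SmoothTorusFn, Integrable
      (fun T : SobolevSpace s => T.toDistribution.pair φ ^ 2) (whiteNoiseLaw s) ∧
      ∫ T, T.toDistribution.pair φ ^ 2 ∂(whiteNoiseLaw s) = ∫ x, φ.1 x ^ 2 := fun φ => by
    have h := hasLaw_pair_whiteNoiseLaw hs φ
    have hi := integrable_sq_gaussianReal (Real.toNNReal (∫ x, φ.1 x ^ 2))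
    constructor
    · rw [← h.map_eq] at hi
      exact hi.comp_aemeasurable h.aemeasurable
    · have h2 := h.integral_comp hi.aestronglyMeasurable
      rw [integral_sq_gaussianReal, Real.coe_toNNReal _ (integral_nonneg fun x => sq_nonneg _)] at h2
      exact h2
  have hint : ∀ φ : SmoothTorusFn, Integrable fun x => φ.1 x ^ 2 := fun φ =>
    integrable_of_continuous ((continuous_smoothTorusFn φ).pow 2)
  -- Polarisation: the covariance is recovered from the variances of the sum and the difference.
  have e1 : ∀ T : SobolevSpace s, T.toDistribution.pair φ * T.toDistribution.pair ψ =
      1 / 4 * (T.toDistribution.pair (φ + ψ) ^ 2 - T.toDistribution.pair (φ - ψ) ^ 2) := fun T => by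
    rw [T.toDistribution.pair_add_right, T.toDistribution.pair_sub_right]; ring
  have e2 : ∀ x, φ.1 x * ψ.1 x = 1 / 4 * ((φ + ψ).1 x ^ 2 - (φ - ψ).1 x ^ 2) := fun x => by
    change _ = 1 / 4 * ((φ.1 x + ψ.1 x) ^ 2 - (φ.1 x - ψ.1 x) ^ 2)
    ring
  simp only [e1, e2]
  rw [integral_const_mul, integral_const_mul, integral_sub (hsq _).1 (hsq _).1,
    integral_sub (hint _) (hint _), (hsq _).2, (hsq _).2]

end Noise
end


noncomputable section

/-! ### Convergence in law in Sobolev spaces from characteristic functionals -/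

section Criterion

variable {s : ℝ}

open SobolevSpace

lemma lintegral_dist_sq_trigPoly_le {μ : Measure (SobolevSpace s)} {B : ENNReal}
    (h : ∀ n, ∫⁻ T, ENNReal.ofReal (casCoeff T.toDistribution n ^ 2) ∂μ ≤ B)
    (F : Finset (Fin 2 → ℤ)) :
    ∫⁻ T, ENNReal.ofReal (dist (trigPoly s F (coeffVec F T)) T ^ 2) ∂μ ≤
      (∑' n, if n ∈ F then 0 else ENNReal.ofReal (sobolevWeight s n)) * B := by
  have hm : ∀ n, Measurable fun T : SobolevSpace s =>
      ENNReal.ofReal (casCoeff T.toDistribution n ^ 2) := fun n =>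
    ((continuous_casCoeff n).measurable.pow_const 2).ennreal_ofReal
  have h1 : ∀ T : SobolevSpace s, ENNReal.ofReal (dist (trigPoly s F (coeffVec F T)) T ^ 2) =
      ∑' n, (if n ∈ F then 0 else ENNReal.ofReal (sobolevWeight s n)) *
        ENNReal.ofReal (casCoeff T.toDistribution n ^ 2) := fun T => by
    have h2 := hasSum_dist_sq_trigPoly_coeffVec F T
    rw [← h2.tsum_eq, ENNReal.ofReal_tsum_of_nonneg (fun n => ?_) h2.summable]
    · refine tsum_congr fun n => ?_
      split_ifs
      · simp
      · exact ENNReal.ofReal_mul (sobolevWeight_nonneg s n)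
    · split_ifs
      · exact le_rfl
      · exact mul_nonneg (sobolevWeight_nonneg s n) (sq_nonneg _)
  simp only [h1]
  rw [lintegral_tsum fun n => ((hm n).const_mul _).aemeasurable, ← ENNReal.tsum_mul_right]
  refine ENNReal.tsum_le_tsum fun n => ?_
  rw [lintegral_const_mul _ (hm n)]
  gcongr
  exact h n

/-- The sum of the Sobolev weights of the frequencies outside `F`. -/
def weightTail (s : ℝ) (F : Finset (Fin 2 → ℤ)) : ℝ :=
  ∑' n, if n ∈ F then 0 else sobolevWeight s n

lemma summable_weightTail (hs : s < -1) (F : Finset (Fin 2 → ℤ)) :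
    Summable fun n => if n ∈ F then 0 else sobolevWeight s n := by
  refine Summable.of_nonneg_of_le (fun n => ?_) (fun n => ?_) (summable_sobolevWeight hs) <;>
  split_ifs <;> first | exact le_rfl | exact sobolevWeight_nonneg s n

lemma tendsto_weightTail (hs : s < -1) : Tendsto (weightTail s) atTop (𝓝 0) := by
  have h3 : ∀ F : Finset (Fin 2 → ℤ), weightTail s F =
      ∑' n, sobolevWeight s n - ∑ n ∈ F, sobolevWeight s n := fun F => by
    have h4 := hasSum_sum_of_ne_finset_zero (f := fun n => if n ∈ F then
      sobolevWeight s n else 0) (s := F)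
      (L := SummationFilter.unconditional _) (fun n hn => by simp [hn])
    rw [Finset.sum_congr rfl fun n (hn : n ∈ F) => if_pos hn] at h4
    have h5 := ((summable_weightTail hs F).hasSum.add h4).unique
      ((summable_sobolevWeight hs).hasSum.congr_fun fun n => by split_ifs <;> simp)
    rw [weightTail]
    linarith
  have h6 := (tendsto_const_nhds (x := ∑' n, sobolevWeight s n)).sub
    (summable_sobolevWeight hs).hasSum
  rw [sub_self] at h6
  exact h6.congr fun F => (h3 F).symm

/-- Replacing `T` by its truncation to `F` costs at most the Lipschitz constant times a distance
whose mean square is bounded by the weight tail times `B`. The bound does not otherwise depend on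
`μ`, so it serves a whole sequence of laws. -/
lemma abs_integral_sub_integral_trigPoly_le (hs : s < -1) {μ : Measure (SobolevSpace s)}
    [IsProbabilityMeasure μ] {B : ℝ} (hB : 0 ≤ B)
    (h : ∀ n, ∫⁻ T, ENNReal.ofReal (casCoeff T.toDistribution n ^ 2) ∂μ ≤ ENNReal.ofReal B)
    {f : SobolevSpace s → ℝ} {L : NNReal} (hL : LipschitzWith L f) {C : ℝ}
    (hC : ∀ x y, dist (f x) (f y) ≤ C) (F : Finset (Fin 2 → ℤ)) {η : ℝ} (hη : 0 < η) :
    |∫ T, f T ∂μ - ∫ T, f (trigPoly s F (coeffVec F T)) ∂μ| ≤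
      η + (L : ℝ) ^ 2 * (weightTail s F * B) / (4 * η) := by
  have hπ : Continuous fun T : SobolevSpace s => trigPoly s F (coeffVec F T) :=
    (continuous_trigPoly hs F).comp (continuous_coeffVec F)
  have hD : Continuous fun T : SobolevSpace s => dist (trigPoly s F (coeffVec F T)) T ^ 2 :=
    (hπ.dist continuous_id).pow 2
  have hl : ∫⁻ T, ENNReal.ofReal (dist (trigPoly s F (coeffVec F T)) T ^ 2) ∂μ ≤
      ENNReal.ofReal (weightTail s F * B) := by
    refine (lintegral_dist_sq_trigPoly_le h F).trans (le_of_eq ?_)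
    rw [weightTail, ENNReal.ofReal_mul' hB, ENNReal.ofReal_tsum_of_nonneg (fun n => ?_)
      (summable_weightTail hs F)]
    · congr 1
      refine tsum_congr fun n => ?_
      split_ifs <;> simp
    · split_ifs <;> first | exact le_rfl | exact sobolevWeight_nonneg s n
  have hw : 0 ≤ weightTail s F * B := by
    refine mul_nonneg (tsum_nonneg fun n => ?_) hB
    split_ifs <;> first | exact le_rfl | exact sobolevWeight_nonneg s n
  have hDi : Integrable (fun T => dist (trigPoly s F (coeffVec F T)) T ^ 2) μ := by
    refine ⟨hD.aestronglyMeasurable, ?_⟩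
    rw [hasFiniteIntegral_iff_ofReal (Eventually.of_forall fun T => sq_nonneg _)]
    exact hl.trans_lt ENNReal.ofReal_lt_top
  have hDle : ∫ T, dist (trigPoly s F (coeffVec F T)) T ^ 2 ∂μ ≤ weightTail s F * B := by
    rw [← ofReal_integral_eq_lintegral_ofReal hDi (Eventually.of_forall fun T => sq_nonneg _)] at hl
    exact (ENNReal.ofReal_le_ofReal_iff hw).mp hl
  have hfb : ∀ x, ‖f x‖ ≤ ‖f 0‖ + C := fun x => by
    have h1 := hC x 0
    rw [Real.dist_eq, ← Real.norm_eq_abs] at h1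
    linarith [norm_sub_norm_le (f x) (f 0)]
  have hfi : Integrable f μ := Integrable.of_bound hL.continuous.aestronglyMeasurable _
    (Eventually.of_forall hfb)
  have hfπ : Integrable (fun T => f (trigPoly s F (coeffVec F T))) μ :=
    Integrable.of_bound (hL.continuous.comp hπ).aestronglyMeasurable _
      (Eventually.of_forall fun T => hfb _)
  rw [← integral_sub hfi hfπ]
  have hpt : ∀ T, ‖f T - f (trigPoly s F (coeffVec F T))‖ ≤
      η + (L : ℝ) ^ 2 / (4 * η) * dist (trigPoly s F (coeffVec F T)) T ^ 2 := fun T => by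
    have h1 := hL.dist_le_mul T (trigPoly s F (coeffVec F T))
    rw [dist_comm T, Real.dist_eq] at h1
    refine h1.trans ?_
    set d := dist (trigPoly s F (coeffVec F T)) T
    -- Young's inequality `L d ≤ η + (L d)²/(4η)` converts the distance into its controlled square.
    have h2 : (L : ℝ) * d ≤ (4 * η ^ 2 + ((L : ℝ) * d) ^ 2) / (4 * η) := by
      rw [le_div_iff₀ (by positivity)]
      nlinarith [sq_nonneg (2 * η - (L : ℝ) * d)]
    refine h2.trans_eq ?_
    field_simp
  have h1 := norm_integral_le_of_norm_le
    ((integrable_const η).add (hDi.const_mul ((L : ℝ) ^ 2 / (4 * η)))) (Eventually.of_forall hpt)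
  have h2 : ∫ T, (η + (L : ℝ) ^ 2 / (4 * η) * dist (trigPoly s F (coeffVec F T)) T ^ 2) ∂μ =
      η + (L : ℝ) ^ 2 / (4 * η) * ∫ T, dist (trigPoly s F (coeffVec F T)) T ^ 2 ∂μ := by
    rw [integral_add (integrable_const η) (hDi.const_mul _), integral_const_mul]
    simp
  refine h1.trans ((le_of_eq h2).trans ?_)
  rw [mul_div_right_comm]
  gcongr

/-- The characteristic function of a coefficient vector is the characteristic functional at a
trigonometric polynomial, so Lévy's continuity theorem applies. -/
lemma inner_coeffVec (F : Finset (Fin 2 → ℤ)) (T : SobolevSpace s) (t : EuclideanSpace ℝ F) :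
    inner ℝ (coeffVec F T) t = T.toDistribution.pair (∑ n : F, t n • torusCas n.1) := by
  rw [T.toDistribution.pair_sum_right, PiLp.inner_apply]
  refine Finset.sum_congr rfl fun n _ => ?_
  rw [T.toDistribution.pair_smul_right]
  rfl

/-- Convergence in law in `H^s`, `s < -1`, follows from bounds on the second moments of the
coefficients and from the convergence of the characteristic functional. -/
theorem tendsto_of_tendsto_charFunctional (hs : s < -1) {μs : ℕ → ProbabilityMeasure (SobolevSpace s)}
    {μ : ProbabilityMeasure (SobolevSpace s)} {B : ℝ} (hB : 0 ≤ B)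
    (hμs : ∀ N n, ∫⁻ T, ENNReal.ofReal (casCoeff T.toDistribution n ^ 2)
      ∂(μs N : Measure (SobolevSpace s)) ≤ ENNReal.ofReal B)
    (hμ : ∀ n, ∫⁻ T, ENNReal.ofReal (casCoeff T.toDistribution n ^ 2)
      ∂(μ : Measure (SobolevSpace s)) ≤ ENNReal.ofReal B)
    (hφ : ∀ φ : SmoothTorusFn, Tendsto (fun N => ∫ T, Complex.exp
      ((T.toDistribution.pair φ : ℂ) * Complex.I) ∂(μs N : Measure (SobolevSpace s))) atTop
      (𝓝 (∫ T, Complex.exp ((T.toDistribution.pair φ : ℂ) * Complex.I)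
        ∂(μ : Measure (SobolevSpace s))))) :
    Tendsto μs atTop (𝓝 μ) := by
  have hcv : ∀ F : Finset (Fin 2 → ℤ), Tendsto
      (fun N => (μs N).map (continuous_coeffVec F).aemeasurable) atTop
      (𝓝 (μ.map (continuous_coeffVec F).aemeasurable)) := fun F => by
    refine ProbabilityMeasure.tendsto_of_tendsto_charFun fun t => ?_
    have h1 : ∀ ν : ProbabilityMeasure (SobolevSpace s),
        charFun ((ν.map (continuous_coeffVec F).aemeasurable :
          ProbabilityMeasure (EuclideanSpace ℝ F)) : Measure (EuclideanSpace ℝ F)) t =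
        ∫ T, Complex.exp ((T.toDistribution.pair (∑ n : F, t n • torusCas n.1) : ℂ) * Complex.I)
          ∂(ν : Measure (SobolevSpace s)) := fun ν => by
      rw [charFun_apply, ProbabilityMeasure.toMeasure_map,
        integral_map (continuous_coeffVec F).aemeasurable
          (Continuous.aestronglyMeasurable (by fun_prop))]
      simp only [inner_coeffVec]
    simp only [h1]
    exact hφ _
  rw [tendsto_iff_forall_lipschitz_integral_tendsto]
  rintro f ⟨C, hC⟩ ⟨L, hL⟩
  have hF : ∀ F : Finset (Fin 2 → ℤ), Tendsto
      (fun N => ∫ T, f (trigPoly s F (coeffVec F T)) ∂(μs N : Measure (SobolevSpace s))) atTop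
      (𝓝 (∫ T, f (trigPoly s F (coeffVec F T)) ∂(μ : Measure (SobolevSpace s)))) := fun F => by
    have hfc : Continuous fun v => f (trigPoly s F v) :=
      hL.continuous.comp (continuous_trigPoly hs F)
    let b : BoundedContinuousFunction (EuclideanSpace ℝ F) ℝ :=
      ⟨⟨fun v => f (trigPoly s F v), hfc⟩, C, fun v w => hC _ _⟩
    have h1 := (ProbabilityMeasure.tendsto_iff_forall_integral_tendsto.mp (hcv F)) b
    have h2 : ∀ ν : ProbabilityMeasure (SobolevSpace s),
        ∫ v, b v ∂((ν.map (continuous_coeffVec F).aemeasurable :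
          ProbabilityMeasure (EuclideanSpace ℝ F)) : Measure (EuclideanSpace ℝ F)) =
        ∫ T, f (trigPoly s F (coeffVec F T)) ∂(ν : Measure (SobolevSpace s)) := fun ν => by
      rw [ProbabilityMeasure.toMeasure_map]
      exact integral_map (continuous_coeffVec F).aemeasurable hfc.aestronglyMeasurable
    simp only [h2] at h1
    exact h1
  rw [Metric.tendsto_atTop]
  intro ε hε
  -- Each of the two truncation errors will be below `2ε/5` and the finite-dimensional error below
  -- `ε/5`.
  have hη : 0 < ε / 5 := by positivity
  have htail : Tendsto (fun F => ε / 5 + (L : ℝ) ^ 2 * (weightTail s F * B) / (4 * (ε / 5))) atTop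
      (𝓝 (ε / 5 + (L : ℝ) ^ 2 * (0 * B) / (4 * (ε / 5)))) :=
    ((((tendsto_weightTail hs).mul_const B).const_mul _).div_const _).const_add _
  rw [zero_mul, mul_zero, zero_div, add_zero] at htail
  obtain ⟨F, hFt⟩ := (htail.eventually (gt_mem_nhds (show ε / 5 < 2 * (ε / 5) by linarith))).exists
  obtain ⟨N₀, hN₀⟩ := Metric.tendsto_atTop.mp (hF F) (ε / 5) hη
  refine ⟨N₀, fun N hN => ?_⟩
  have h1 := abs_integral_sub_integral_trigPoly_le hs hB (hμs N) hL hC F hη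
  have h2 := abs_integral_sub_integral_trigPoly_le hs hB hμ hL hC F hη
  have h3 := hN₀ N hN
  rw [Real.dist_eq] at h3 ⊢
  rw [abs_le] at h1 h2
  rw [abs_lt] at h3 ⊢
  constructor <;> linarith [h1.1, h1.2, h2.1, h2.2, h3.1, h3.2]

end Criterion

/-! ### Central limit theorem for the vortices at a fixed time -/

section PointVortexLimit

/-- Integrating the intensities first gives the Gaussian factor `∏ exp(-φ(x_i)²/(2N))`; independence
of the positions turns its integral into an `N`-th power. -/
lemma integral_cexp_pair_vortexLaw (N : ℕ) {φ : Torus → ℝ} (hφ : Continuous φ) :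
    ∫ p : (Fin N → ℝ) × (Fin N → Torus), Complex.exp
      ((((√(N : ℝ))⁻¹ * ∑ i, p.1 i * φ (p.2 i) : ℝ) : ℂ) * Complex.I) ∂(vortexLaw N) =
      (((∫ x, Real.exp (-((N : ℝ)⁻¹ * φ x ^ 2) / 2)) ^ N : ℝ) : ℂ) := by
  have hc : Continuous fun p : (Fin N → ℝ) × (Fin N → Torus) => Complex.exp
      ((((√(N : ℝ))⁻¹ * ∑ i, p.1 i * φ (p.2 i) : ℝ) : ℂ) * Complex.I) := by fun_prop
  have hi : Integrable (fun p : (Fin N → ℝ) × (Fin N → Torus) => Complex.exp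
      ((((√(N : ℝ))⁻¹ * ∑ i, p.1 i * φ (p.2 i) : ℝ) : ℂ) * Complex.I))
      ((stdGaussianPi N).prod volume) :=
    Integrable.of_bound hc.aestronglyMeasurable 1
      (Eventually.of_forall fun p => (Complex.norm_exp_ofReal_mul_I _).le)
  have h1 : ∀ x : Fin N → Torus, ∫ ξ : Fin N → ℝ, Complex.exp
      ((((√(N : ℝ))⁻¹ * ∑ i, ξ i * φ (x i) : ℝ) : ℂ) * Complex.I) ∂(stdGaussianPi N) =
      ((∏ i, Real.exp (-((N : ℝ)⁻¹ * φ (x i) ^ 2) / 2) : ℝ) : ℂ) := fun x => by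
    have h2 := integral_cexp_sum_gaussian fun i : Fin N => (√(N : ℝ))⁻¹ * φ (x i)
    rw [← Real.exp_sum]
    have h3 : -(∑ i, ((√(N : ℝ))⁻¹ * φ (x i)) ^ 2) / 2 =
        ∑ i, -((N : ℝ)⁻¹ * φ (x i) ^ 2) / 2 := by
      rw [← Finset.sum_div, ← Finset.sum_neg_distrib]
      simp only [mul_pow, inv_pow, Real.sq_sqrt (Nat.cast_nonneg N)]
    rw [h3] at h2
    rw [← h2]
    refine integral_congr_ae (Eventually.of_forall fun ξ => ?_)
    simp only [Finset.mul_sum]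
    congr 3
    exact Finset.sum_congr rfl fun i _ => by ring
  have h4 := integral_prod_symm _ hi
  rw [vortexLaw]
  refine h4.trans ?_
  simp only [h1]
  rw [integral_complex_ofReal]
  congr 1
  have h5 := integral_fintype_prod_volume_eq_pow (ι := Fin N)
    (fun x : Torus => Real.exp (-((N : ℝ)⁻¹ * φ x ^ 2) / 2))
  rw [Fintype.card_fin] at h5
  exact h5

lemma tendsto_mul_exp_sub_one (u : ℝ) :
    Tendsto (fun N : ℕ => (N : ℝ) * (Real.exp (-((N : ℝ)⁻¹ * u) / 2) - 1)) atTop (𝓝 (-u / 2)) := by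
  have h1 : HasDerivAt (fun x : ℝ => Real.exp (-(x * u) / 2)) (-u / 2) 0 := by
    have h2 : HasDerivAt (fun x : ℝ => -(x * u) / 2) (-(1 * u) / 2) 0 :=
      (((hasDerivAt_id (0 : ℝ)).mul_const u).neg).div_const 2
    simpa using h2.exp
  have h3 := h1.tendsto_slope_zero_right.comp tendsto_inv_atTop_nhdsGT_zero
  have h4 := h3.comp (tendsto_natCast_atTop_atTop (R := ℝ))
  refine h4.congr fun N => ?_
  simp

/-- The integral is `1 + a_N / N` with `a_N → -∫φ²/2`, by dominated convergence with `φ²/2` as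
majorant, and `(1 + a_N / N)^N` tends to the exponential of the limit. -/
lemma tendsto_integral_exp_pow {φ : Torus → ℝ} (hφ : Continuous φ) :
    Tendsto (fun N : ℕ => (∫ x, Real.exp (-((N : ℝ)⁻¹ * φ x ^ 2) / 2)) ^ N) atTop
      (𝓝 (Real.exp (-(∫ x, φ x ^ 2) / 2))) := by
  have hi : ∀ N : ℕ, Integrable fun x => Real.exp (-((N : ℝ)⁻¹ * φ x ^ 2) / 2) := fun N =>
    integrable_of_continuous (by fun_prop)
  have hlim : Tendsto (fun N : ℕ => ∫ x, (N : ℝ) * (Real.exp (-((N : ℝ)⁻¹ * φ x ^ 2) / 2) - 1))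
      atTop (𝓝 (∫ x, -φ x ^ 2 / 2)) := by
    refine tendsto_integral_of_dominated_convergence (fun x => φ x ^ 2 / 2)
      (fun N => Continuous.aestronglyMeasurable (by fun_prop))
      (integrable_of_continuous (by fun_prop)) (fun N => Eventually.of_forall fun x => ?_)
      (Eventually.of_forall fun x => ?_)
    · rcases Nat.eq_zero_or_pos N with rfl | hN
      · rw [Nat.cast_zero, zero_mul, norm_zero]
        positivity
      · have hN' : (0 : ℝ) < N := by exact_mod_cast hN
        have h1 := Real.add_one_le_exp (-((N : ℝ)⁻¹ * φ x ^ 2) / 2)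
        have h2 : Real.exp (-((N : ℝ)⁻¹ * φ x ^ 2) / 2) ≤ 1 := Real.exp_le_one_iff.mpr (by
          have : 0 ≤ (N : ℝ)⁻¹ * φ x ^ 2 := by positivity
          linarith)
        rw [Real.norm_eq_abs, abs_mul, abs_of_pos hN', abs_of_nonpos (sub_nonpos.mpr h2)]
        calc (N : ℝ) * -(Real.exp (-((N : ℝ)⁻¹ * φ x ^ 2) / 2) - 1)
            ≤ N * ((N : ℝ)⁻¹ * φ x ^ 2 / 2) := by gcongr; linarith
          _ = _ := by field_simp
    · have := tendsto_mul_exp_sub_one (φ x ^ 2)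
      exact this
  have h2 : ∀ N : ℕ, ∫ x, (N : ℝ) * (Real.exp (-((N : ℝ)⁻¹ * φ x ^ 2) / 2) - 1) =
      (N : ℝ) * ((∫ x, Real.exp (-((N : ℝ)⁻¹ * φ x ^ 2) / 2)) - 1) := fun N => by
    rw [integral_const_mul, integral_sub (hi N) (integrable_const 1)]
    simp
  have h3 : ∫ x, -φ x ^ 2 / 2 = -(∫ x, φ x ^ 2) / 2 := by
    rw [integral_div, integral_neg]
  simp only [h2, h3] at hlim
  have h4 := Real.tendsto_one_add_pow_exp_of_tendsto hlim
  exact h4.congr fun N => by rw [add_sub_cancel]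

/-- The law of the normalised measure of `N` independent vortices in `H^{-1-δ}`. -/
def pointVortexSobolevLaw {δ : ℝ} (hδ : 0 < δ) (N : ℕ) :
    ProbabilityMeasure (SobolevSpace (-1 - δ)) :=
  ⟨(vortexLaw N).map (pointVortexSobolev hδ),
    Measure.isProbabilityMeasure_map (continuous_pointVortexSobolev hδ).aemeasurable⟩

lemma lintegral_casCoeff_whiteNoiseLaw_le {s : ℝ} (hs : s < -1) (n : Fin 2 → ℤ) :
    ∫⁻ T, ENNReal.ofReal (casCoeff T.toDistribution n ^ 2) ∂(whiteNoiseLaw s) ≤ 1 := by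
  have hm : Measurable fun T : SobolevSpace s =>
      ENNReal.ofReal (casCoeff T.toDistribution n ^ 2) :=
    ((SobolevSpace.continuous_casCoeff n).measurable.pow_const 2).ennreal_ofReal
  rw [whiteNoiseLaw, lintegral_map' hm.aemeasurable (aemeasurable_ofCoeff hs),
    ← lintegral_sq_gaussianCoeff n]
  refine lintegral_mono_ae ?_
  filter_upwards [ae_summable_gaussianCoeff hs] with g hg
  rw [SobolevSpace.casCoeff_ofCoeff hg]

lemma tendsto_pointVortexSobolevLaw {δ : ℝ} (hδ : 0 < δ) (hs : -1 - δ < -1) :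
    Tendsto (pointVortexSobolevLaw hδ) atTop
      (𝓝 ⟨whiteNoiseLaw (-1 - δ), isProbabilityMeasure_whiteNoiseLaw hs⟩) := by
  -- The same constant must bound the second moments of the vortex coefficients, where it is the
  -- case `k = 1`, `M = 2` of `lintegral_pair_pow_le`, and those of white noise, which are at most
  -- `1`.
  have hB : (1 : ℝ) ≤ (2 * 1 : ℕ).factorial * (2 * Real.exp (2 ^ 2 / 2)) := by
    have h := Real.one_le_exp (show (0 : ℝ) ≤ 2 ^ 2 / 2 by norm_num)
    have h' : ((2 * 1 : ℕ).factorial : ℝ) = 2 := by norm_num [Nat.factorial]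
    rw [h']
    linarith
  refine tendsto_of_tendsto_charFunctional hs (zero_le_one.trans hB) (fun N n => ?_) (fun n => ?_)
    fun φ => ?_
  · have hm : Measurable fun T : SobolevSpace (-1 - δ) =>
        ENNReal.ofReal (casCoeff T.toDistribution n ^ 2) :=
      ((SobolevSpace.continuous_casCoeff n).measurable.pow_const 2).ennreal_ofReal
    have h1 := lintegral_map hm (continuous_pointVortexSobolev (N := N) hδ).measurable
      (μ := vortexLaw N)
    have h2 := lintegral_pair_pow_le (N := N) (continuous_smoothTorusFn (torusCas n))
      (abs_torusCas_le n) 1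
    simp only [casCoeff_pointVortexSobolev] at h1
    rw [mul_one] at h2
    exact h1.trans_le h2
  · refine (lintegral_casCoeff_whiteNoiseLaw_le hs n).trans ?_
    rw [← ENNReal.ofReal_one]
    exact ENNReal.ofReal_le_ofReal hB
  · have hm : Measurable fun T : SobolevSpace (-1 - δ) =>
        Complex.exp ((T.toDistribution.pair φ : ℂ) * Complex.I) := by
      have := SobolevSpace.measurable_pair (s := -1 - δ) φ
      fun_prop
    have h1 : ∀ N, ∫ T, Complex.exp ((T.toDistribution.pair φ : ℂ) * Complex.I)
        ∂(pointVortexSobolevLaw hδ N : Measure (SobolevSpace (-1 - δ))) =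
        (((∫ x, Real.exp (-((N : ℝ)⁻¹ * φ.1 x ^ 2) / 2)) ^ N : ℝ) : ℂ) := fun N => by
      have h2 := integral_map (continuous_pointVortexSobolev (N := N) hδ).aemeasurable
        (μ := vortexLaw N) hm.aestronglyMeasurable
      simp only [pair_pointVortexSobolev] at h2
      exact h2.trans (integral_cexp_pair_vortexLaw N (continuous_smoothTorusFn φ))
    have h3 := integral_cexp_pair_whiteNoiseLaw hs φ 1
    simp only [one_mul, one_pow] at h3
    simp only [h1]
    have h4 := tendsto_integral_exp_pow (continuous_smoothTorusFn φ)
    have h5 := (Complex.continuous_ofReal.tendsto _).comp h4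
    rw [← h3] at h5
    exact h5

end PointVortexLimit
end


noncomputable section

/-! ### Transfer to an arbitrary probability space and the main theorem -/

section Transfer

variable {Ω 𝓧 : Type*} [MeasurableSpace Ω] [MeasurableSpace 𝓧] {Z : Ω → 𝓧} {μ : Measure 𝓧}
  {P : Measure Ω}

lemma HasLaw.integrable_comp (hZ : HasLaw Z μ P) {f : 𝓧 → ℝ} (hf : Integrable f μ) :
    Integrable (fun ω => f (Z ω)) P := by
  rw [← hZ.map_eq] at hf
  exact hf.comp_aemeasurable hZ.aemeasurable

lemma HasLaw.ae_comp (hZ : HasLaw Z μ P) {p : 𝓧 → Prop} (hp : ∀ᵐ x ∂μ, p x) :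
    ∀ᵐ ω ∂P, p (Z ω) := by
  rw [← hZ.map_eq] at hp
  exact ae_of_ae_map hZ.aemeasurable hp

end Transfer

section VortexLaw

variable {N : ℕ} {K : Torus → Plane} {b : ℝ} {g : Torus → ℝ} {Ω : Type*} [MeasurableSpace Ω]
  {P : Measure Ω} {Z : Ω → (Fin N → ℝ) × (Fin N → Torus)}

lemma hasLaw_vortexMap (hg : IsGreenPair K b g) (hK : Integrable fun p => ‖K p‖)
    (hZ : HasLaw Z (vortexLaw N) P) {t : ℝ} (ht : 0 ≤ t) :
    HasLaw (fun ω => vortexMap K t (Z ω)) (vortexLaw N) P :=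
  HasLaw.fun_comp ⟨aemeasurable_vortexMap hg hK ht, map_vortexMap hg hK ht⟩ hZ

lemma integral_sq_tensorPair_vortexField_le {ε : ℝ} (hε : ε ∈ Ioo (0 : ℝ) 1)
    (hK : IsVortexKernel ε K) (hZ : HasLaw Z (vortexLaw N) P) {t : ℝ} (ht : 0 ≤ t)
    (φ : SmoothTorusFn) :
    Integrable (fun ω => tensorPair (vortexField K (Z ω).1 (Z ω).2 t) (vortexH K φ.1) ^ 2) P ∧
      ∫ ω, tensorPair (vortexField K (Z ω).1 (Z ω).2 t) (vortexH K φ.1) ^ 2 ∂P ≤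
        2 * gaussianFourthMoment * ∫ p, vortexH K φ.1 p ^ 2 := by
  obtain ⟨b, g, hg⟩ := hK.exists_greenPair hε
  have hL := hasLaw_vortexMap hg (hK.integrable_norm hε) hZ ht
  have hi := integrable_sq_tensorPair (N := N) (memLp_vortexH hε hK φ) (vortexH_self φ.1)
  refine ⟨HasLaw.integrable_comp hL hi, ?_⟩
  refine (hL.integral_comp hi.aestronglyMeasurable).trans_le ?_
  exact integral_sq_tensorPair_le (memLp_vortexH hε hK φ) (vortexH_self φ.1)
    (vortexH_swap hK.odd φ.1)

lemma integral_norm_vortexField_rpow_le (hg : IsGreenPair K b g) (hK : Integrable fun p => ‖K p‖)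
    (hZ : HasLaw Z (vortexLaw N) P) {t : ℝ} (ht : 0 ≤ t) {p δ : ℝ} (hp : 1 ≤ p) (hδ : 0 < δ) :
    Integrable (fun ω => ‖measureSobolev (vortexField K (Z ω).1 (Z ω).2 t) hδ‖ ^ p) P ∧
      ∫ ω, ‖measureSobolev (vortexField K (Z ω).1 (Z ω).2 t) hδ‖ ^ p ∂P ≤
        1 + sobolevMomentBound (-1 - δ) ⌈p⌉₊ := by
  have hL := hasLaw_vortexMap hg hK hZ ht
  have hi := integrable_norm_pointVortexSobolev_rpow (N := N) hδ hp
  exact ⟨HasLaw.integrable_comp hL hi.1,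
    (hL.integral_comp hi.1.aestronglyMeasurable).trans_le hi.2⟩

/-- By invariance this law is independent of `t`, so the limit theorem at any time reduces to the
static one. -/
lemma hasLaw_vortexField (hg : IsGreenPair K b g) (hK : Integrable fun p => ‖K p‖)
    (hZ : HasLaw Z (vortexLaw N) P) {t : ℝ} (ht : 0 ≤ t) {δ : ℝ} (hδ : 0 < δ) :
    HasLaw (fun ω => measureSobolev (vortexField K (Z ω).1 (Z ω).2 t) hδ)
      (pointVortexSobolevLaw hδ N : Measure (SobolevSpace (-1 - δ))) P := by
  have h1 : HasLaw (pointVortexSobolev (N := N) hδ)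
      (pointVortexSobolevLaw hδ N : Measure (SobolevSpace (-1 - δ))) (vortexLaw N) :=
    ⟨(continuous_pointVortexSobolev hδ).aemeasurable, rfl⟩
  have h2 := h1.fun_comp (hasLaw_vortexMap hg hK hZ ht)
  exact h2

end VortexLaw

lemma tendstoInDistribution_vortexField {K : Torus → Plane} {b : ℝ} {g : Torus → ℝ}
    (hg : IsGreenPair K b g) (hK : Integrable fun p => ‖K p‖) {Ω : ℕ → Type*}
    [∀ N, MeasurableSpace (Ω N)] {P : ∀ N, Measure (Ω N)} [∀ N, IsProbabilityMeasure (P N)]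
    {Z : ∀ N, Ω N → (Fin N → ℝ) × (Fin N → Torus)} (hZ : ∀ N, HasLaw (Z N) (vortexLaw N) (P N))
    {t : ℝ} (ht : 0 ≤ t) {δ : ℝ} (hδ : 0 < δ) [IsProbabilityMeasure (whiteNoiseLaw (-1 - δ))] :
    TendstoInDistribution
      (fun (N : ℕ) (ω : Ω N) => measureSobolev (vortexField K (Z N ω).1 (Z N ω).2 t) hδ)
      atTop (fun W : SobolevSpace (-1 - δ) => W) P (whiteNoiseLaw (-1 - δ)) where
  forall_aemeasurable N := (hasLaw_vortexField hg hK (hZ N) ht hδ).aemeasurable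
  aemeasurable_limit := aemeasurable_id
  tendsto := by
    have h := tendsto_pointVortexSobolevLaw hδ (by linarith)
    have h1 : ∀ N, pointVortexSobolevLaw hδ N =
        ⟨(P N).map fun ω => measureSobolev (vortexField K (Z N ω).1 (Z N ω).2 t) hδ,
          Measure.isProbabilityMeasure_map
            (hasLaw_vortexField hg hK (hZ N) ht hδ).aemeasurable⟩ := fun N =>
      Subtype.ext (hasLaw_vortexField hg hK (hZ N) ht hδ).map_eq.symm
    have h2 : (⟨whiteNoiseLaw (-1 - δ), inferInstance⟩ :
        ProbabilityMeasure (SobolevSpace (-1 - δ))) =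
        ⟨(whiteNoiseLaw (-1 - δ)).map fun W => W,
          Measure.isProbabilityMeasure_map aemeasurable_id⟩ :=
      Subtype.ext Measure.map_id.symm
    rw [← h2]
    exact h.congr h1

end

theorem mainTheorem2 :
    ∃ (c : ℝ) (C : ℝ → ℝ → ℝ),
    ∀ (ε : ℝ), ε ∈ Ioo (0 : ℝ) 1 → ∀ (K : Torus → Plane), IsVortexKernel ε K →
    ∀ (Ω : ℕ → Type*) [∀ N, MeasurableSpace (Ω N)] (P : ∀ N, Measure (Ω N))
      [∀ N, IsProbabilityMeasure (P N)]
      (ξ : ∀ N, Ω N → Fin N → ℝ) (X₀ : ∀ N, Ω N → Fin N → Torus),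
    (∀ N, HasLaw (fun ω => (ξ N ω, X₀ N ω)) (vortexLaw N) (P N)) →
    -- the dynamics are almost surely the unique global collision-free solution
    (∀ N, 1 ≤ N → ∀ᵐ ω ∂(P N),
      IsVortexSolution K (ξ N ω) (X₀ N ω) (vortexFlow K (ξ N ω) (X₀ N ω)) ∧
      ∀ X, IsVortexSolution K (ξ N ω) (X₀ N ω) X →
        EqOn X (vortexFlow K (ξ N ω) (X₀ N ω)) (Ici 0)) ∧
    -- stationarity in time
    (∀ N, 1 ≤ N → ∀ (m : ℕ) (t : Fin m → ℝ) (h : ℝ), (∀ k, 0 ≤ t k) → 0 ≤ h →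
      IdentDistrib
        (fun ω k => measureDistribution (vortexField K (ξ N ω) (X₀ N ω) (t k + h)))
        (fun ω k => measureDistribution (vortexField K (ξ N ω) (X₀ N ω) (t k))) (P N) (P N)) ∧
    -- homogeneity in space
    (∀ N, 1 ≤ N → ∀ (m : ℕ) (t : Fin m → ℝ) (a : Torus), (∀ k, 0 ≤ t k) →
      IdentDistrib
        (fun ω k => measureDistribution
          ((vortexField K (ξ N ω) (X₀ N ω) (t k)).map (fun x => x + a)))
        (fun ω k => measureDistribution (vortexField K (ξ N ω) (X₀ N ω) (t k))) (P N) (P N)) ∧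
    -- the evolution equation
    (∀ N, 1 ≤ N → ∀ᵐ ω ∂(P N), ∀ t : ℝ, 0 < t → ∀ φ : SmoothTorusFn,
      HasDerivAt
        (fun s => (measureDistribution (vortexField K (ξ N ω) (X₀ N ω) s)).pair φ)
        (1 / 2 * tensorPair (vortexField K (ξ N ω) (X₀ N ω) t) (vortexH K φ.1)) t) ∧
    -- the second moment bound for the nonlinear term
    (∀ N, 1 ≤ N → ∀ t : ℝ, 0 < t → ∀ φ : SmoothTorusFn,
      MemLp (vortexH K φ.1) 2 ∧
      Integrable
        (fun ω => tensorPair (vortexField K (ξ N ω) (X₀ N ω) t) (vortexH K φ.1) ^ 2) (P N) ∧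
      ∫ ω, tensorPair (vortexField K (ξ N ω) (X₀ N ω) t) (vortexH K φ.1) ^ 2 ∂(P N) ≤
        c * ∫ p, vortexH K φ.1 p ^ 2) ∧
    -- moment bounds in negative Sobolev spaces
    (∀ (p δ : ℝ) (_ : 1 ≤ p) (hδ : 0 < δ), ∀ N, 1 ≤ N → ∀ t : ℝ, 0 ≤ t →
      Integrable (fun ω => ‖measureSobolev (vortexField K (ξ N ω) (X₀ N ω) t) hδ‖ ^ p) (P N) ∧
      ∫ ω, ‖measureSobolev (vortexField K (ξ N ω) (X₀ N ω) t) hδ‖ ^ p ∂(P N) ≤ C p δ) ∧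
    -- convergence in law to white noise
    (∀ (δ : ℝ) (hδ : 0 < δ),
      ∃ (μ : Measure (SobolevSpace (-1 - δ))) (_ : IsProbabilityMeasure μ),
        IsWhiteNoise (fun W : SobolevSpace (-1 - δ) => W.toDistribution) μ ∧
        ∀ t : ℝ, 0 < t →
          TendstoInDistribution
            (fun (N : ℕ) (ω : Ω N) => measureSobolev (vortexField K (ξ N ω) (X₀ N ω) t) hδ)
            atTop (fun W : SobolevSpace (-1 - δ) => W) P μ) := by
  -- The factor `2` counts the index pairings. Both constants are fixed before `ε`, `K` and the
  -- probability spaces, so they depend on none of these.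
  refine ⟨2 * gaussianFourthMoment, fun p δ => 1 + sobolevMomentBound (-1 - δ) ⌈p⌉₊,
    fun ε hε K hK Ω _ P _ ξ X₀ hZ => ?_⟩
  obtain ⟨b, g, hg⟩ := hK.exists_greenPair hε
  have hKi := hK.integrable_norm hε
  have hex : ∀ N, ∀ᵐ ω ∂(P N), ∃ X, IsVortexSolution K (ξ N ω) (X₀ N ω) X := fun N =>
    HasLaw.ae_comp (hZ N) (ae_exists_isVortexSolution hg hKi)
  refine ⟨fun N _ => ?_, fun N _ m t h ht hh => ?_, fun N _ m t a ht => ?_, fun N _ => ?_,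
    fun N _ t ht φ => ⟨memLp_vortexH hε hK φ, ?_⟩, fun p δ hp hδ N _ t ht => ?_, fun δ hδ => ?_⟩
  · filter_upwards [hex N] with ω hω
    exact ⟨isVortexSolution_vortexFlow hω,
      fun X hX => hX.eqOn hg (isVortexSolution_vortexFlow hω)⟩
  · exact IdentDistrib.comp_hasLaw (hZ N) (identDistrib_vortexFieldVector_add hg hKi ht hh)
  · exact IdentDistrib.comp_hasLaw (hZ N) (identDistrib_map_vortexFieldVector hg hKi ht a)
  · filter_upwards [hex N] with ω hω t ht φ
    exact hasDerivAt_pair_vortexField hg hω ht φ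
  · exact integral_sq_tensorPair_vortexField_le hε hK (hZ N) ht.le φ
  · exact integral_norm_vortexField_rpow_le hg hKi (hZ N) ht hp hδ
  · have hs : -1 - δ < -1 := by linarith
    have hp := isProbabilityMeasure_whiteNoiseLaw hs
    exact ⟨whiteNoiseLaw (-1 - δ), hp, isWhiteNoise_whiteNoiseLaw hs,
      fun t ht => tendstoInDistribution_vortexField hg hKi hZ ht.le hδ⟩
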